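/- Let $k,n,d\ge 1$, let $P=\{p_1,\dots,p_n\}\subset\mathbb R^d$ be $n$ points (points may coincide), and let $1\le L\le\lfloor n/k\rfloor\le\lceil n/k\rceil\le U\le n$ be integers. A balanced clustering of $P$ consists of a partition of $P$ into clusters $P_1,\dots,P_k$ with $L\le|P_j|\le U$ and centers $c_1,\dots,c_k\in\mathbb R^d$; its cost is $\max_{j}\max_{p\in P_j}\|p-c_j\|$. A $4$-approximation is a balanced clustering whose cost is at most $4$ times the minimum cost of a balanced clustering. For centers $c=(c_1,\dots,c_k)$ and $r\ge0$, and for $T\subseteq\{1,\dots,k\}$, let $n_T$ be the number of input points that lie in exactly those closed balls $B(c_j,r)$ with $j\in T$. The system $\mathrm{SoL}(c,r)$ in variables $x_T^j\ge 0$ ($j\in T$) reads: $\sum_{j\in T}x_T^j=n_T$ for every $T$ (for $T=\emptyset$: every input point is covered by some ball), and $L\le\sum_{T\ni j}x_T^j\le U$ for every $j$. Consider the following algorithm. (1) Select $s_1,\dots,s_k\in P$, where $s_1$ is arbitrary and each later $s_j$ is a point of $P$ with the largest minimum distance to $s_1,\dots,s_{j-1}$ (Gonzalez's algorithm); let $S=\{s_1,\dots,s_k\}$.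 (2) Compute and sort the $nk$ distances between points of $P$ and $s_1,\dots,s_k$. (3) For each of the $k^k$ tuples $(s_{\tau(1)},\dots,s_{\tau(k)})\in S^k$, start with the largest distance as best radius and do a binary search on the sorted distances: probe the middle entry $r$; if $\mathrm{SoL}$ is feasible over the reals for this tuple and $r$, replace the best radius by $r$ if $r$ is smaller and continue to the left, otherwise continue to the right. (4) Take a tuple with the smallest best radius $r$ and an integral solution $y$ of $\mathrm{SoL}$ for this tuple and $r$, and return the tuple as centers together with a clustering that assigns to cluster $j$, for all $T$ and $j\in T$, exactly $y_T^j$ of the $n_T$ points counted for $T$. Then every clustering that this algorithm may return, whatever its choices, is a $4$-approximation. Moreover, the algorithm can be implemented on a real RAM by one program which, for each fixed $k$, has running time $O\big(n(\log n+d)\big)$: for every $k$ there is a constant $C$ such that for all $n,d,L,U,P$ as above the program halts after at most $C\,n(\log n+d)$ steps, its final memory showing a complete run of the algorithm (the points $s_1,\dots,s_k$, the probes and verdicts of the binary searches for all $k^k$ tuples, the returned tuple and the returned clustering). -/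

import Mathlib

/-! ## A real RAM with a step count

The machine has integer variables and integer arrays (with values in `ℕ`), and real variables and
real arrays.  A program is a structured text over the instructions below.  Every constant, variable
access, array access, arithmetic operation, comparison, assignment and control decision costs one
step.  Integers and reals are separate (no rounding, no conversion), integers can be added,
subtracted (truncated at `0`), halved and compared and are the only array indices; reals can be
added, subtracted, multiplied and compared.  A bound proved for this instruction set holds a
fortiori for a real RAM with further unit-cost instructions (division, square roots, ...). -/

namespace RealRAM

/-- Memory contents: variables are numbered, and so are arrays; array cells are indexed by `ℕ`. -/
structure State where
  ivar : ℕ → ℕ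
  iarr : ℕ → ℕ → ℕ
  rvar : ℕ → ℝ
  rarr : ℕ → ℕ → ℝ

/-- Integer expressions. -/
inductive IExpr where
  | const (c : ℕ)
  | var (x : ℕ)
  | arr (A : ℕ) (idx : IExpr)
  | add (e f : IExpr)
  | sub (e f : IExpr)
  | half (e : IExpr)

/-- Value of an integer expression. -/
def IExpr.eval (σ : State) : IExpr → ℕ
  | .const c => c
  | .var x => σ.ivar x
  | .arr A idx => σ.iarr A (idx.eval σ)
  | .add e f => e.eval σ + f.eval σ
  | .sub e f => e.eval σ - f.eval σ
  | .half e => e.eval σ / 2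

/-- Number of steps needed to evaluate an integer expression. -/
def IExpr.cost : IExpr → ℕ
  | .const _ => 1
  | .var _ => 1
  | .arr _ idx => idx.cost + 1
  | .add e f => e.cost + f.cost + 1
  | .sub e f => e.cost + f.cost + 1
  | .half e => e.cost + 1

/-- Real expressions. -/
inductive RExpr where
  | zero
  | one
  | var (x : ℕ)
  | arr (A : ℕ) (idx : IExpr)
  | add (e f : RExpr)
  | sub (e f : RExpr)
  | mul (e f : RExpr)

/-- Value of a real expression. -/
noncomputable def RExpr.eval (σ : State) : RExpr → ℝ
  | .zero => 0
  | .one => 1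
  | .var x => σ.rvar x
  | .arr A idx => σ.rarr A (idx.eval σ)
  | .add e f => e.eval σ + f.eval σ
  | .sub e f => e.eval σ - f.eval σ
  | .mul e f => e.eval σ * f.eval σ

/-- Number of steps needed to evaluate a real expression. -/
def RExpr.cost : RExpr → ℕ
  | .zero => 1
  | .one => 1
  | .var _ => 1
  | .arr _ idx => idx.cost + 1
  | .add e f => e.cost + f.cost + 1
  | .sub e f => e.cost + f.cost + 1
  | .mul e f => e.cost + f.cost + 1

/-- Tests: comparisons of two integers or of two reals, and Boolean combinations. -/
inductive Cond where
  | ile (e f : IExpr)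
  | rle (e f : RExpr)
  | neg (b : Cond)
  | conj (b c : Cond)

/-- Truth of a test. -/
def Cond.Holds (σ : State) : Cond → Prop
  | .ile e f => e.eval σ ≤ f.eval σ
  | .rle e f => e.eval σ ≤ f.eval σ
  | .neg b => ¬ b.Holds σ
  | .conj b c => b.Holds σ ∧ c.Holds σ

/-- Number of steps needed to evaluate a test. -/
def Cond.cost : Cond → ℕ
  | .ile e f => e.cost + f.cost + 1
  | .rle e f => e.cost + f.cost + 1
  | .neg b => b.cost + 1
  | .conj b c => b.cost + c.cost + 1

/-- Programs. -/
inductive Cmd where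
  | skip
  | iset (x : ℕ) (e : IExpr)
  | istore (A : ℕ) (idx : IExpr) (e : IExpr)
  | rset (x : ℕ) (e : RExpr)
  | rstore (A : ℕ) (idx : IExpr) (e : RExpr)
  | seq (p q : Cmd)
  | ite (b : Cond) (p q : Cmd)
  | loop (b : Cond) (p : Cmd)

/-- `Exec p σ t σ'`: started in `σ`, the program `p` halts after exactly `t` steps in `σ'`.
`loop b p` runs `p` as long as the test `b` holds. -/
inductive Exec : Cmd → State → ℕ → State → Prop
  | skip (σ : State) : Exec .skip σ 1 σ
  | iset (x : ℕ) (e : IExpr) (σ : State) :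
      Exec (.iset x e) σ (e.cost + 1)
        { σ with ivar := Function.update σ.ivar x (e.eval σ) }
  | istore (A : ℕ) (idx e : IExpr) (σ : State) :
      Exec (.istore A idx e) σ (idx.cost + e.cost + 1)
        { σ with
          iarr := Function.update σ.iarr A
            (Function.update (σ.iarr A) (IExpr.eval σ idx) (IExpr.eval σ e)) }
  | rset (x : ℕ) (e : RExpr) (σ : State) :
      Exec (.rset x e) σ (e.cost + 1)
        { σ with rvar := Function.update σ.rvar x (e.eval σ) }
  | rstore (A : ℕ) (idx : IExpr) (e : RExpr) (σ : State) :
      Exec (.rstore A idx e) σ (idx.cost + e.cost + 1)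
        { σ with
          rarr := Function.update σ.rarr A
            (Function.update (σ.rarr A) (IExpr.eval σ idx) (RExpr.eval σ e)) }
  | seq {p q : Cmd} {σ σ₁ σ₂ : State} {t₁ t₂ : ℕ} :
      Exec p σ t₁ σ₁ → Exec q σ₁ t₂ σ₂ → Exec (.seq p q) σ (t₁ + t₂) σ₂
  | ite_true {b : Cond} {p q : Cmd} {σ σ' : State} {t : ℕ} :
      b.Holds σ → Exec p σ t σ' → Exec (.ite b p q) σ (b.cost + 1 + t) σ'
  | ite_false {b : Cond} {p q : Cmd} {σ σ' : State} {t : ℕ} :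
      ¬ b.Holds σ → Exec q σ t σ' → Exec (.ite b p q) σ (b.cost + 1 + t) σ'
  | loop_done {b : Cond} {p : Cmd} {σ : State} :
      ¬ b.Holds σ → Exec (.loop b p) σ (b.cost + 1) σ
  | loop_step {b : Cond} {p : Cmd} {σ σ₁ σ₂ : State} {t₁ t₂ : ℕ} :
      b.Holds σ → Exec p σ t₁ σ₁ → Exec (.loop b p) σ₁ t₂ σ₂ →
        Exec (.loop b p) σ (b.cost + 1 + t₁ + t₂) σ₂

end RealRAM

/-! ## Balanced `k`-center

The input is a family `P` of `n` points (points may coincide).  A clustering is given by the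
centers `c j` and the map `a` that sends the index of a point to the index of its cluster. -/

namespace BCenter

/-- Every cluster has between `L` and `U` points. -/
def IsBalanced {n k : ℕ} (L U : ℕ) (a : Fin n → Fin k) : Prop :=
  ∀ j : Fin k, L ≤ (Finset.univ.filter fun i => a i = j).card ∧
    (Finset.univ.filter fun i => a i = j).card ≤ U

/-- The `k`-center objective: the largest distance of a point to the center of its cluster. -/
noncomputable def cost {n k d : ℕ} (P : Fin n → EuclideanSpace ℝ (Fin d))
    (c : Fin k → EuclideanSpace ℝ (Fin d)) (a : Fin n → Fin k) : ℝ :=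
  ⨆ i : Fin n, dist (P i) (c (a i))

/-- `(c, a)` is a `ρ`-approximation: a balanced clustering whose cost is at most `ρ` times that of
every balanced clustering (the centers may be any points of the space). -/
def IsApprox {n k d : ℕ} (ρ : ℝ) (P : Fin n → EuclideanSpace ℝ (Fin d)) (L U : ℕ)
    (c : Fin k → EuclideanSpace ℝ (Fin d)) (a : Fin n → Fin k) : Prop :=
  IsBalanced L U a ∧
    ∀ (c' : Fin k → EuclideanSpace ℝ (Fin d)) (a' : Fin n → Fin k),
      IsBalanced L U a' → cost P c a ≤ ρ * cost P c' a'

/-- `s` lists (indices of) points that Gonzalez's algorithm may select: the first one is arbitrary,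
each later one has the largest minimum distance to the points selected before it. -/
def IsGonzalez {n k d : ℕ} (P : Fin n → EuclideanSpace ℝ (Fin d)) (s : Fin k → Fin n) : Prop :=
  ∀ j : Fin k, 0 < (j : ℕ) → ∀ i : Fin n,
    Metric.infDist (P i) ((fun l => P (s l)) '' Set.Iio j) ≤
      Metric.infDist (P (s j)) ((fun l => P (s l)) '' Set.Iio j)

/-- The region of the points that lie in exactly those balls of radius `r` around the centers `c`
whose index belongs to `T`. -/
def region {k d : ℕ} (c : Fin k → EuclideanSpace ℝ (Fin d)) (r : ℝ) (T : Finset (Fin k)) :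
    Set (EuclideanSpace ℝ (Fin d)) :=
  {p | ∀ j : Fin k, p ∈ Metric.closedBall (c j) r ↔ j ∈ T}

open Classical in
/-- `x` solves the region-based linear system for the centers `c` and the radius `r`; the variable
`x T j`, for `j ∈ T`, is the amount assigned to cluster `j` from the region of `T`.  For `T = ∅` the
equation says that no input point lies outside the union of the balls (otherwise the radius is
rejected). -/
def IsSolution {n k d : ℕ} (P : Fin n → EuclideanSpace ℝ (Fin d)) (L U : ℕ)
    (c : Fin k → EuclideanSpace ℝ (Fin d)) (r : ℝ) (x : Finset (Fin k) → Fin k → ℝ) : Prop :=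
  (∀ T : Finset (Fin k), ∀ j ∈ T, 0 ≤ x T j) ∧
  (∀ T : Finset (Fin k),
    ∑ j ∈ T, x T j = ((Finset.univ.filter fun i => P i ∈ region c r T).card : ℝ)) ∧
  ∀ j : Fin k, (L : ℝ) ≤ ∑ T ∈ Finset.univ.filter (fun T : Finset (Fin k) => j ∈ T), x T j ∧
    ∑ T ∈ Finset.univ.filter (fun T : Finset (Fin k) => j ∈ T), x T j ≤ (U : ℝ)

/-- The linear system for the centers `c` and the radius `r` is feasible (over the reals). -/
def Feasible {n k d : ℕ} (P : Fin n → EuclideanSpace ℝ (Fin d)) (L U : ℕ)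
    (c : Fin k → EuclideanSpace ℝ (Fin d)) (r : ℝ) : Prop :=
  ∃ x : Finset (Fin k) → Fin k → ℝ, IsSolution P L U c r x

/-- The `n * k` distances from the input points to the selected points, in increasing order. -/
noncomputable def sortedDistances {n k d : ℕ} (P : Fin n → EuclideanSpace ℝ (Fin d))
    (s : Fin k → Fin n) : List ℝ :=
  Multiset.sort
    ((Finset.univ : Finset (Fin n × Fin k)).val.map fun q => dist (P q.1) (P (s q.2))) (· ≤ ·)

open Classical in
/-- Binary search among the positions `lo, ..., hi - 1` of the sorted list `R`, as the list of its
steps: each step probes the middle position and records it together with the verdict (`1` if the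
entry `r` at that position is feasible, `0` if not); the search goes on to the left of a feasible
position and to the right of an infeasible one, until no position is left. -/
noncomputable def probes (feasible : ℝ → Prop) (R : List ℝ) (lo hi : ℕ) : List (ℕ × ℕ) :=
  if lo < hi then
    if feasible (R.getD ((lo + hi) / 2) 0) then
      ((lo + hi) / 2, 1) :: probes feasible R lo ((lo + hi) / 2)
    else ((lo + hi) / 2, 0) :: probes feasible R ((lo + hi) / 2 + 1) hi
  else []
termination_by hi - lo
decreasing_by all_goals omega

/-- The binary search for the `k`-tuple `(s (τ 1), ..., s (τ k))` of selected points. -/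
noncomputable def search {n k d : ℕ} (P : Fin n → EuclideanSpace ℝ (Fin d)) (L U : ℕ)
    (s : Fin k → Fin n) (τ : Fin k → Fin k) : List (ℕ × ℕ) :=
  probes (Feasible P L U fun j => P (s (τ j))) (sortedDistances P s)
    0 (sortedDistances P s).length

/-- The radius that the binary search finds for the `k`-tuple `(s (τ 1), ..., s (τ k))`: it starts
with the largest distance and is updated whenever a smaller feasible radius is probed. -/
noncomputable def radius {n k d : ℕ} (P : Fin n → EuclideanSpace ℝ (Fin d)) (L U : ℕ)
    (s : Fin k → Fin n) (τ : Fin k → Fin k) : ℝ :=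
  (search P L U s τ).foldl
    (fun best q =>
      if q.2 = 1 ∧ (sortedDistances P s).getD q.1 0 < best
      then (sortedDistances P s).getD q.1 0 else best)
    ((sortedDistances P s).getLastD 0)

open Classical in
/-- The algorithm may return, for the input `P, L, U`, the centers `P (s (τ j))` and the clustering
`a`.  Here `s` is an output of Gonzalez's algorithm, `τ` is a `k`-tuple with the smallest radius
among all `k`-tuples of selected points, and `a` realizes an integral solution `y` of the linear
system for that tuple and that radius: from each region `T`, exactly `y T j` points are assigned to
cluster `j`. -/
def Returns {n k d : ℕ} (P : Fin n → EuclideanSpace ℝ (Fin d)) (L U : ℕ)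
    (s : Fin k → Fin n) (τ : Fin k → Fin k) (a : Fin n → Fin k) : Prop :=
  IsGonzalez P s ∧
  (∀ τ' : Fin k → Fin k, radius P L U s τ ≤ radius P L U s τ') ∧
  ∃ y : Finset (Fin k) → Fin k → ℕ,
    IsSolution P L U (fun j => P (s (τ j))) (radius P L U s τ) (fun T j => (y T j : ℝ)) ∧
    ∀ T : Finset (Fin k), ∀ j ∈ T,
      (Finset.univ.filter fun i =>
        P i ∈ region (fun j => P (s (τ j))) (radius P L U s τ) T ∧ a i = j).card = y T j

/-- The initial memory of the machine: `n, k, d, L, U` are in the integer variables `0, ..., 4`,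
coordinate `j` of point `i` is in cell `i * d + j` of the real array `0`; all else is `0`. -/
noncomputable def input {n d : ℕ} (P : Fin n → EuclideanSpace ℝ (Fin d)) (k L U : ℕ) :
    RealRAM.State where
  ivar := fun x => if x = 0 then n else if x = 1 then k else if x = 2 then d else
    if x = 3 then L else if x = 4 then U else 0
  iarr := fun _ _ => 0
  rvar := fun _ => 0
  rarr := fun A m => if A = 0 then
      if h : m < n * d then
        P (finProdFinEquiv.symm ⟨m, h⟩).1 (finProdFinEquiv.symm ⟨m, h⟩).2
      else 0
    else 0

/-- The record of the search through all `k`-tuples, in the order of the list `tuples`: for each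
tuple `τ` the numbers `τ 1, ..., τ k`, followed by position and verdict of each probe of the binary
search for `τ`. -/
noncomputable def searchRecord {n k d : ℕ} (P : Fin n → EuclideanSpace ℝ (Fin d)) (L U : ℕ)
    (s : Fin k → Fin n) (tuples : List (Fin k → Fin k)) : List ℕ :=
  tuples.flatMap fun τ =>
    (List.ofFn fun j => (τ j : ℕ)) ++ (search P L U s τ).flatMap fun q => [q.1, q.2]

/-- The final memory of the machine shows a complete run of the algorithm: the integer arrays `0`,
`1`, `2` hold the output `s` of Gonzalez's algorithm, the returned tuple `τ` and the returned
clustering `a`, and the integer array `3` holds the record of the binary searches for all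
`k`-tuples, each tuple being treated once, in some order. -/
def ShowsRun {n k d : ℕ} (σ : RealRAM.State) (P : Fin n → EuclideanSpace ℝ (Fin d)) (L U : ℕ)
    (s : Fin k → Fin n) (τ : Fin k → Fin k) (a : Fin n → Fin k) : Prop :=
  Returns P L U s τ a ∧
  (∀ j : Fin k, σ.iarr 0 j = s j) ∧ (∀ j : Fin k, σ.iarr 1 j = τ j) ∧
  (∀ i : Fin n, σ.iarr 2 i = a i) ∧
  ∃ tuples : List (Fin k → Fin k), tuples.Nodup ∧ (∀ τ' : Fin k → Fin k, τ' ∈ tuples) ∧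
    ∀ m : ℕ, (h : m < (searchRecord P L U s tuples).length) →
      σ.iarr 3 m = (searchRecord P L U s tuples)[m]

end BCenter

/-! ## Reasoning about programs of the real RAM -/

namespace RealRAM

/-! The approximation bound rests on three facts. By pigeonhole, every input point has a selected
point within twice the cost `ρ` of any clustering into `k` clusters (`IsGonzalez.exists_dist_le`).
In a balanced clustering every cluster is nonempty because `L ≥ 1`. Choose a representative of each
cluster and replace the cluster's center by a selected point within `2ρ` of the representative; any
point of the cluster is within `2ρ` of the representative, hence within `4ρ` of the new center. The
largest distance that arises is one of the sorted distances, and the given assignment shows that it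
is a feasible radius for the new tuple. As feasibility is monotone in the radius, binary search
finds a radius no larger (`radius_le`). Conversely, the equations for the regions force every point
of a returned clustering into a ball that contains it, so its cost is at most the radius
(`Returns.isApprox`).

Feasibility is purely combinatorial. Let `M i` be the set of balls that contain point `i`. A real
solution implies, for every set `A` of clusters, that the number of points with `M i ⊆ A` is at most
`U * #A`, and that this number plus `L * #Aᶜ` is at most `n` (`Feasible.hallCond`). These conditions
already yield a balanced integral assignment, by Hall's marriage theorem for `U` slots per cluster
and dummy points that may only use optional slots (`HallCond.exists_assignment`). Hence real
feasibility, integral feasibility and Hall's conditions coincide.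

The program therefore solves no linear program. A table of the `k`-digit numbers in base `k` lists
the `k ^ k` tuples and also encodes the sets `A`, through nonzero digits (`hallDigits_iff`). A probe
counts the points inside each set, in time linear in `n` for fixed `k`. The clustering is built
greedily: each point goes to a cluster that keeps Hall's conditions true. Such a cluster exists,
since Hall's conditions provide an assignment that extends the choices made so far (`exists_fits`),
and the counts are updated in time independent of `n` and `d`. Real comparisons use squared
distances, which are ordered like distances.

For fixed `k`, the distances cost `O(n d)`, merge sort costs `O(n log n)`, and the `O(log n)` probes
for each of the `k ^ k` tuples cost `O(n)` each. Program correctness is proved by invariants with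
explicit step bounds (`Run`); what a program fragment leaves unchanged is read off its text
(`Exec.frame`). -/

/-- Set an integer variable. -/
def State.setI (σ : State) (x v : ℕ) : State :=
  { σ with ivar := Function.update σ.ivar x v }

/-- Set a cell of an integer array. -/
def State.putI (σ : State) (A i v : ℕ) : State :=
  { σ with iarr := Function.update σ.iarr A (Function.update (σ.iarr A) i v) }

/-- Set a real variable. -/
noncomputable def State.setR (σ : State) (x : ℕ) (v : ℝ) : State :=
  { σ with rvar := Function.update σ.rvar x v }

/-- Set a cell of a real array. -/
noncomputable def State.putR (σ : State) (A i : ℕ) (v : ℝ) : State :=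
  { σ with rarr := Function.update σ.rarr A (Function.update (σ.rarr A) i v) }

section simps
variable (σ : State) (x y A B i m v : ℕ) (r : ℝ)

@[simp] theorem setI_ivar : (σ.setI x v).ivar y = if y = x then v else σ.ivar y := by
  simp [State.setI, Function.update_apply]
@[simp] theorem setI_iarr : (σ.setI x v).iarr = σ.iarr := rfl
@[simp] theorem setI_rvar : (σ.setI x v).rvar = σ.rvar := rfl
@[simp] theorem setI_rarr : (σ.setI x v).rarr = σ.rarr := rfl
@[simp] theorem putI_ivar : (σ.putI A i v).ivar = σ.ivar := rfl
@[simp] theorem putI_rvar : (σ.putI A i v).rvar = σ.rvar := rfl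
@[simp] theorem putI_rarr : (σ.putI A i v).rarr = σ.rarr := rfl
@[simp] theorem putI_iarr :
    (σ.putI A i v).iarr B m = if B = A ∧ m = i then v else σ.iarr B m := by
  by_cases h : B = A
  · subst h; simp [State.putI, Function.update_apply]
  · simp [State.putI, h]
@[simp] theorem setR_rvar : (σ.setR x r).rvar y = if y = x then r else σ.rvar y := by
  simp [State.setR, Function.update_apply]
@[simp] theorem setR_iarr : (σ.setR x r).iarr = σ.iarr := rfl
@[simp] theorem setR_ivar : (σ.setR x r).ivar = σ.ivar := rfl
@[simp] theorem putR_ivar : (σ.putR A i r).ivar = σ.ivar := rfl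
@[simp] theorem putR_rvar : (σ.putR A i r).rvar = σ.rvar := rfl
@[simp] theorem putR_iarr : (σ.putR A i r).iarr = σ.iarr := rfl
@[simp] theorem putR_rarr :
    (σ.putR A i r).rarr B m = if B = A ∧ m = i then r else σ.rarr B m := by
  by_cases h : B = A
  · subst h; simp [State.putR, Function.update_apply]
  · simp [State.putR, h]

end simps

attribute [simp] IExpr.eval RExpr.eval Cond.Holds

/-! ### Write sets of programs and the memory they preserve. -/

/-- Does the program contain an assignment to the integer variable? -/
def Cmd.wI (x : ℕ) : Cmd → Bool
  | .iset y _ => x == y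
  | .seq p q => p.wI x || q.wI x
  | .ite _ p q => p.wI x || q.wI x
  | .loop _ p => p.wI x
  | _ => false

/-- Does the program contain an assignment to a cell of the integer array? -/
def Cmd.wIA (A : ℕ) : Cmd → Bool
  | .istore B _ _ => A == B
  | .seq p q => p.wIA A || q.wIA A
  | .ite _ p q => p.wIA A || q.wIA A
  | .loop _ p => p.wIA A
  | _ => false

/-- Does the program contain an assignment to the real variable? -/
def Cmd.wR (x : ℕ) : Cmd → Bool
  | .rset y _ => x == y
  | .seq p q => p.wR x || q.wR x
  | .ite _ p q => p.wR x || q.wR x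
  | .loop _ p => p.wR x
  | _ => false

/-- Does the program contain an assignment to a cell of the real array? -/
def Cmd.wRA (A : ℕ) : Cmd → Bool
  | .rstore B _ _ => A == B
  | .seq p q => p.wRA A || q.wRA A
  | .ite _ p q => p.wRA A || q.wRA A
  | .loop _ p => p.wRA A
  | _ => false

/-- The two states agree on everything to which the program contains no assignment. -/
structure Frame (c : Cmd) (σ σ' : State) : Prop where
  iv : ∀ x, c.wI x = false → σ'.ivar x = σ.ivar x
  ia : ∀ A, c.wIA A = false → σ'.iarr A = σ.iarr A
  rv : ∀ x, c.wR x = false → σ'.rvar x = σ.rvar x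
  ra : ∀ A, c.wRA A = false → σ'.rarr A = σ.rarr A

theorem Frame.refl (c : Cmd) (σ : State) : Frame c σ σ :=
  ⟨fun _ _ => rfl, fun _ _ => rfl, fun _ _ => rfl, fun _ _ => rfl⟩

theorem Frame.trans {c : Cmd} {σ₁ σ₂ σ₃ : State} (h : Frame c σ₁ σ₂) (h' : Frame c σ₂ σ₃) :
    Frame c σ₁ σ₃ :=
  ⟨fun x hx => (h'.iv x hx).trans (h.iv x hx), fun x hx => (h'.ia x hx).trans (h.ia x hx),
    fun x hx => (h'.rv x hx).trans (h.rv x hx), fun x hx => (h'.ra x hx).trans (h.ra x hx)⟩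

theorem Frame.seqLeft {p q : Cmd} {σ σ' : State} (h : Frame p σ σ') : Frame (.seq p q) σ σ' :=
  ⟨fun x hx => h.iv x (by simp_all [Cmd.wI]), fun x hx => h.ia x (by simp_all [Cmd.wIA]),
    fun x hx => h.rv x (by simp_all [Cmd.wR]), fun x hx => h.ra x (by simp_all [Cmd.wRA])⟩

theorem Frame.seqRight {p q : Cmd} {σ σ' : State} (h : Frame q σ σ') : Frame (.seq p q) σ σ' :=
  ⟨fun x hx => h.iv x (by simp_all [Cmd.wI]), fun x hx => h.ia x (by simp_all [Cmd.wIA]),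
    fun x hx => h.rv x (by simp_all [Cmd.wR]), fun x hx => h.ra x (by simp_all [Cmd.wRA])⟩

theorem Frame.iteLeft {b : Cond} {p q : Cmd} {σ σ' : State} (h : Frame p σ σ') :
    Frame (.ite b p q) σ σ' :=
  ⟨fun x hx => h.iv x (by simp_all [Cmd.wI]), fun x hx => h.ia x (by simp_all [Cmd.wIA]),
    fun x hx => h.rv x (by simp_all [Cmd.wR]), fun x hx => h.ra x (by simp_all [Cmd.wRA])⟩

theorem Frame.iteRight {b : Cond} {p q : Cmd} {σ σ' : State} (h : Frame q σ σ') :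
    Frame (.ite b p q) σ σ' :=
  ⟨fun x hx => h.iv x (by simp_all [Cmd.wI]), fun x hx => h.ia x (by simp_all [Cmd.wIA]),
    fun x hx => h.rv x (by simp_all [Cmd.wR]), fun x hx => h.ra x (by simp_all [Cmd.wRA])⟩

theorem Frame.loopBody {b : Cond} {p : Cmd} {σ σ' : State} (h : Frame p σ σ') :
    Frame (.loop b p) σ σ' :=
  ⟨h.iv, h.ia, h.rv, h.ra⟩

theorem Frame.setI {c : Cmd} {x : ℕ} (h : c.wI x = true) (σ : State) (v : ℕ) :
    Frame c σ (σ.setI x v) :=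
  ⟨fun y hy => by
    have : y ≠ x := by rintro rfl; simp [h] at hy
    simp [this], fun _ _ => rfl, fun _ _ => rfl, fun _ _ => rfl⟩

theorem Frame.setR {c : Cmd} {x : ℕ} (h : c.wR x = true) (σ : State) (v : ℝ) :
    Frame c σ (σ.setR x v) :=
  ⟨fun _ _ => rfl, fun _ _ => rfl, fun y hy => by
    have : y ≠ x := by rintro rfl; simp [h] at hy
    simp [this], fun _ _ => rfl⟩

/-- Only assignments alter memory, and every assignment executed occurs in the text. The write sets
are computable, so for a concrete program each preservation fact needs only `rfl` as its side
condition. -/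
theorem Exec.frame {c : Cmd} {σ σ' : State} {t : ℕ} (h : Exec c σ t σ') : Frame c σ σ' := by
  induction h with
  | skip σ => exact Frame.refl _ _
  | iset x e σ =>
    refine ⟨fun y hy => ?_, fun _ _ => rfl, fun _ _ => rfl, fun _ _ => rfl⟩
    simp [Cmd.wI] at hy; simp [hy]
  | istore x i e σ =>
    refine ⟨fun _ _ => rfl, fun y hy => ?_, fun _ _ => rfl, fun _ _ => rfl⟩
    simp [Cmd.wIA] at hy; simp [hy]
  | rset x e σ =>
    refine ⟨fun _ _ => rfl, fun _ _ => rfl, fun y hy => ?_, fun _ _ => rfl⟩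
    simp [Cmd.wR] at hy; simp [hy]
  | rstore x i e σ =>
    refine ⟨fun _ _ => rfl, fun _ _ => rfl, fun _ _ => rfl, fun y hy => ?_⟩
    simp [Cmd.wRA] at hy; simp [hy]
  | seq _ _ h1 h2 => exact h1.seqLeft.trans h2.seqRight
  | ite_true _ _ h => exact h.iteLeft
  | ite_false _ _ h => exact h.iteRight
  | loop_done _ => exact Frame.refl _ _
  | loop_step _ _ _ h1 h2 => exact h1.loopBody.trans h2

/-! ### Runs with a time bound, and their proof rules. -/

/-- Started in `σ`, the program halts after at most `T` steps in a state that satisfies `Q`. -/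
def Run (c : Cmd) (σ : State) (T : ℕ) (Q : State → Prop) : Prop :=
  ∃ t σ', Exec c σ t σ' ∧ t ≤ T ∧ Q σ'

/-- Besides weakening, this hands the frame of the run to the continuation. Together with the nested
postcondition of `Run.seq`, it carries facts about untouched memory from one fragment to the next.
-/
theorem Run.mono {c : Cmd} {σ : State} {T T' : ℕ} {Q Q' : State → Prop} (h : Run c σ T Q)
    (hT : T ≤ T') (hQ : ∀ σ', Q σ' → Frame c σ σ' → Q' σ') : Run c σ T' Q' := by
  obtain ⟨t, σ', he, ht, hq⟩ := h
  exact ⟨t, σ', he, ht.trans hT, hQ _ hq he.frame⟩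

theorem Run.seq {p q : Cmd} {σ : State} {T₁ T₂ : ℕ} {Q : State → Prop}
    (h : Run p σ T₁ fun σ' => Run q σ' T₂ Q) : Run (.seq p q) σ (T₁ + T₂) Q := by
  obtain ⟨t, σ', he, ht, t', σ'', he', ht', hq⟩ := h
  exact ⟨t + t', σ'', he.seq he', by omega, hq⟩

open Classical in
/-- The effect of a loop-free program. -/
noncomputable def Cmd.den : Cmd → State → State
  | .skip, σ => σ
  | .iset x e, σ => σ.setI x (e.eval σ)
  | .istore A i e, σ => σ.putI A (i.eval σ) (e.eval σ)
  | .rset x e, σ => σ.setR x (e.eval σ)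
  | .rstore A i e, σ => σ.putR A (i.eval σ) (e.eval σ)
  | .seq p q, σ => q.den (p.den σ)
  | .ite b p q, σ => if b.Holds σ then p.den σ else q.den σ
  | .loop _ _, σ => σ

/-- A bound on the number of steps of a loop-free program. -/
def Cmd.wc : Cmd → ℕ
  | .skip => 1
  | .iset _ e => e.cost + 1
  | .istore _ i e => i.cost + e.cost + 1
  | .rset _ e => e.cost + 1
  | .rstore _ i e => i.cost + e.cost + 1
  | .seq p q => p.wc + q.wc
  | .ite b p q => b.cost + 1 + (p.wc + q.wc)
  | .loop _ _ => 0

/-- Is the program loop-free? -/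
def Cmd.loopFree : Cmd → Bool
  | .seq p q => p.loopFree && q.loopFree
  | .ite _ p q => p.loopFree && q.loopFree
  | .loop _ _ => false
  | _ => true

theorem Cmd.exec_den (c : Cmd) (h : c.loopFree = true) (σ : State) :
    ∃ t ≤ c.wc, Exec c σ t (c.den σ) := by
  induction c generalizing σ with
  | skip => exact ⟨_, le_rfl, .skip σ⟩
  | iset x e => exact ⟨_, le_rfl, .iset x e σ⟩
  | istore x i e => exact ⟨_, le_rfl, .istore x i e σ⟩
  | rset x e => exact ⟨_, le_rfl, .rset x e σ⟩
  | rstore x i e => exact ⟨_, le_rfl, .rstore x i e σ⟩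
  | seq p q hp hq =>
    simp only [Cmd.loopFree, Bool.and_eq_true] at h
    obtain ⟨t, ht, he⟩ := hp h.1 σ
    obtain ⟨t', ht', he'⟩ := hq h.2 (p.den σ)
    exact ⟨t + t', add_le_add ht ht', he.seq he'⟩
  | ite b p q hp hq =>
    simp only [Cmd.loopFree, Bool.and_eq_true] at h
    obtain ⟨t, ht, he⟩ := hp h.1 σ
    obtain ⟨t', ht', he'⟩ := hq h.2 σ
    by_cases hb : b.Holds σ
    · refine ⟨_, ?_, by simpa only [Cmd.den, if_pos hb] using Exec.ite_true hb he⟩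
      simp only [Cmd.wc]; omega
    · refine ⟨_, ?_, by simpa only [Cmd.den, if_neg hb] using Exec.ite_false hb he'⟩
      simp only [Cmd.wc]; omega
  | loop b p _ => simp [Cmd.loopFree] at h

theorem Run.of_loopFree {c : Cmd} {σ : State} {Q : State → Prop} (h : c.loopFree = true)
    (hQ : Q (c.den σ)) : Run c σ c.wc Q := by
  obtain ⟨t, ht, he⟩ := c.exec_den h σ
  exact ⟨t, _, he, ht, hQ⟩

/-- Amortized rule: an iteration may have its own time bound, paid for by the drop of `φ`. It serves
loops whose iterations differ in cost or whose number is not known beforehand. -/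
theorem Run.loop_of_potential {b : Cond} {c : Cmd} (σ₀ : State) (Inv : State → Prop)
    (φ : State → ℕ) (h0 : Inv σ₀)
    (hstep : ∀ σ, Frame (.loop b c) σ₀ σ → Inv σ → b.Holds σ →
      ∃ T, Run c σ T fun σ' => Inv σ' ∧ φ σ' + T + b.cost + 1 ≤ φ σ) :
    Run (.loop b c) σ₀ (φ σ₀ + b.cost + 1) fun σ =>
      Inv σ ∧ ¬ b.Holds σ ∧ Frame (.loop b c) σ₀ σ := by
  suffices H : ∀ N σ, φ σ ≤ N → Inv σ → Frame (.loop b c) σ₀ σ →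
      Run (.loop b c) σ (φ σ + b.cost + 1) fun σ =>
        Inv σ ∧ ¬ b.Holds σ ∧ Frame (.loop b c) σ₀ σ from
    H _ σ₀ le_rfl h0 (Frame.refl _ _)
  intro N
  induction N with
  | zero =>
    intro σ hN hI hF
    by_cases hb : b.Holds σ
    · obtain ⟨T, t, σ', he, ht, hI', hφ⟩ := hstep σ hF hI hb
      omega
    · exact ⟨_, σ, .loop_done hb, by omega, hI, hb, hF⟩
  | succ N ih =>
    intro σ hN hI hF
    by_cases hb : b.Holds σ
    · obtain ⟨T, t, σ', he, ht, hI', hφ⟩ := hstep σ hF hI hb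
      obtain ⟨t', σ'', he', ht', hQ⟩ :=
        ih σ' (by omega) hI' (hF.trans he.frame.loopBody)
      exact ⟨_, σ'', .loop_step hb he he', by omega, hQ⟩
    · exact ⟨_, σ, .loop_done hb, by omega, hI, hb, hF⟩

theorem Run.loop_of_count {b : Cond} {c : Cmd} (σ₀ : State) (M T : ℕ) (Inv : ℕ → State → Prop)
    (h0 : Inv 0 σ₀)
    (hstep : ∀ m < M, ∀ σ, Frame (.loop b c) σ₀ σ → Inv m σ →
      b.Holds σ ∧ Run c σ T (Inv (m + 1)))
    (hdone : ∀ σ, Frame (.loop b c) σ₀ σ → Inv M σ → ¬ b.Holds σ) :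
    Run (.loop b c) σ₀ (M * (T + b.cost + 1) + b.cost + 1) fun σ =>
      Inv M σ ∧ Frame (.loop b c) σ₀ σ := by
  suffices H : ∀ r m σ, m + r = M → Inv m σ → Frame (.loop b c) σ₀ σ →
      Run (.loop b c) σ (r * (T + b.cost + 1) + b.cost + 1) fun σ =>
        Inv M σ ∧ Frame (.loop b c) σ₀ σ from
    H M 0 σ₀ (by omega) h0 (Frame.refl _ _)
  intro r
  induction r with
  | zero =>
    intro m σ hm hI hF
    obtain rfl : m = M := by omega
    exact ⟨_, σ, .loop_done (hdone σ hF hI), by omega, hI, hF⟩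
  | succ r ih =>
    intro m σ hm hI hF
    obtain ⟨hb, t, σ', he, ht, hI'⟩ := hstep m (by omega) σ hF hI
    obtain ⟨t', σ'', he', ht', hQ⟩ :=
      ih (m + 1) σ' (by omega) hI' (hF.trans he.frame.loopBody)
    refine ⟨_, σ'', .loop_step hb he he', ?_, hQ⟩
    rw [Nat.succ_mul]; omega

/-- `for x = 0, ..., y - 1 do c`, where `y` is an integer variable. -/
def Cmd.forLt (x y : ℕ) (c : Cmd) : Cmd :=
  .seq (.iset x (.const 0)) (.loop (.neg (.ile (.var y) (.var x)))
    (.seq c (.iset x (.add (.var x) (.const 1)))))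

/-- Each round pays 5 steps for the test and 4 for the increment besides the body; initialization
and the last test give the 7. As `hInv` makes the invariant blind to the counter, incrementing does
not disturb it. -/
theorem Run.forLt {x y : ℕ} {c : Cmd} {σ : State} {T : ℕ} (Inv : ℕ → State → Prop)
    (hx : c.wI x = false) (hy : (Cmd.forLt x y c).wI y = false)
    (hInv : ∀ m σ v, Inv m σ → Inv m (σ.setI x v)) (h0 : Inv 0 σ)
    (hstep : ∀ m, m < σ.ivar y → ∀ σ', σ'.ivar x = m → Frame (Cmd.forLt x y c) σ σ' →
      Inv m σ' → Run c σ' T (Inv (m + 1))) :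
    Run (Cmd.forLt x y c) σ (σ.ivar y * (T + 9) + 7) fun σ' =>
      Inv (σ.ivar y) σ' ∧ Frame (Cmd.forLt x y c) σ σ' := by
  have hyx : y ≠ x := by
    rintro rfl; simp [Cmd.forLt, Cmd.wI] at hy
  set b : Cond := .neg (.ile (.var y) (.var x)) with hb
  have key : Run (.loop b (.seq c (.iset x (.add (.var x) (.const 1))))) (σ.setI x 0)
      (σ.ivar y * ((T + 4) + b.cost + 1) + b.cost + 1) fun σ' => Inv (σ.ivar y) σ' := by
    have hf0 : Frame (Cmd.forLt x y c) σ (σ.setI x 0) :=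
      Frame.setI (by simp [Cmd.forLt, Cmd.wI]) σ 0
    refine (Run.loop_of_count _ _ _ (fun m σ' => Inv m σ' ∧ σ'.ivar x = m)
      ⟨hInv _ _ _ h0, by simp⟩ ?_ ?_).mono le_rfl fun σ' h _ => h.1.1
    · rintro m hm σ' hF ⟨hI, hxm⟩
      have hF' : Frame (Cmd.forLt x y c) σ σ' := hf0.trans hF.seqRight
      refine ⟨?_, ?_⟩
      · simp [hb, hF'.iv y hy, hxm, hm]
      · refine Run.seq ((hstep m hm σ' hxm hF' hI).mono le_rfl fun σ'' h hf => ?_)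
        refine Run.of_loopFree rfl ?_
        have : σ''.ivar x = m := (hf.iv x hx).trans hxm
        exact ⟨hInv _ _ _ h, by simp [Cmd.den, this]⟩
    · rintro σ' hF ⟨hI, hxm⟩
      have hF' : Frame (Cmd.forLt x y c) σ σ' := hf0.trans hF.seqRight
      simp [hb, hF'.iv y hy, hxm]
  have : Run (Cmd.forLt x y c) σ (2 + (σ.ivar y * ((T + 4) + b.cost + 1) + b.cost + 1)) fun σ' =>
      Inv (σ.ivar y) σ' := by
    refine Run.seq ?_
    refine Run.of_loopFree rfl ?_
    exact key
  refine this.mono ?_ fun σ' h hf => ⟨h, hf⟩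
  simp only [hb, Cond.cost, IExpr.cost]
  ring_nf; omega

end RealRAM

infixr:67 " ;; " => RealRAM.Cmd.seq

/-! ## Assignments and the conditions of Hall's theorem -/

namespace BCenter

open Finset

/-- Hall's conditions for a balanced assignment of the points `i` to clusters in `M i`. -/
def HallCond {n k : ℕ} (L U : ℕ) (M : Fin n → Finset (Fin k)) : Prop :=
  ∀ A : Finset (Fin k), #{i | M i ⊆ A} ≤ U * #A ∧ #{i | M i ⊆ A} + L * #Aᶜ ≤ n

theorem card_fiber_sum {n k : ℕ} (a : Fin n → Fin k) (A : Finset (Fin k)) :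
    #{i | a i ∈ A} = ∑ j ∈ A, #{i | a i = j} := by
  rw [card_eq_sum_card_fiberwise (f := a) (t := A) (fun i hi => by simpa using hi)]
  refine sum_congr rfl fun j hj => ?_
  congr 1; ext i; simp only [mem_filter, mem_univ, true_and]
  exact ⟨fun h => h.2, fun h => ⟨h ▸ hj, h⟩⟩

/-- Points with all options in `A` lie in clusters of `A`, which hold at most `U` points each, while
the clusters outside `A` need `L` further points each. -/
theorem HallCond.of_assignment {n k L U : ℕ} {M : Fin n → Finset (Fin k)} {a : Fin n → Fin k}
    (ha : ∀ i, a i ∈ M i) (hb : IsBalanced L U a) : HallCond L U M := by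
  intro A
  have h1 : #{i | M i ⊆ A} ≤ #{i | a i ∈ A} :=
    card_le_card fun i hi => by
      simp only [mem_filter, mem_univ, true_and] at hi ⊢; exact hi (ha i)
  have h2 : #{i | a i ∈ A} ≤ U * #A := by
    rw [card_fiber_sum, mul_comm]
    exact sum_le_card_nsmul _ _ _ fun j _ => (hb j).2
  have h3 : L * #Aᶜ ≤ #{i | a i ∈ Aᶜ} := by
    rw [card_fiber_sum, mul_comm]
    exact card_nsmul_le_sum _ _ _ fun j _ => (hb j).1
  have h4 : #{i | a i ∈ A} + #{i | a i ∈ Aᶜ} = n := by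
    have := card_filter_add_card_filter_not (s := (univ : Finset (Fin n))) (fun i => a i ∈ A)
    simpa using this
  exact ⟨h1.trans h2, by omega⟩

/-- Hall's marriage theorem with `U` slots per cluster. The `k * U - n` dummies make the matching
perfect, but may not use the first `L` slots of a cluster; those are therefore filled by genuine
points, which gives the lower bound. -/
theorem HallCond.exists_assignment {n k L U : ℕ} (hLU : L ≤ U) {M : Fin n → Finset (Fin k)}
    (h : HallCond L U M) : ∃ a : Fin n → Fin k, (∀ i, a i ∈ M i) ∧ IsBalanced L U a := by
  classical
  have hn : n ≤ k * U := by simpa [mul_comm] using (h univ).1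
  have hopt : #{u : Fin U | L ≤ (u : ℕ)} = U - L := by
    have := card_filter_add_card_filter_not (s := (univ : Finset (Fin U))) (fun u => (u : ℕ) < L)
    simp only [not_lt, card_univ, Fintype.card_fin, Fin.card_filter_val_lt] at this
    omega
  let t : Fin n ⊕ Fin (k * U - n) → Finset (Fin k × Fin U) :=
    Sum.elim (fun i => M i ×ˢ univ) (fun _ => univ ×ˢ ({u | L ≤ (u : ℕ)} : Finset (Fin U)))
  have hall : ∀ s : Finset (Fin n ⊕ Fin (k * U - n)), #s ≤ #(s.biUnion t) := by
    intro s
    set S := s.toLeft with hS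
    set A := S.biUnion M with hA
    have hs : #s = #s.toLeft + #s.toRight := (card_toLeft_add_card_toRight).symm
    have hSA : #s.toLeft ≤ #{i | M i ⊆ A} := card_le_card fun i hi => by
      simp only [mem_filter, mem_univ, true_and]
      exact subset_biUnion_of_mem M hi
    have hsub : A ×ˢ (univ : Finset (Fin U)) ⊆ s.biUnion t := by
      intro p hp
      simp only [mem_product, hA, mem_biUnion, hS, mem_toLeft] at hp
      obtain ⟨⟨i, hi, hp⟩, -⟩ := hp
      exact mem_biUnion.2 ⟨_, hi, by simp [t, hp]⟩
    by_cases hR : s.toRight = ∅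
    · have := card_le_card hsub
      rw [card_product, card_univ, Fintype.card_fin] at this
      rw [hs, hR, card_empty]
      have := (h A).1
      rw [mul_comm] at this
      omega
    · obtain ⟨q, hq⟩ := nonempty_iff_ne_empty.2 hR
      have hsub2 : (A ×ˢ (univ : Finset (Fin U))) ∪ (Aᶜ ×ˢ ({u | L ≤ (u : ℕ)} : Finset (Fin U))) ⊆
          s.biUnion t := by
        refine union_subset hsub fun p hp => ?_
        exact mem_biUnion.2 ⟨_, mem_toRight.1 hq, by
          simp only [mem_product] at hp
          simp [t, (mem_filter.1 hp.2).2]⟩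
      have hcard := card_le_card hsub2
      rw [card_union_of_disjoint (disjoint_left.2 fun p hp hp' => by
        simp only [mem_product, mem_compl] at hp hp'; exact hp'.1 hp.1), card_product, card_product,
        hopt, card_univ, Fintype.card_fin] at hcard
      have hAk : #A + #Aᶜ = k := by simp
      have h2 := (h A).2
      have hr : #s.toRight ≤ k * U - n := by simpa using card_le_univ s.toRight
      have e1 : k * U = #A * U + #Aᶜ * (U - L) + L * #Aᶜ := by
        obtain ⟨v, rfl⟩ := Nat.exists_eq_add_of_le hLU
        rw [Nat.add_sub_cancel_left]
        calc k * (L + v) = (#A + #Aᶜ) * (L + v) := by rw [hAk]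
          _ = _ := by ring
      omega
  obtain ⟨f, hf, hft⟩ := (all_card_le_biUnion_card_iff_exists_injective t).1 hall
  -- There are `n + (k * U - n) = k * U` points and dummies, as many as slots.
  have hbij : Function.Bijective f := by
    refine (Fintype.bijective_iff_injective_and_card f).2 ⟨hf, ?_⟩
    simp; omega
  refine ⟨fun i => (f (.inl i)).1, fun i => ?_, fun j => ⟨?_, ?_⟩⟩
  · have := hft (.inl i)
    simpa [t] using this
  · have hmand : #({j} ×ˢ ({u : Fin U | (u : ℕ) < L} : Finset (Fin U))) = L := by
      rw [card_product, Fin.card_filter_val_lt]; simp [hLU]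
    rw [← hmand]
    refine (card_le_card (t := ({i | (f (.inl i)).1 = j} : Finset (Fin n)).image
      fun i => f (.inl i)) ?_).trans card_image_le
    intro p hp
    simp only [mem_product, mem_singleton, mem_filter, mem_univ, true_and] at hp
    obtain ⟨x, hx⟩ := hbij.2 p
    cases x with
    | inl i => exact mem_image.2 ⟨i, by simp [hx, hp.1], hx⟩
    | inr q =>
      have := hft (.inr q)
      rw [hx] at this
      simp [t] at this
      omega
  · have hU : #({j} ×ˢ (univ : Finset (Fin U))) = U := by simp
    refine le_of_le_of_eq ?_ hU
    rw [← card_image_of_injective _ (hf.comp Sum.inl_injective)]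
    refine card_le_card fun p hp => ?_
    simp only [mem_image, mem_filter, mem_univ, true_and, Function.comp] at hp
    obtain ⟨i, hi, rfl⟩ := hp
    exact mem_product.2 ⟨by simpa using hi, mem_univ _⟩

/-! ### The linear system and Hall's conditions. -/

/-- The clusters whose balls of radius `r` contain the point. -/
noncomputable def balls {k d : ℕ} (c : Fin k → EuclideanSpace ℝ (Fin d)) (r : ℝ)
    (p : EuclideanSpace ℝ (Fin d)) : Finset (Fin k) :=
  {j | dist p (c j) ≤ r}

/-- The regions are the fibres of `balls`, so counting over regions is counting over fibres. -/
theorem mem_region_iff {k d : ℕ} (c : Fin k → EuclideanSpace ℝ (Fin d)) (r : ℝ)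
    (T : Finset (Fin k)) (p : EuclideanSpace ℝ (Fin d)) :
    p ∈ region c r T ↔ balls c r p = T := by
  simp [region, balls, Finset.ext_iff]

section solutions
variable {n k d L U : ℕ} {P : Fin n → EuclideanSpace ℝ (Fin d)}
  {c : Fin k → EuclideanSpace ℝ (Fin d)} {r : ℝ}

/-- All mass from regions `T ⊆ A` flows into clusters of `A`, which receive at most `U * #A`; the
clusters of `Aᶜ` receive at least `L * #Aᶜ`, and the total mass is `n`. No integrality is needed. -/
theorem Feasible.hallCond (h : Feasible P L U c r) : HallCond L U fun i => balls c r (P i) := by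
  classical
  obtain ⟨x, h0, hT, hj⟩ := h
  -- The values `x T j` with `j ∉ T` are unconstrained, so they are replaced by zero before sums are
  -- interchanged.
  set z : Finset (Fin k) → Fin k → ℝ := fun T j => if j ∈ T then x T j else 0 with hz
  have hz0 : ∀ T j, 0 ≤ z T j := fun T j => by
    simp only [hz]; split_ifs with hjT
    exacts [h0 T j hjT, le_rfl]
  have hzT : ∀ T, ∑ j, z T j = #{i | balls c r (P i) = T} := fun T => by
    have := hT T
    simp only [mem_region_iff] at this
    rw [← sum_filter_add_sum_filter_not univ (· ∈ T), sum_eq_zero (s := filter (· ∉ T) univ)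
      (fun j hj => by simp at hj; simp [hz, hj]), add_zero]
    convert this using 1
    · simp only [filter_mem_eq_inter, univ_inter]
      exact sum_congr rfl fun j hj => by simp [hz, hj]
  have hzj : ∀ j, (L : ℝ) ≤ ∑ T, z T j ∧ ∑ T, z T j ≤ U := fun j => by
    have := hj j
    simpa [hz, sum_filter] using this
  intro A
  have hup : (#{i | balls c r (P i) ⊆ A} : ℝ) ≤ ∑ j ∈ A, ∑ T, z T j := by
    have e : #{i | balls c r (P i) ⊆ A} = ∑ T ∈ A.powerset, #{i | balls c r (P i) = T} := by
      rw [card_eq_sum_card_fiberwise (f := fun i => balls c r (P i)) (t := A.powerset)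
        (fun i hi => by simpa using hi)]
      refine sum_congr rfl fun T hT => ?_
      congr 1; ext i; simp only [mem_filter, mem_univ, true_and]
      exact ⟨fun h => h.2, fun h => ⟨h ▸ mem_powerset.1 hT, h⟩⟩
    rw [e, sum_comm]; push_cast
    calc ∑ T ∈ A.powerset, (#{i | balls c r (P i) = T} : ℝ) = ∑ T ∈ A.powerset, ∑ j ∈ A, z T j := by
          refine sum_congr rfl fun T hTA => ?_
          rw [← hzT]
          refine (sum_subset (subset_univ A) fun j _ hj => ?_).symm
          have : j ∉ T := fun h => hj (mem_powerset.1 hTA h)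
          simp [hz, this]
      _ ≤ ∑ T, ∑ j ∈ A, z T j :=
          sum_le_sum_of_subset_of_nonneg (subset_univ _) fun T _ _ => sum_nonneg fun j _ => hz0 T j
  have htot : ∑ j ∈ A, ∑ T, z T j + ∑ j ∈ Aᶜ, ∑ T, z T j = n := by
    rw [sum_add_sum_compl, sum_comm]
    simp only [hzT]
    rw [← Nat.cast_sum]
    norm_cast
    have := card_eq_sum_card_fiberwise (s := (univ : Finset (Fin n)))
      (f := fun i => balls c r (P i)) (t := univ) (by simp)
    simpa using this.symm
  have hA1 : ∑ j ∈ A, ∑ T, z T j ≤ U * #A := by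
    have := sum_le_card_nsmul A (fun j => ∑ T, z T j) (U : ℝ) fun j _ => (hzj j).2
    simpa [mul_comm] using this
  have hA2 : (L : ℝ) * #Aᶜ ≤ ∑ j ∈ Aᶜ, ∑ T, z T j := by
    have := card_nsmul_le_sum Aᶜ (fun j => ∑ T, z T j) (L : ℝ) fun j _ => (hzj j).1
    rw [nsmul_eq_mul] at this
    linarith
  constructor
  · exact_mod_cast hup.trans hA1
  · have : (#{i | balls c r (P i) ⊆ A} : ℝ) + L * #Aᶜ ≤ n := by linarith
    exact_mod_cast this

open Classical in
theorem isSolution_of_assignment {a : Fin n → Fin k} (ha : ∀ i, dist (P i) (c (a i)) ≤ r)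
    (hb : IsBalanced L U a) :
    IsSolution P L U c r fun T j => ((#{i | P i ∈ region c r T ∧ a i = j} : ℕ) : ℝ) := by
  have ha' : ∀ i, a i ∈ balls c r (P i) := fun i => by simp [balls, ha]
  refine ⟨fun T j _ => Nat.cast_nonneg _, fun T => ?_, fun j => ?_⟩
  · rw [← Nat.cast_sum]
    norm_cast
    rw [card_eq_sum_card_fiberwise (f := a) (t := T)]
    · simp only [filter_filter]
    · intro i hi
      simp only [coe_filter, mem_univ, true_and, Set.mem_ofPred_eq, mem_region_iff] at hi
      rw [← hi]; exact ha' i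
  · have e : ∑ T ∈ Finset.univ.filter (fun T : Finset (Fin k) => j ∈ T),
        #{i | P i ∈ region c r T ∧ a i = j} = #{i | a i = j} := by
      rw [card_eq_sum_card_fiberwise (s := {i | a i = j}) (f := fun i => balls c r (P i))
        (t := univ.filter (fun T : Finset (Fin k) => j ∈ T))]
      · refine sum_congr rfl fun T _ => ?_
        congr 1; ext i
        simp [mem_region_iff, and_comm]
      · intro i hi
        simp only [coe_filter, mem_univ, true_and, Set.mem_ofPred_eq] at hi ⊢
        rw [← hi]; exact ha' i
    rw [← Nat.cast_sum, e]
    have := hb j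
    exact ⟨by exact_mod_cast this.1, by exact_mod_cast this.2⟩

theorem feasible_of_assignment {a : Fin n → Fin k} (ha : ∀ i, dist (P i) (c (a i)) ≤ r)
    (hb : IsBalanced L U a) : Feasible P L U c r :=
  ⟨_, isSolution_of_assignment ha hb⟩

theorem Feasible.exists_assignment (hLU : L ≤ U) (h : Feasible P L U c r) :
    ∃ a : Fin n → Fin k, (∀ i, dist (P i) (c (a i)) ≤ r) ∧ IsBalanced L U a := by
  obtain ⟨a, ha, hb⟩ := h.hallCond.exists_assignment hLU
  exact ⟨a, fun i => by simpa [balls] using ha i, hb⟩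

theorem feasible_iff_hallCond (hLU : L ≤ U) :
    Feasible P L U c r ↔ HallCond L U fun i => balls c r (P i) := by
  refine ⟨Feasible.hallCond, fun h => ?_⟩
  obtain ⟨a, ha, hb⟩ := h.exists_assignment hLU
  exact feasible_of_assignment (fun i => by simpa [balls] using ha i) hb

/-- The regions change with the radius, so solutions cannot be compared directly; an integral
assignment, however, stays valid when the balls grow. -/
theorem Feasible.mono (hLU : L ≤ U) {r' : ℝ} (hr : r ≤ r') (h : Feasible P L U c r) :
    Feasible P L U c r' := by
  obtain ⟨a, ha, hb⟩ := h.exists_assignment hLU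
  exact feasible_of_assignment (fun i => (ha i).trans hr) hb

/-- If every ball contains every point, no point is confined to a proper subset of clusters, and
Hall's conditions reduce to `k * L ≤ n ≤ k * U`. This justifies the largest distance as the initial
best radius. -/
theorem feasible_of_forall_dist_le (hLU : L ≤ U) (hL : k * L ≤ n) (hU : n ≤ k * U)
    (h : ∀ i j, dist (P i) (c j) ≤ r) : Feasible P L U c r := by
  refine (feasible_iff_hallCond hLU).2 fun A => ?_
  have e : ∀ i, balls c r (P i) = univ := fun i => by ext j; simp [balls, h]
  simp only [e]
  by_cases hA : A = univ
  · subst hA; simpa [mul_comm] using hU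
  · have : ¬ univ ⊆ A := fun h' => hA (univ_subset_iff.1 h')
    simp only [this, filter_false, card_empty, zero_le, zero_add, true_and]
    have h1 : #Aᶜ ≤ k := by simpa using card_le_univ Aᶜ
    calc L * #Aᶜ ≤ L * k := Nat.mul_le_mul_left _ h1
      _ ≤ n := by rwa [mul_comm]

end solutions

/-! ## The radius found by the binary search -/

/-- One update of the best radius. -/
noncomputable def improve (R : List ℝ) (best : ℝ) (q : ℕ × ℕ) : ℝ :=
  if q.2 = 1 ∧ R.getD q.1 0 < best then R.getD q.1 0 else best

theorem radius_eq {n k d : ℕ} (P : Fin n → EuclideanSpace ℝ (Fin d)) (L U : ℕ)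
    (s : Fin k → Fin n) (τ : Fin k → Fin k) :
    radius P L U s τ = (search P L U s τ).foldl (improve (sortedDistances P s))
      ((sortedDistances P s).getLastD 0) := rfl

theorem improve_le (R : List ℝ) (best : ℝ) (q : ℕ × ℕ) : improve R best q ≤ best := by
  unfold improve; split_ifs with h
  exacts [h.2.le, le_rfl]

theorem foldl_improve_le (R : List ℝ) (l : List (ℕ × ℕ)) (best : ℝ) :
    l.foldl (improve R) best ≤ best := by
  induction l generalizing best with
  | nil => exact le_rfl
  | cons q l ih => exact (ih _).trans (improve_le _ _ _)

/-- A feasible position `m` leaves the search interval only when a feasible position at or before it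
is probed, and then the best value is at most `R` at `m`. An infeasible probe discards only
positions at or before it, which monotonicity makes infeasible. -/
theorem foldl_probes_le {p : ℝ → Prop} {R : List ℝ} (hp : ∀ x y, x ≤ y → p x → p y)
    (hR : ∀ i j, i ≤ j → j < R.length → R.getD i 0 ≤ R.getD j 0) (lo hi : ℕ) (hhi : hi ≤ R.length)
    (best : ℝ) (m : ℕ) (hm : lo ≤ m) (hm' : m < hi) (hpm : p (R.getD m 0)) :
    (probes p R lo hi).foldl (improve R) best ≤ R.getD m 0 := by
  induction lo, hi using probes.induct p R generalizing best with
  | case1 lo hi h hmid ih =>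
    rw [probes, if_pos h, if_pos hmid, List.foldl_cons]
    by_cases hlt : m < (lo + hi) / 2
    · exact ih (by omega) _ hm hlt
    · refine (foldl_improve_le _ _ _).trans
        (le_trans ?_ (hR ((lo + hi) / 2) m (by omega) (by omega)))
      unfold improve; split_ifs with h'
      · exact le_rfl
      · simpa using h'
  | case2 lo hi h hmid ih =>
    rw [probes, if_pos h, if_neg hmid, List.foldl_cons]
    by_cases hle : m ≤ (lo + hi) / 2
    · exact absurd (hp _ _ (hR _ _ hle (by omega)) hpm) hmid
    · exact ih hhi _ (by omega) hm'
  | case3 lo hi h => omega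

theorem foldl_probes_mem {p : ℝ → Prop} {R : List ℝ} (lo hi : ℕ) (best : ℝ) (hb : p best) :
    p ((probes p R lo hi).foldl (improve R) best) := by
  induction lo, hi using probes.induct p R generalizing best with
  | case1 lo hi h hmid ih =>
    rw [probes, if_pos h, if_pos hmid, List.foldl_cons]
    refine ih _ ?_
    unfold improve; split_ifs
    exacts [hmid, hb]
  | case2 lo hi h hmid ih =>
    rw [probes, if_pos h, if_neg hmid, List.foldl_cons]
    refine ih _ ?_
    simpa [improve] using hb
  | case3 lo hi h => rw [probes, if_neg h]; exact hb

section radius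
variable {n k d L U : ℕ} {P : Fin n → EuclideanSpace ℝ (Fin d)} {s : Fin k → Fin n}

theorem mem_sortedDistances {x : ℝ} :
    x ∈ sortedDistances P s ↔ ∃ i j, dist (P i) (P (s j)) = x := by
  simp [sortedDistances]

theorem length_sortedDistances : (sortedDistances P s).length = n * k := by
  simp [sortedDistances]

theorem pairwise_sortedDistances : (sortedDistances P s).Pairwise (· ≤ ·) :=
  Multiset.pairwise_sort _ _

theorem getD_sortedDistances_le (i j : ℕ) (hij : i ≤ j) (hj : j < (sortedDistances P s).length) :
    (sortedDistances P s).getD i 0 ≤ (sortedDistances P s).getD j 0 := by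
  rw [List.getD_eq_getElem _ _ hj, List.getD_eq_getElem _ _ (hij.trans_lt hj)]
  rcases hij.eq_or_lt with rfl | h
  · exact le_rfl
  · exact List.pairwise_iff_getElem.1 pairwise_sortedDistances _ _ _ _ h

theorem radius_le (hLU : L ≤ U) (τ : Fin k → Fin k) {r : ℝ} (hr : r ∈ sortedDistances P s)
    (hf : Feasible P L U (fun j => P (s (τ j))) r) : radius P L U s τ ≤ r := by
  obtain ⟨m, hm, rfl⟩ := List.mem_iff_getElem.1 hr
  rw [← List.getD_eq_getElem _ 0 hm] at hf ⊢
  exact foldl_probes_le (fun x y hxy h => h.mono hLU hxy) getD_sortedDistances_le _ _ le_rfl _ _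
    (Nat.zero_le _) hm hf

/-- The initial radius dominates all distances from input points to the centers, hence is feasible,
and later updates install only probed radii with a positive verdict. -/
theorem feasible_radius (hLU : L ≤ U) (hL : k * L ≤ n) (hU : n ≤ k * U) (hk : 1 ≤ k) (hn : 1 ≤ n)
    (τ : Fin k → Fin k) : Feasible P L U (fun j => P (s (τ j))) (radius P L U s τ) := by
  refine foldl_probes_mem _ _ _ (feasible_of_forall_dist_le hLU hL hU fun i j => ?_)
  have hlen : 0 < (sortedDistances P s).length := by
    rw [length_sortedDistances]; exact Nat.mul_pos hn hk
  obtain ⟨m, hm, e⟩ := List.mem_iff_getElem.1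
    (mem_sortedDistances.2 ⟨i, τ j, rfl⟩ : dist (P i) (P (s (τ j))) ∈ sortedDistances P s)
  have hl : (sortedDistances P s).getLastD 0
      = (sortedDistances P s).getD ((sortedDistances P s).length - 1) 0 := by
    rw [List.getLastD_eq_getLast?, List.getLast?_eq_getElem?, List.getD_eq_getElem?_getD]
  rw [hl, ← e, ← List.getD_eq_getElem _ 0 hm]
  exact getD_sortedDistances_le _ _ (by omega) (by omega)

end radius

/-! ## The approximation factor -/

theorem dist_le_cost {n k d : ℕ} (P : Fin n → EuclideanSpace ℝ (Fin d))
    (c : Fin k → EuclideanSpace ℝ (Fin d)) (a : Fin n → Fin k) (i : Fin n) :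
    dist (P i) (c (a i)) ≤ cost P c a :=
  le_ciSup (f := fun i => dist (P i) (c (a i))) (Set.finite_range _).bddAbove i

/-- If point `i` were farther than twice the cost from all selected points, the greedy rule would
make the selected points equally far apart. These `k + 1` points then cannot share `k` clusters,
since points of one cluster are within twice the cost. -/
theorem IsGonzalez.exists_dist_le {n k d : ℕ} {P : Fin n → EuclideanSpace ℝ (Fin d)}
    {s : Fin k → Fin n} (h : IsGonzalez P s) (c : Fin k → EuclideanSpace ℝ (Fin d))
    (a : Fin n → Fin k) (i : Fin n) : ∃ j, dist (P i) (P (s j)) ≤ 2 * cost P c a := by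
  by_contra! hcon
  have hpair : ∀ l j : Fin k, l < j → 2 * cost P c a < dist (P (s j)) (P (s l)) := by
    intro l j hlj
    set S := (fun l => P (s l)) '' Set.Iio j
    have hfin : S.Finite := (Set.toFinite _).image _
    have hne : S.Nonempty := ⟨_, l, hlj, rfl⟩
    obtain ⟨y, ⟨l', _, rfl⟩, hy⟩ := hfin.isCompact.exists_infDist_eq_dist hne (P i)
    have h1 := h j (by have : (l : ℕ) < j := hlj; omega) i
    have h2 : Metric.infDist (P (s j)) S ≤ dist (P (s j)) (P (s l)) :=
      Metric.infDist_le_dist_of_mem ⟨l, hlj, rfl⟩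
    calc _ < dist (P i) (P (s l')) := hcon l'
      _ = _ := hy.symm
      _ ≤ _ := h1
      _ ≤ _ := h2
  -- `none` stands for the extra point `i`; the pigeonhole principle is applied to `Option (Fin k)`,
  -- of size `k + 1`.
  let q : Option (Fin k) → Fin n := fun o => o.elim i s
  have hsame : ∀ x y : Fin n, a x = a y → dist (P x) (P y) ≤ 2 * cost P c a := by
    intro x y hxy
    have h1 := dist_le_cost P c a x
    have h2 := dist_le_cost P c a y
    rw [hxy] at h1
    have := dist_triangle_right (P x) (P y) (c (a y))
    linarith
  obtain ⟨x, y, hxy, he⟩ := Fintype.exists_ne_map_eq_of_card_lt (fun o => a (q o))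
    (by simp : Fintype.card (Fin k) < Fintype.card (Option (Fin k)))
  have hd := hsame _ _ he
  cases x with
  | none =>
    cases y with
    | none => exact hxy rfl
    | some y => exact absurd (hcon y) (not_lt.2 hd)
  | some x =>
    cases y with
    | none => rw [dist_comm] at hd; exact absurd (hcon x) (not_lt.2 hd)
    | some y =>
      have hne : x ≠ y := fun h => hxy (congrArg _ h)
      rcases lt_or_gt_of_ne hne with hlt | hlt
      · rw [dist_comm] at hd; exact absurd (hpair _ _ hlt) (not_lt.2 hd)
      · exact absurd (hpair _ _ hlt) (not_lt.2 hd)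

theorem Returns.isApprox {k n d L U : ℕ} {P : Fin n → EuclideanSpace ℝ (Fin d)}
    (hk : 1 ≤ k) (hL : 1 ≤ L) (hkL : k * L ≤ n) (hkU : n ≤ k * U)
    {s : Fin k → Fin n} {τ : Fin k → Fin k} {a : Fin n → Fin k} (h : Returns P L U s τ a) :
    IsApprox 4 P L U (fun j => P (s (τ j))) a := by
  classical
  have hLU : L ≤ U := Nat.le_of_mul_le_mul_left (hkL.trans hkU) hk
  have hn : 0 < n := lt_of_lt_of_le (Nat.mul_pos hk hL) hkL
  have : Nonempty (Fin n) := ⟨⟨0, hn⟩⟩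
  obtain ⟨hG, hmin, y, ⟨-, hT, hj⟩, hy⟩ := h
  set r := radius P L U s τ
  set c : Fin k → EuclideanSpace ℝ (Fin d) := fun j => P (s (τ j)) with hc
  simp only [mem_region_iff] at hT hy
  -- Within a region `T`, the numbers `y T j` for `j ∈ T` add up to the size of the region. The
  -- points sent to clusters of `T` thus exhaust it.
  have hmem : ∀ i, a i ∈ balls c r (P i) := by
    intro i
    set T := balls c r (P i) with hTdef
    have h1 : #{i | balls c r (P i) = T} = ∑ j ∈ T, #{i | balls c r (P i) = T ∧ a i = j} := by
      rw [sum_congr rfl fun j hjT => ?_]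
      · have := hT T
        rw [← Nat.cast_sum] at this
        exact_mod_cast this.symm
      · convert hy T j hjT
    have h2 : ∑ j ∈ T, #{i | balls c r (P i) = T ∧ a i = j}
        = #{i | balls c r (P i) = T ∧ a i ∈ T} := by
      rw [card_eq_sum_card_fiberwise (s := {i | balls c r (P i) = T ∧ a i ∈ T}) (f := a) (t := T)
        (fun i hi => by simp at hi; exact hi.2)]
      refine sum_congr rfl fun j hjT => ?_
      congr 1; ext i
      simp only [mem_filter, mem_univ, true_and]
      exact ⟨fun h => ⟨⟨h.1, h.2 ▸ hjT⟩, h.2⟩, fun h => ⟨h.1.1, h.2⟩⟩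
    have h3 := eq_of_subset_of_card_le
      (s := {i | balls c r (P i) = T ∧ a i ∈ T}) (t := {i | balls c r (P i) = T})
      (fun i hi => by simp at hi ⊢; exact hi.1) (by rw [h1, h2])
    have h4 : i ∈ ({i | balls c r (P i) = T} : Finset (Fin n)) := by simp [hTdef]
    rw [← h3] at h4
    simpa using (mem_filter.1 h4).2.2
  have hcost : cost P c a ≤ r := ciSup_le fun i => by simpa [balls] using hmem i
  refine ⟨fun j => ?_, fun c' a' hb' => ?_⟩
  · have e : ∑ T ∈ Finset.univ.filter (fun T : Finset (Fin k) => j ∈ T), y T j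
        = #{i | a i = j} := by
      rw [card_eq_sum_card_fiberwise (s := {i | a i = j}) (f := fun i => balls c r (P i))
        (t := univ.filter (fun T : Finset (Fin k) => j ∈ T))]
      · refine sum_congr rfl fun T hT => ?_
        rw [← hy T j (by simpa using hT)]
        congr 1; ext i
        simp [and_comm]
      · intro i hi
        simp only [coe_filter, mem_univ, true_and, Set.mem_ofPred_eq] at hi ⊢
        rw [← hi]; exact hmem i
    have := hj j
    rw [← Nat.cast_sum, e] at this
    exact ⟨by exact_mod_cast this.1, by exact_mod_cast this.2⟩
  -- Here `L ≥ 1` provides a representative `p j` of each competing cluster.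
  · have hne : ∀ j, ∃ i, a' i = j := fun j => by
      have : 0 < #{i | a' i = j} := lt_of_lt_of_le hL (hb' j).1
      obtain ⟨i, hi⟩ := card_pos.1 this
      exact ⟨i, by simpa using hi⟩
    choose p hp using hne
    choose τ' hτ' using fun j => hG.exists_dist_le c' a' (p j)
    -- The radius for `τ'` is attained at a point, so it occurs among the sorted distances and
    -- `radius_le` applies.
    obtain ⟨i₀, hi₀⟩ := Finite.exists_max fun i => dist (P i) (P (s (τ' (a' i))))
    have hrad : radius P L U s τ' ≤ dist (P i₀) (P (s (τ' (a' i₀)))) :=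
      radius_le hLU τ' (mem_sortedDistances.2 ⟨_, _, rfl⟩) (feasible_of_assignment hi₀ hb')
    have h1 := dist_le_cost P c' a' i₀
    have h2 := dist_le_cost P c' a' (p (a' i₀))
    rw [hp] at h2
    have h3 := hτ' (a' i₀)
    have h4 := dist_triangle (P i₀) (P (p (a' i₀))) (P (s (τ' (a' i₀))))
    have h5 := dist_triangle_right (P i₀) (P (p (a' i₀))) (c' (a' i₀))
    have h6 := hmin τ'
    linarith

end BCenter

/-! ## The program: tables and Gonzalez's algorithm -/

namespace BCenter

open RealRAM Finset

/-- Store the multiples `0, y, 2 * y, ...` in the integer array `A`, as many as `b` says. -/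
def mulTable (A b y : ℕ) : Cmd :=
  .iset 8 (.const 0) ;;
  .forLt 7 b (.istore A (.var 7) (.var 8) ;; .iset 8 (.add (.var 8) (.var y)))

/-- Index arithmetic needs products, but integers can only be added, subtracted and halved.
Accumulating the multiples costs constant time per entry, and the final accumulator is the full
product. -/
theorem run_mulTable {A b y : ℕ} (hb : b ≠ 7 ∧ b ≠ 8) (hy : y ≠ 7 ∧ y ≠ 8) (σ : State) {M v : ℕ}
    (hM : σ.ivar b = M) (hv : σ.ivar y = v) :
    Run (mulTable A b y) σ (16 * M + 9) fun σ' =>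
      (∀ i < M, σ'.iarr A i = i * v) ∧ σ'.ivar 8 = M * v := by
  refine Run.mono (T := 2 + (M * (7 + 9) + 7)) (Run.seq (Run.of_loopFree rfl ?_)) (by omega)
    (fun σ' h _ => h)
  simp only [Cmd.den, IExpr.eval]
  have := Run.forLt (x := 7) (y := b)
    (c := .istore A (.var 7) (.var 8) ;; .iset 8 (.add (.var 8) (.var y))) (σ := σ.setI 8 0)
    (T := 7) (fun m σ' => (∀ i < m, σ'.iarr A i = i * v) ∧ σ'.ivar 8 = m * v) rfl
    (by simp [Cmd.forLt, Cmd.wI, hb]) (by simp) (by simp) ?_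
  · simp only [setI_ivar, hb, if_false, hM] at this
    exact this.mono le_rfl fun σ' h _ => h.1
  · rintro m hm σ' h7 hF ⟨h1, h8⟩
    have hy' : σ'.ivar y = v := by
      rw [hF.iv y (by simp [Cmd.forLt, Cmd.wI, hy])]; simp [hy, hv]
    refine Run.of_loopFree rfl ?_
    simp only [Cmd.den, IExpr.eval, setI_iarr, putI_iarr, true_and, putI_ivar, setI_ivar, if_true,
      h7, h8, hy', Nat.succ_mul, and_true]
    intro i hi
    split_ifs with h
    · rw [h]
    · exact h1 i (by omega)

/-- Tables of the multiples of `d` and of `n`, and the number `n * k`. -/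
def tables : Cmd := mulTable 4 0 2 ;; mulTable 5 1 0 ;; .iset 6 (.var 8)

theorem run_tables (σ : State) {n k d : ℕ} (hn : σ.ivar 0 = n) (hk : σ.ivar 1 = k)
    (hd : σ.ivar 2 = d) :
    Run tables σ (16 * n + 16 * k + 20) fun σ' =>
      (∀ i < n, σ'.iarr 4 i = i * d) ∧ (∀ j < k, σ'.iarr 5 j = j * n) ∧ σ'.ivar 6 = k * n := by
  refine Run.mono (T := (16 * n + 9) + ((16 * k + 9) + 2)) (Run.seq ((run_mulTable (by decide)
    (by decide) σ hn hd).mono le_rfl fun σ₁ h₁ f₁ => ?_)) (by omega) (fun σ' h _ => h)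
  refine Run.seq ((run_mulTable (by decide) (by decide) σ₁ ((f₁.iv 1 rfl).trans hk)
    ((f₁.iv 0 rfl).trans hn)).mono le_rfl fun σ₂ h₂ f₂ => Run.of_loopFree rfl ?_)
  simp only [Cmd.den, IExpr.eval, setI_iarr, setI_ivar, if_true]
  rw [f₂.ia 4 rfl]
  exact ⟨h₁.1, h₂.1, h₂.2⟩

/-- Find a point whose distance in the real array `3` is largest. -/
def farthest : Cmd :=
  .iset 10 (.const 0) ;;
  .forLt 7 0 (.ite (.rle (.arr 3 (.var 10)) (.arr 3 (.var 7))) (.iset 10 (.var 7)) .skip)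

/-- Nothing is assumed about real array `3`, so the lemma also covers the first round, where any
point may be selected. -/
theorem run_farthest (σ : State) {n : ℕ} (hn : σ.ivar 0 = n) (h1 : 1 ≤ n) :
    Run farthest σ (18 * n + 9) fun σ' =>
      σ'.ivar 10 < n ∧ ∀ i < n, σ.rarr 3 i ≤ σ.rarr 3 (σ'.ivar 10) := by
  refine Run.mono (T := 2 + (n * (9 + 9) + 7)) (Run.seq (Run.of_loopFree rfl ?_)) (by omega)
    (fun σ' h _ => h)
  have := Run.forLt (x := 7) (y := 0)
    (c := .ite (.rle (.arr 3 (.var 10)) (.arr 3 (.var 7))) (.iset 10 (.var 7)) .skip)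
    (σ := σ.setI 10 0) (T := 9)
    (fun m σ' => σ'.ivar 10 < n ∧ ∀ i < m, σ.rarr 3 i ≤ σ.rarr 3 (σ'.ivar 10)) rfl rfl
    (by simp) (by simp; omega) ?_
  · simp only [setI_ivar, show (0 : ℕ) ≠ 10 by decide, if_false, hn] at this
    exact this.mono le_rfl fun σ' h _ => h.1
  · rintro m hm σ' h7 hF ⟨h10, hmax⟩
    have hm' : m < n := by simpa [hn] using hm
    have h3 : σ'.rarr 3 = σ.rarr 3 := hF.ra 3 rfl
    refine Run.of_loopFree rfl ?_
    simp only [Cmd.den, Cond.Holds, RExpr.eval, IExpr.eval, h7, h3]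
    split_ifs with hle
    · simp only [setI_ivar, if_true]
      refine ⟨hm', fun i hi => ?_⟩
      rcases Nat.lt_succ_iff_lt_or_eq.1 hi with h | rfl
      · exact (hmax i h).trans hle
      · exact le_rfl
    · refine ⟨h10, fun i hi => ?_⟩
      rcases Nat.lt_succ_iff_lt_or_eq.1 hi with h | rfl
      · exact hmax i h
      · exact (not_le.1 hle).le

/-- The squared distance of the points with numbers `ivar 10` and `ivar 7`. -/
def sqDist : Cmd :=
  .rset 1 .zero ;;
  .forLt 11 2 (
    .rset 2 (.sub (.arr 0 (.add (.arr 4 (.var 10)) (.var 11)))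
      (.arr 0 (.add (.arr 4 (.var 7)) (.var 11)))) ;;
    .rset 1 (.add (.var 1) (.mul (.var 2) (.var 2))))

/-- The squared distance of two points of dimension `d` whose coordinates are stored in `p`. -/
noncomputable def sqd (p : ℕ → ℝ) (d a b : ℕ) : ℝ :=
  ∑ l ∈ range d, (p (a * d + l) - p (b * d + l)) ^ 2

theorem run_sqDist (σ : State) {n d : ℕ} (hd : σ.ivar 2 = d) (h10 : σ.ivar 10 < n)
    (h7 : σ.ivar 7 < n) (h4 : ∀ i < n, σ.iarr 4 i = i * d) :
    Run sqDist σ (27 * d + 9) fun σ' =>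
      σ'.rvar 1 = sqd (σ.rarr 0) d (σ.ivar 10) (σ.ivar 7) := by
  refine Run.mono (T := 2 + (d * (18 + 9) + 7)) (Run.seq (Run.of_loopFree rfl ?_)) (by omega)
    (fun σ' h _ => h)
  have := Run.forLt (x := 11) (y := 2)
    (c := .rset 2 (.sub (.arr 0 (.add (.arr 4 (.var 10)) (.var 11)))
        (.arr 0 (.add (.arr 4 (.var 7)) (.var 11)))) ;;
      .rset 1 (.add (.var 1) (.mul (.var 2) (.var 2))))
    (σ := σ.setR 1 0) (T := 18)
    (fun m σ' => σ'.rvar 1 = ∑ l ∈ range m,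
      (σ.rarr 0 (σ.ivar 10 * d + l) - σ.rarr 0 (σ.ivar 7 * d + l)) ^ 2) rfl rfl
    (by simp) (by simp) ?_
  · simp only [setR_ivar, hd] at this
    exact this.mono le_rfl fun σ' h _ => h.1
  · rintro m hm σ' h11 hF hI
    have e0 : σ'.rarr 0 = σ.rarr 0 := hF.ra 0 rfl
    have e4 : σ'.iarr 4 = σ.iarr 4 := hF.ia 4 rfl
    have e10 : σ'.ivar 10 = σ.ivar 10 := hF.iv 10 rfl
    have e7 : σ'.ivar 7 = σ.ivar 7 := hF.iv 7 rfl
    refine Run.of_loopFree rfl ?_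
    simp [Cmd.den, e0, e4, e10, e7, h11, h4 _ h10, h4 _ h7, hI, sum_range_succ, pow_two]

/-- Store the squared distances of all points to the point `ivar 10`, and update the squared
distances to the selected points. -/
def distRowBody : Cmd :=
  sqDist ;;
  .rstore 1 (.add (.arr 5 (.var 9)) (.var 7)) (.var 1) ;;
  .rstore 2 (.add (.arr 5 (.var 9)) (.var 7)) (.var 1) ;;
  .ite (.neg (.conj (.neg (.ile (.var 9) (.const 0))) (.rle (.arr 3 (.var 7)) (.var 1))))
    (.rstore 3 (.var 7) (.var 1)) .skip

/-- The loop over all points. -/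
def distRow : Cmd := .forLt 7 0 distRowBody

open Classical in
-- Squared distances are written twice: array `1` stays indexed by center and point, array `2` will
-- be sorted. The case `j = 0` overwrites the meaningless minima in array `3`.
theorem run_distRow (σ : State) {n d j c : ℕ} (hn : σ.ivar 0 = n) (hd : σ.ivar 2 = d)
    (hc : σ.ivar 10 = c) (hcn : c < n) (hj : σ.ivar 9 = j) (h4 : ∀ i < n, σ.iarr 4 i = i * d)
    (h5 : σ.iarr 5 j = j * n) (h21 : ∀ m, σ.rarr 2 m = σ.rarr 1 m) :
    Run distRow σ (n * (27 * d + 50) + 7) fun σ' =>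
      (∀ m < j * n, σ'.rarr 1 m = σ.rarr 1 m) ∧
      (∀ i < n, σ'.rarr 1 (j * n + i) = sqd (σ.rarr 0) d c i) ∧
      (∀ m, σ'.rarr 2 m = σ'.rarr 1 m) ∧
      ∀ i < n, σ'.rarr 3 i = if j = 0 ∨ sqd (σ.rarr 0) d c i < σ.rarr 3 i
        then sqd (σ.rarr 0) d c i else σ.rarr 3 i := by
  have := Run.forLt (x := 7) (y := 0) (c := distRowBody) (σ := σ) (T := 27 * d + 41)
    (fun i₀ σ' => (∀ m < j * n, σ'.rarr 1 m = σ.rarr 1 m) ∧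
      (∀ i < i₀, σ'.rarr 1 (j * n + i) = sqd (σ.rarr 0) d c i) ∧
      (∀ m, σ'.rarr 2 m = σ'.rarr 1 m) ∧
      ∀ i < n, σ'.rarr 3 i = if i < i₀ ∧ (j = 0 ∨ sqd (σ.rarr 0) d c i < σ.rarr 3 i)
        then sqd (σ.rarr 0) d c i else σ.rarr 3 i) rfl rfl (by simp) (by simpa using h21) ?_
  · rw [hn] at this
    refine this.mono (by ring_nf; omega) fun σ' h _ => ⟨h.1.1, h.1.2.1, h.1.2.2.1, fun i hi => ?_⟩
    rw [h.1.2.2.2 i hi]; simp [hi]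
  · rintro m hm σ' h7 hF ⟨ha, hb, hc', hd'⟩
    rw [hn] at hm
    have e0 : σ'.rarr 0 = σ.rarr 0 := hF.ra 0 rfl
    have e4 : σ'.iarr 4 = σ.iarr 4 := hF.ia 4 rfl
    have e5 : σ'.iarr 5 = σ.iarr 5 := hF.ia 5 rfl
    have e10 : σ'.ivar 10 = c := (hF.iv 10 rfl).trans hc
    have e9 : σ'.ivar 9 = j := (hF.iv 9 rfl).trans hj
    have e2 : σ'.ivar 2 = d := (hF.iv 2 rfl).trans hd
    refine Run.mono (T := (27 * d + 9) + 32) (Run.seq ((run_sqDist σ' (n := n) e2 (by omega)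
      (by omega) (by rwa [e4])).mono le_rfl fun σ₁ h₁ f₁ =>
        (Run.of_loopFree rfl ?_).mono (by decide) fun σ' h _ => h)) (by omega) (fun σ' h _ => h)
    have g7 : σ₁.ivar 7 = m := (f₁.iv 7 rfl).trans h7
    have g9 : σ₁.ivar 9 = j := (f₁.iv 9 rfl).trans e9
    have g5 : σ₁.iarr 5 j = j * n := by rw [f₁.ia 5 rfl, e5, h5]
    have g1 : σ₁.rarr 1 = σ'.rarr 1 := f₁.ra 1 rfl
    have g2 : σ₁.rarr 2 = σ'.rarr 2 := f₁.ra 2 rfl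
    have g3 : σ₁.rarr 3 = σ'.rarr 3 := f₁.ra 3 rfl
    rw [e10, h7, e0] at h₁
    have hm3 := hd' m hm
    simp only [lt_irrefl, false_and, if_false] at hm3
    have c1 : ∀ i < m + 1, (if j * n + i = j * n + m then sqd (σ.rarr 0) d c m else
        σ'.rarr 1 (j * n + i)) = sqd (σ.rarr 0) d c i := by
      intro i hi
      split_ifs with h
      · obtain rfl : i = m := by omega
        rfl
      · exact hb i (by omega)
    have c2 : ∀ q < j * n, (if q = j * n + m then sqd (σ.rarr 0) d c m else
        σ'.rarr 1 q) = σ.rarr 1 q := by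
      intro q hq
      rw [if_neg (by omega), ha q hq]
    simp only [Cmd.den, Cond.Holds, RExpr.eval, IExpr.eval, putR_ivar, putR_iarr, putR_rvar,
      g7, g9, g5, h₁, putR_rarr, Nat.reduceEqDiff, false_and, if_false, g3, hm3]
    split_ifs with hcond
    · have hcond' : ¬ (j = 0 ∨ sqd (σ.rarr 0) d c m < σ.rarr 3 m) := by
        rintro (h | h)
        · exact hcond.1 h.le
        · exact absurd hcond.2 (not_le.2 h)
      refine ⟨by simpa [g1] using c2, by simpa [g1] using c1, by simp [hc', g1, g2],
        fun i hi => ?_⟩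
      by_cases him : i = m
      · subst him; simp [g3, hm3, hcond']
      · have : i < m + 1 ↔ i < m := by omega
        simp [g3, hd' i hi, this]
    · have hcond' : j = 0 ∨ sqd (σ.rarr 0) d c m < σ.rarr 3 m := by
        by_contra! hcon
        exact hcond ⟨by omega, hcon.2⟩
      refine ⟨by simpa [g1] using c2, by simpa [g1] using c1, by simp [hc', g1, g2],
        fun i hi => ?_⟩
      by_cases him : i = m
      · subst him; simp [hcond']
      · have : i < m + 1 ↔ i < m := by omega
        simp [him, g3, hd' i hi, this]

/-- One round of Gonzalez's algorithm. -/
def gonzalezBody : Cmd := farthest ;; .istore 0 (.var 9) (.var 10) ;; distRow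

/-- Gonzalez's algorithm, with all squared distances to the selected points. -/
def gonzalez : Cmd := .forLt 9 1 gonzalezBody

/-- Gonzalez's algorithm may select `s 0, ..., s (k - 1)`, in terms of squared distances. -/
def GonzalezSel (δ : ℕ → ℕ → ℝ) (n k : ℕ) (s : ℕ → ℕ) : Prop :=
  ∀ j < k, 0 < j → ∀ i < n, ∃ l < j, ∀ l' < j, δ (s l) i ≤ δ (s l') (s j)

theorem run_gonzalez (σ : State) {n k d : ℕ} (hn : σ.ivar 0 = n) (hk : σ.ivar 1 = k)
    (hd : σ.ivar 2 = d) (h1 : 1 ≤ n) (h4 : ∀ i < n, σ.iarr 4 i = i * d)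
    (h5 : ∀ j < k, σ.iarr 5 j = j * n) (h21 : ∀ m, σ.rarr 2 m = σ.rarr 1 m) :
    Run gonzalez σ (k * (n * (27 * d + 68) + 28) + 7) fun σ' =>
      (∀ j < k, σ'.iarr 0 j < n) ∧
      (∀ j < k, ∀ i < n, σ'.rarr 1 (j * n + i) = sqd (σ.rarr 0) d (σ'.iarr 0 j) i) ∧
      (∀ m, σ'.rarr 2 m = σ'.rarr 1 m) ∧
      GonzalezSel (sqd (σ.rarr 0) d) n k (σ'.iarr 0) := by
  set δ := sqd (σ.rarr 0) d with hδ
  have := Run.forLt (x := 9) (y := 1) (c := gonzalezBody) (σ := σ)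
    (T := n * (27 * d + 68) + 19)
    (fun j σ' => (∀ l < j, σ'.iarr 0 l < n) ∧
      (∀ l < j, ∀ i < n, σ'.rarr 1 (l * n + i) = δ (σ'.iarr 0 l) i) ∧
      (∀ m, σ'.rarr 2 m = σ'.rarr 1 m) ∧
      GonzalezSel δ n j (σ'.iarr 0) ∧
      -- Array `3` holds the minimum over the selected points, expressed as an attained lower bound;
      -- before the first round there is no such minimum.
      (0 < j → ∀ i < n, (∀ l < j, σ'.rarr 3 i ≤ δ (σ'.iarr 0 l) i) ∧
        ∃ l < j, σ'.rarr 3 i = δ (σ'.iarr 0 l) i)) rfl rfl (by simp)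
    (by simpa [GonzalezSel] using h21) ?_
  · rw [hk] at this
    refine this.mono (by ring_nf; omega) fun σ' h _ =>
      ⟨h.1.1, h.1.2.1, h.1.2.2.1, h.1.2.2.2.1⟩
  · rintro j hj σ' h9 hF ⟨ha, hb, hc, hg, hm⟩
    rw [hk] at hj
    have e0 : σ'.ivar 0 = n := (hF.iv 0 rfl).trans hn
    have e2 : σ'.ivar 2 = d := (hF.iv 2 rfl).trans hd
    refine Run.mono (T := (18 * n + 9) + (3 + (n * (27 * d + 50) + 7)))
      (Run.seq ((run_farthest σ' e0 h1).mono le_rfl fun σ₁ h₁ f₁ =>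
        Run.seq (Run.of_loopFree rfl ?_))) (by ring_nf; omega) (fun σ' h _ => h)
    obtain ⟨hcn, hmax⟩ := h₁
    set c := σ₁.ivar 10 with hcdef
    have g9 : σ₁.ivar 9 = j := (f₁.iv 9 rfl).trans h9
    have g2 : σ₁.rarr 2 = σ'.rarr 2 := f₁.ra 2 rfl
    have g1 : σ₁.rarr 1 = σ'.rarr 1 := f₁.ra 1 rfl
    have g3 : σ₁.rarr 3 = σ'.rarr 3 := f₁.ra 3 rfl
    have g0 : σ₁.rarr 0 = σ.rarr 0 := (f₁.ra 0 rfl).trans (hF.ra 0 rfl)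
    have i0 : σ₁.iarr 0 = σ'.iarr 0 := f₁.ia 0 rfl
    simp only [Cmd.den, IExpr.eval, g9, ← hcdef]
    refine (run_distRow (σ₁.putI 0 j c) (n := n) (d := d) (j := j) (c := c)
      ((f₁.iv 0 rfl).trans e0) ((f₁.iv 2 rfl).trans e2) rfl hcn g9 ?_ ?_ ?_).mono le_rfl ?_
    · intro i hi
      simp only [putI_iarr, show (4 : ℕ) ≠ 0 by decide, false_and, if_false]
      rw [f₁.ia 4 rfl, hF.ia 4 rfl, h4 i hi]
    · simp only [putI_iarr, show (5 : ℕ) ≠ 0 by decide, false_and, if_false]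
      rw [f₁.ia 5 rfl, hF.ia 5 rfl, h5 j hj]
    · simpa [g1, g2] using hc
    · rintro σ₂ ⟨q1, q2, q3, q4⟩ f₂
      have hs : ∀ l, σ₂.iarr 0 l = if l = j then c else σ'.iarr 0 l := by
        intro l; rw [f₂.ia 0 rfl]; simp [i0]
      have hsj : σ₂.iarr 0 j = c := by simp [hs]
      have hsl : ∀ l < j, σ₂.iarr 0 l = σ'.iarr 0 l := fun l hl => by
        rw [hs, if_neg (by omega)]
      simp only [putI_rarr, g1, g0, g3, ← hδ] at q1 q2 q4
      refine ⟨fun l hl => ?_, fun l hl i hi => ?_, q3, ?_, fun _ i hi => ?_⟩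
      · rcases Nat.lt_succ_iff_lt_or_eq.1 hl with h | rfl
        · rw [hsl l h]; exact ha l h
        · rw [hsj]; exact hcn
      · rcases Nat.lt_succ_iff_lt_or_eq.1 hl with h | rfl
        · rw [hsl l h, q1 _ (by nlinarith), hb l h i hi]
        · rw [hsj, q2 i hi]
      · intro j' hj' hj0 i hi
        rcases Nat.lt_succ_iff_lt_or_eq.1 hj' with h | rfl
        · obtain ⟨l, hl, hl'⟩ := hg j' h hj0 i hi
          refine ⟨l, hl, fun l' hl'' => ?_⟩
          rw [hsl l (by omega), hsl l' (by omega), hsl j' h]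
          exact hl' l' hl''
        · obtain ⟨l, hl, hl'⟩ := (hm hj0 i hi).2
          refine ⟨l, hl, fun l' hl'' => ?_⟩
          rw [hsl l hl, hsl l' hl'', hsj, ← hl']
          exact (hmax i hi).trans ((hm hj0 c hcn).1 l' hl'')
      · rw [q4 i hi]
        constructor
        · intro l hl
          rcases Nat.lt_succ_iff_lt_or_eq.1 hl with h | rfl
          · rw [hsl l h]
            have := (hm (by omega) i hi).1 l h
            split_ifs with hif
            · rcases hif with h0 | h0
              · omega
              · linarith
            · exact this
          · rw [hsj]
            split_ifs with hif
            · exact le_rfl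
            · exact not_lt.1 fun h => hif (Or.inr h)
        · split_ifs with hif
          · exact ⟨j, by omega, by rw [hsj]⟩
          · obtain ⟨l, hl, hl'⟩ := (hm (Nat.pos_of_ne_zero fun h => hif (Or.inl h)) i hi).2
            exact ⟨l, by omega, by rw [hsl l hl, hl']⟩

end BCenter

/-! ## The program: merge sort -/

namespace BCenter

open RealRAM Finset

/-- Take one element in a merge. -/
def mergeStep : Cmd :=
  .ite (.conj (.neg (.ile (.var 14) (.var 16)))
      (.neg (.conj (.neg (.ile (.var 15) (.var 17)))
        (.neg (.rle (.arr 2 (.var 16)) (.arr 2 (.var 17)))))))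
    (.rstore 4 (.var 18) (.arr 2 (.var 16)) ;; .iset 16 (.add (.var 16) (.const 1)))
    (.rstore 4 (.var 18) (.arr 2 (.var 17)) ;; .iset 17 (.add (.var 17) (.const 1))) ;;
  .iset 18 (.add (.var 18) (.const 1))

/-- Merge two neighbouring runs. -/
def mergeRuns : Cmd := .loop (.neg (.ile (.var 15) (.var 18))) mergeStep

theorem map_range_update {A B : ℕ → ℝ} {p : ℕ} (h : ∀ x < p, A x = B x) :
    (Multiset.range p).map A = (Multiset.range p).map B :=
  Multiset.map_congr rfl fun x hx => h x (Multiset.mem_range.1 hx)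

/-- Contents are compared as multisets of whole prefixes. This makes consecutive merges of a pass
compose without any bookkeeping for single blocks. -/
theorem run_mergeRuns (σ : State) {lo mid hi : ℕ} (h14 : σ.ivar 14 = mid) (h15 : σ.ivar 15 = hi)
    (h16 : σ.ivar 16 = lo) (h17 : σ.ivar 17 = mid) (h18 : σ.ivar 18 = lo)
    (hlm : lo ≤ mid) (hmh : mid ≤ hi)
    (hs₁ : ∀ x y, lo ≤ x → x < y → y < mid → σ.rarr 2 x ≤ σ.rarr 2 y)
    (hs₂ : ∀ x y, mid ≤ x → x < y → y < hi → σ.rarr 2 x ≤ σ.rarr 2 y)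
    (hm : (Multiset.range lo).map (σ.rarr 4) = (Multiset.range lo).map (σ.rarr 2)) :
    Run mergeRuns σ ((hi - lo) * 43 + 5) fun σ' =>
      (∀ x < lo, σ'.rarr 4 x = σ.rarr 4 x) ∧
      (∀ x y, lo ≤ x → x < y → y < hi → σ'.rarr 4 x ≤ σ'.rarr 4 y) ∧
      (Multiset.range hi).map (σ'.rarr 4) = (Multiset.range hi).map (σ.rarr 2) := by
  set A := σ.rarr 2 with hA
  have := Run.loop_of_count (b := .neg (.ile (.var 15) (.var 18))) (c := mergeStep) σ (hi - lo) 38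
    (fun m σ' => ∃ i j, σ'.ivar 16 = i ∧ σ'.ivar 17 = j ∧ σ'.ivar 18 = lo + m ∧
      lo ≤ i ∧ i ≤ mid ∧ mid ≤ j ∧ j ≤ hi ∧ lo + m + mid = i + j ∧
      (∀ x < lo, σ'.rarr 4 x = σ.rarr 4 x) ∧
      (∀ x y, lo ≤ x → x < y → y < lo + m → σ'.rarr 4 x ≤ σ'.rarr 4 y) ∧
      (∀ x, lo ≤ x → x < lo + m → (∀ y, i ≤ y → y < mid → σ'.rarr 4 x ≤ A y) ∧
        ∀ y, j ≤ y → y < hi → σ'.rarr 4 x ≤ A y) ∧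
      -- The overlap of the two input prefixes is added on the left, which avoids subtraction. At
      -- the end `i = mid` and `j = hi`, and the prefix up to `mid` cancels.
      (Multiset.range (lo + m)).map (σ'.rarr 4) + (Multiset.range mid).map A =
        (Multiset.range i).map A + (Multiset.range j).map A)
    ⟨lo, mid, h16, h17, h18, le_rfl, hlm, le_rfl, hmh, by omega, fun _ _ => rfl,
      fun x y _ _ _ => by omega, fun x _ _ => by omega, by rw [add_zero, hm]⟩ ?_ ?_
  · refine this.mono ?_ ?_
    · change (hi - lo) * (38 + 4 + 1) + 4 + 1 ≤ _
      omega
    · rintro σ' ⟨⟨i, j, -, -, -, hi₁, hi₂, hj₁, hj₂, he, ha, hb, -, hc⟩, -⟩ -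
      obtain ⟨rfl, rfl⟩ : i = mid ∧ j = hi := by omega
      rw [show lo + (j - lo) = j by omega] at hb hc
      rw [add_comm] at hc
      exact ⟨ha, hb, add_left_cancel hc⟩
  · rintro m hm' σ' hF ⟨i, j, e16, e17, e18, hi₁, hi₂, hj₁, hj₂, he, ha, hb, hc, hd⟩
    have e14 : σ'.ivar 14 = mid := (hF.iv 14 rfl).trans h14
    have e15 : σ'.ivar 15 = hi := (hF.iv 15 rfl).trans h15
    have e2 : σ'.rarr 2 = A := hF.ra 2 rfl
    refine ⟨by simp [e15, e18]; omega, (Run.of_loopFree rfl ?_).mono (by decide) fun σ' h _ => h⟩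
    simp only [mergeStep, Cmd.den, Cond.Holds, RExpr.eval, IExpr.eval, e14, e15, e16, e17, e18, e2]
    have key : ∀ v : ℝ, (∀ x, lo ≤ x → x < lo + m → σ'.rarr 4 x ≤ v) →
        (∀ x < lo, (if x = lo + m then v else σ'.rarr 4 x) = σ.rarr 4 x) ∧
        (∀ x y, lo ≤ x → x < y → y < lo + (m + 1) →
          (if x = lo + m then v else σ'.rarr 4 x) ≤ if y = lo + m then v else σ'.rarr 4 y) ∧
        ((Multiset.range (lo + (m + 1))).map fun x => if x = lo + m then v else σ'.rarr 4 x) =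
          v ::ₘ (Multiset.range (lo + m)).map (σ'.rarr 4) := by
      intro v hv
      refine ⟨fun x hx => by rw [if_neg (by omega), ha x hx], fun x y hx hxy hy => ?_, ?_⟩
      · rw [if_neg (by omega)]
        split_ifs with h
        · exact hv x hx (by omega)
        · exact hb x y hx hxy (by omega)
      · rw [← add_assoc, Multiset.range_succ, Multiset.map_cons, if_pos rfl,
          map_range_update fun x hx => if_neg (by omega)]
    split_ifs with hcond
    · obtain ⟨hi₃, hcond⟩ := hcond
      have hij : ∀ y, j ≤ y → y < hi → A i ≤ A y := by
        intro y hjy hy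
        have h1 : A i ≤ A j := by
          by_contra hcon
          exact hcond ⟨by omega, hcon⟩
        rcases hjy.eq_or_lt with rfl | h
        · exact h1
        · exact h1.trans (hs₂ _ _ hj₁ h hy)
      have hii : ∀ y, i ≤ y → y < mid → A i ≤ A y := by
        intro y hiy hy
        rcases hiy.eq_or_lt with rfl | h
        · exact le_rfl
        · exact hs₁ _ _ hi₁ h hy
      obtain ⟨k1, k2, k3⟩ := key (A i) fun x hx hx' => (hc x hx hx').1 i le_rfl (by omega)
      refine ⟨i + 1, j, by simp [e16], by simp [e17], by simp [e18]; omega, by omega, by omega, hj₁,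
        hj₂, by omega, by simpa using k1, by simpa using k2, ?_, ?_⟩
      · intro x hx hx'
        simp only [setI_rarr, putR_rarr, true_and]
        split_ifs with h
        · exact ⟨fun y hy hy' => hii y (by omega) hy', hij⟩
        · have := hc x hx (by omega)
          exact ⟨fun y hy hy' => this.1 y (by omega) hy', this.2⟩
      · simp only [setI_rarr, putR_rarr, true_and]
        rw [k3, Multiset.cons_add, hd, Multiset.range_succ, Multiset.map_cons, Multiset.cons_add]
    · have hj₃ : j < hi := by
        by_contra hcon
        exact hcond ⟨by omega, fun h => h.1 (by omega)⟩
      have hji : ∀ y, i ≤ y → y < mid → A j ≤ A y := by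
        intro y hiy hy
        have h1 : A j ≤ A i := by
          by_contra hcon
          exact hcond ⟨by omega, fun h => h.2 (not_le.1 hcon).le⟩
        rcases hiy.eq_or_lt with rfl | h
        · exact h1
        · exact h1.trans (hs₁ _ _ hi₁ h hy)
      have hjj : ∀ y, j ≤ y → y < hi → A j ≤ A y := by
        intro y hjy hy
        rcases hjy.eq_or_lt with rfl | h
        · exact le_rfl
        · exact hs₂ _ _ hj₁ h hy
      obtain ⟨k1, k2, k3⟩ := key (A j) fun x hx hx' => (hc x hx hx').2 j le_rfl (by omega)
      refine ⟨i, j + 1, by simp [e16], by simp [e17], by simp [e18]; omega, hi₁, hi₂, by omega,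
        by omega, by omega, by simpa using k1, by simpa using k2, ?_, ?_⟩
      · intro x hx hx'
        simp only [setI_rarr, putR_rarr, true_and]
        split_ifs with h
        · exact ⟨hji, fun y hy hy' => hjj y (by omega) hy'⟩
        · have := hc x hx (by omega)
          exact ⟨this.1, fun y hy hy' => this.2 y (by omega) hy'⟩
      · simp only [setI_rarr, putR_rarr, true_and]
        rw [k3, Multiset.cons_add, hd, Multiset.range_succ, Multiset.map_cons, Multiset.add_cons]
  · rintro σ' hF ⟨i, j, -, -, e18, -⟩
    have e15 : σ'.ivar 15 = hi := (hF.iv 15 rfl).trans h15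
    simp [e15, e18]; omega

/-- The first `N` entries are sorted within each block of length `w`. -/
def BlockSorted (A : ℕ → ℝ) (w N : ℕ) : Prop :=
  ∀ x y, x < y → y < N → x / w = y / w → A x ≤ A y

/-- Set up the next merge. -/
def mergeSetup : Cmd :=
  .iset 14 (.add (.var 13) (.var 12)) ;;
  .iset 14 (.sub (.var 14) (.sub (.var 14) (.var 6))) ;;
  .iset 15 (.add (.var 14) (.var 12)) ;;
  .iset 15 (.sub (.var 15) (.sub (.var 15) (.var 6))) ;;
  .iset 16 (.var 13) ;; .iset 17 (.var 14) ;; .iset 18 (.var 13)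

/-- The body of the loop over pairs of runs. -/
def mergeBody : Cmd := mergeSetup ;; mergeRuns ;; .iset 13 (.var 15)

/-- Merge all pairs of neighbouring runs of length `ivar 12`. -/
def mergePass : Cmd :=
  .iset 13 (.const 0) ;; .loop (.neg (.ile (.var 6) (.var 13))) mergeBody

theorem run_mergePass (σ : State) {w N : ℕ} (h12 : σ.ivar 12 = w) (h6 : σ.ivar 6 = N)
    (hw : 0 < w) (hs : BlockSorted (σ.rarr 2) w N) :
    Run mergePass σ (N * 93 + 7) fun σ' => BlockSorted (σ'.rarr 4) (w + w) N ∧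
      (Multiset.range N).map (σ'.rarr 4) = (Multiset.range N).map (σ.rarr 2) := by
  set A := σ.rarr 2 with hA
  have := Run.loop_of_potential (b := .neg (.ile (.var 6) (.var 13))) (c := mergeBody)
    (σ.setI 13 0)
    (fun σ' => ∃ lo, σ'.ivar 13 = lo ∧ lo ≤ N ∧ (lo = N ∨ ∃ q, lo = q * (w + w)) ∧
      BlockSorted (σ'.rarr 4) (w + w) lo ∧
      (Multiset.range lo).map (σ'.rarr 4) = (Multiset.range lo).map A)
    -- A merge costs 43 per element plus 50 for setup and tests; as it handles at least one element,
    -- 93 per element is enough.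
    (fun σ' => (N - σ'.ivar 13) * 93)
    ⟨0, by simp, by omega, Or.inr ⟨0, by simp⟩, fun x y _ h => by omega, by simp⟩ ?_
  · refine Run.mono (T := 2 + (N * 93 + 5)) (Run.seq (Run.of_loopFree rfl ?_)) (by omega)
      (fun σ' h _ => h)
    refine this.mono (by simp [Cond.cost, IExpr.cost]) ?_
    rintro σ' ⟨⟨lo, h13, hlo, -, h1, h2⟩, hb, hF⟩ -
    have e6 : σ'.ivar 6 = N := (hF.iv 6 rfl).trans (by simpa using h6)
    obtain rfl : lo = N := by
      simp [e6, h13] at hb; omega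
    exact ⟨h1, h2⟩
  · rintro σ' hF ⟨lo, h13, hlo, hq, h1, h2⟩ hb
    have e6 : σ'.ivar 6 = N := (hF.iv 6 rfl).trans (by simpa using h6)
    have e12 : σ'.ivar 12 = w := (hF.iv 12 rfl).trans (by simpa using h12)
    have e2 : σ'.rarr 2 = A := hF.ra 2 rfl
    have hlt : lo < N := by simpa [e6, h13] using hb
    obtain ⟨q, rfl⟩ : ∃ q, lo = q * (w + w) := hq.resolve_left (by omega)
    set lo := q * (w + w) with hlo'
    obtain ⟨mid, hmid⟩ : ∃ mid, mid = min (lo + w) N := ⟨_, rfl⟩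
    obtain ⟨hi, hhi⟩ : ∃ hi, hi = min (mid + w) N := ⟨_, rfl⟩
    have hblock : ∀ x, lo ≤ x → x < lo + w → x / w = 2 * q := fun x hx hx' =>
      Nat.div_eq_of_lt_le (by rw [mul_comm]; nlinarith) (by nlinarith)
    have hblock' : ∀ x, lo + w ≤ x → x < lo + w + w → x / w = 2 * q + 1 := fun x hx hx' =>
      Nat.div_eq_of_lt_le (by nlinarith) (by nlinarith)
    refine ⟨38 + (((hi - lo) * 43 + 5) + 2), Run.seq ((Run.of_loopFree (c := mergeSetup) rfl
      (Q := fun σ₁ => σ₁.ivar 14 = mid ∧ σ₁.ivar 15 = hi ∧ σ₁.ivar 16 = lo ∧ σ₁.ivar 17 = mid ∧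
        σ₁.ivar 18 = lo) ?_).mono (by decide) ?_)⟩
    -- With truncated subtraction, `x - (x - N)` is `min x N`; this trims the last runs.
    · have c1 : lo + w - (lo + w - N) = mid := by omega
      have c2 : mid + w - (mid + w - N) = hi := by omega
      simp [mergeSetup, Cmd.den, e6, e12, h13, c1, c2]
    · rintro σ₁ ⟨g14, g15, g16, g17, g18⟩ f₁
      have g2 : σ₁.rarr 2 = A := (f₁.ra 2 rfl).trans e2
      have g4 : σ₁.rarr 4 = σ'.rarr 4 := f₁.ra 4 rfl
      refine Run.seq ((run_mergeRuns σ₁ g14 g15 g16 g17 g18 (by omega) (by omega) ?_ ?_ ?_).mono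
        le_rfl ?_)
      · intro x y hx hxy hy
        rw [g2]
        refine hs x y hxy (by omega) ?_
        rw [hblock x hx (by omega), hblock y (by omega) (by omega)]
      · intro x y hx hxy hy
        rw [g2]
        refine hs x y hxy (by omega) ?_
        rw [hblock' x (by omega) (by omega), hblock' y (by omega) (by omega)]
      · rw [g4, g2, h2]
      · rintro σ₂ ⟨k1, k2, k3⟩ f₂
        refine Run.of_loopFree rfl ?_
        have g15' : σ₂.ivar 15 = hi := (f₂.iv 15 rfl).trans g15
        simp only [Cmd.den, IExpr.eval, setI_ivar, if_true, setI_rarr, g15', h13, Cond.cost,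
          IExpr.cost]
        refine ⟨⟨hi, rfl, by omega, ?_, ?_, by rw [k3, g2]⟩, by omega⟩
        · by_cases h : hi = N
          · exact Or.inl h
          · exact Or.inr ⟨q + 1, by rw [Nat.succ_mul]; omega⟩
        · intro x y hxy hy he
          have hy2 : y < lo + (w + w) := by omega
          by_cases hylo : y < lo
          · rw [k1 x (by omega), k1 y hylo, g4]
            exact h1 x y hxy hylo he
          · have hyq : y / (w + w) = q :=
              Nat.div_eq_of_lt_le (by omega) (by rw [Nat.succ_mul]; omega)
            have hx : lo ≤ x := by
              rw [hyq] at he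
              have := Nat.div_mul_le_self x (w + w)
              rw [he] at this; exact this
            exact k2 x y hx hxy hy

/-- Copy the real array `4` to the real array `2`. -/
def copyBack : Cmd := .forLt 7 6 (.rstore 2 (.var 7) (.arr 4 (.var 7)))

theorem run_copyBack (σ : State) {N : ℕ} (h6 : σ.ivar 6 = N) :
    Run copyBack σ (N * 13 + 7) fun σ' => ∀ m < N, σ'.rarr 2 m = σ.rarr 4 m := by
  have := Run.forLt (x := 7) (y := 6) (c := .rstore 2 (.var 7) (.arr 4 (.var 7))) (σ := σ)
    (T := 4) (fun i σ' => ∀ m < i, σ'.rarr 2 m = σ.rarr 4 m) rfl rfl (by simp) (by simp) ?_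
  · rw [h6] at this
    exact this.mono le_rfl fun σ' h _ => h.1
  · rintro m hm σ' h7 hF hI
    have e4 : σ'.rarr 4 = σ.rarr 4 := hF.ra 4 rfl
    refine Run.of_loopFree rfl ?_
    intro i hi
    simp only [Cmd.den, IExpr.eval, RExpr.eval, putR_rarr, h7, e4, true_and]
    split_ifs with h
    · rw [h]
    · exact hI i (by omega)

/-- Merge sort of the first `ivar 6` cells of the real array `2`. -/
def sortArray : Cmd :=
  .iset 12 (.const 1) ;;
  .loop (.neg (.ile (.var 6) (.var 12)))
    (mergePass ;; copyBack ;; .iset 12 (.add (.var 12) (.var 12)))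

/-- After `m` passes the blocks of length `2 ^ m` are sorted. `Nat.clog 2 N` is the first `m` with
`N ≤ 2 ^ m`, when one block covers the array. -/
theorem run_sortArray (σ : State) {N : ℕ} (h6 : σ.ivar 6 = N) :
    Run sortArray σ (Nat.clog 2 N * (N * 106 + 30) + 7) fun σ' =>
      (∀ x y, x ≤ y → y < N → σ'.rarr 2 x ≤ σ'.rarr 2 y) ∧
      (Multiset.range N).map (σ'.rarr 2) = (Multiset.range N).map (σ.rarr 2) := by
  have := Run.loop_of_count (b := .neg (.ile (.var 6) (.var 12)))
    (c := mergePass ;; copyBack ;; .iset 12 (.add (.var 12) (.var 12))) (σ.setI 12 1)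
    (Nat.clog 2 N) ((N * 93 + 7) + ((N * 13 + 7) + 4))
    (fun m σ' => σ'.ivar 12 = 2 ^ m ∧ BlockSorted (σ'.rarr 2) (2 ^ m) N ∧
      (Multiset.range N).map (σ'.rarr 2) = (Multiset.range N).map (σ.rarr 2))
    ⟨by simp, fun x y hxy _ h => by simp at h; omega, by simp⟩ ?_ ?_
  · refine Run.mono (T := 2 + (Nat.clog 2 N * (N * 106 + 30) + 5))
      (Run.seq (Run.of_loopFree rfl ?_)) (by omega) (fun σ' h _ => h)
    refine this.mono (by simp only [Cond.cost, IExpr.cost]; ring_nf; omega) ?_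
    rintro σ' ⟨⟨-, hs, hm⟩, -⟩ -
    refine ⟨fun x y hxy hy => ?_, hm⟩
    rcases hxy.eq_or_lt with rfl | h
    · exact le_rfl
    · have hN : N ≤ 2 ^ Nat.clog 2 N := Nat.le_pow_clog (by norm_num) N
      exact hs x y h hy (by rw [Nat.div_eq_of_lt (by omega), Nat.div_eq_of_lt (by omega)])
  · rintro m hm σ' hF ⟨h12, hs, hmul⟩
    have e6 : σ'.ivar 6 = N := (hF.iv 6 rfl).trans (by simpa using h6)
    refine ⟨?_, Run.seq ((run_mergePass σ' h12 e6 (by positivity) hs).mono le_rfl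
      fun σ₁ h₁ f₁ => Run.seq ((run_copyBack σ₁ ((f₁.iv 6 rfl).trans e6)).mono le_rfl
        fun σ₂ h₂ f₂ => Run.of_loopFree rfl ?_))⟩
    · have := (Nat.lt_clog_iff_pow_lt (by norm_num)).1 hm
      simpa [e6, h12] using this
    · have g12 : σ₂.ivar 12 = 2 ^ m := ((f₂.iv 12 rfl).trans (f₁.iv 12 rfl)).trans h12
      have ew : 2 ^ (m + 1) = 2 ^ m + 2 ^ m := by ring
      simp only [Cmd.den, IExpr.eval, setI_ivar, if_true, setI_rarr, g12, ew, true_and]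
      refine ⟨fun x y hxy hy he => ?_, ?_⟩
      · rw [h₂ x (by omega), h₂ y hy]; exact h₁.1 x y hxy hy he
      · rw [map_range_update h₂, h₁.2, hmul]
  · rintro σ' hF ⟨h12, -⟩
    have e6 : σ'.ivar 6 = N := (hF.iv 6 rfl).trans (by simpa using h6)
    have hN : N ≤ 2 ^ Nat.clog 2 N := Nat.le_pow_clog (by norm_num) N
    simpa [e6, h12] using hN

end BCenter

/-! ## The program: the table of tuples -/

namespace BCenter

open RealRAM Finset

/-- The `j`-th digit of `e` in base `k`. -/
def digit (k e j : ℕ) : ℕ := e / k ^ j % k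

theorem digit_lt {k : ℕ} (hk : 1 ≤ k) (e j : ℕ) : digit k e j < k := Nat.mod_lt _ hk

/-- When `1` is added to `e`, a carry reaches position `j` exactly if `k ^ j ∣ e + 1`. So `v` is the
digit plus carry, and `k ≤ v` is the test for passing the carry on. -/
theorem digit_succ {k : ℕ} (hk : 1 ≤ k) (e j : ℕ) :
    let v := digit k e j + if k ^ j ∣ e + 1 then 1 else 0
    (k ≤ v → digit k (e + 1) j = 0 ∧ k ^ (j + 1) ∣ e + 1) ∧
      (¬ k ≤ v → digit k (e + 1) j = v ∧ ¬ k ^ (j + 1) ∣ e + 1) := by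
  intro v
  have hdiv : ∀ h : k ^ j ∣ e + 1, (k ^ (j + 1) ∣ e + 1 ↔ (e + 1) / k ^ j % k = 0) := by
    intro h
    rw [pow_succ, ← Nat.dvd_iff_mod_eq_zero]
    exact (Nat.dvd_div_iff_mul_dvd h).symm
  have hlt : e / k ^ j % k < k := Nat.mod_lt _ hk
  have hs : (e + 1) / k ^ j = e / k ^ j + if k ^ j ∣ e + 1 then 1 else 0 := Nat.succ_div ..
  by_cases h : k ^ j ∣ e + 1
  · rw [if_pos h] at hs
    have hv : v = e / k ^ j % k + 1 := by simp [v, digit, h]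
    rw [hv, hdiv h]
    unfold digit
    rw [hs]
    constructor
    · intro hle
      have : (e / k ^ j + 1) % k = 0 := by
        rw [Nat.add_mod, show e / k ^ j % k = k - 1 by omega]
        -- In base `1` one has `1 % 1 = 0`, so the general computation does not apply.
        rcases hk.eq_or_lt with rfl | hk1
        · simp
        · rw [Nat.mod_eq_of_lt hk1, Nat.sub_add_cancel hk, Nat.mod_self]
      exact ⟨this, this⟩
    · intro hle
      have : (e / k ^ j + 1) % k = e / k ^ j % k + 1 := by
        rw [Nat.add_mod, Nat.mod_eq_of_lt (show 1 < k by omega),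
          Nat.mod_eq_of_lt (show e / k ^ j % k + 1 < k by omega)]
      rw [this]
      exact ⟨rfl, by omega⟩
  · rw [if_neg h, add_zero] at hs
    have hv : v = e / k ^ j % k := by simp [v, digit, h]
    rw [hv]
    refine ⟨fun h' => by omega, fun _ => ⟨?_, fun h' => h ?_⟩⟩
    · unfold digit; rw [hs]
    · exact (pow_dvd_pow k (Nat.le_succ j)).trans h'

/-- Compute one digit of the next tuple. -/
def carryBody : Cmd :=
  .iset 10 (.add (.arr 6 (.add (.var 8) (.var 7))) (.var 9)) ;;
  .ite (.ile (.var 1) (.var 10))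
    (.istore 6 (.add (.var 12) (.var 7)) (.const 0) ;; .iset 9 (.const 1))
    (.istore 6 (.add (.var 12) (.var 7)) (.var 10) ;; .iset 9 (.const 0))

theorem run_carry (σ : State) {k e : ℕ} (hk : σ.ivar 1 = k) (hk1 : 1 ≤ k)
    (h8 : σ.ivar 8 = e * k) (h12 : σ.ivar 12 = e * k + k) (h9 : σ.ivar 9 = 1)
    (h6 : ∀ j < k, σ.iarr 6 (e * k + j) = digit k e j) :
    Run (.forLt 7 1 carryBody) σ (k * 34 + 7) fun σ' =>
      (σ'.ivar 9 = if k ^ k ∣ e + 1 then 1 else 0) ∧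
      (∀ q < e * k + k, σ'.iarr 6 q = σ.iarr 6 q) ∧
      ∀ j < k, σ'.iarr 6 (e * k + k + j) = digit k (e + 1) j := by
  have := Run.forLt (x := 7) (y := 1) (c := carryBody) (σ := σ) (T := 25)
    (fun m σ' => (σ'.ivar 9 = if k ^ m ∣ e + 1 then 1 else 0) ∧
      (∀ q < e * k + k, σ'.iarr 6 q = σ.iarr 6 q) ∧
      ∀ j < m, σ'.iarr 6 (e * k + k + j) = digit k (e + 1) j) rfl rfl (by simp) (by simp [h9]) ?_
  · rw [hk] at this
    exact this.mono le_rfl fun σ' h _ => h.1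
  · rintro m hm σ' h7 hF ⟨ha, hb, hc⟩
    rw [hk] at hm
    have e1 : σ'.ivar 1 = k := (hF.iv 1 rfl).trans hk
    have e8 : σ'.ivar 8 = e * k := (hF.iv 8 rfl).trans h8
    have e12 : σ'.ivar 12 = e * k + k := (hF.iv 12 rfl).trans h12
    have e6 : σ'.iarr 6 (e * k + m) = digit k e m := by rw [hb _ (by omega), h6 m hm]
    obtain ⟨hds₁, hds₂⟩ := digit_succ hk1 e m
    refine Run.of_loopFree rfl ?_
    simp only [carryBody, Cmd.den, Cond.Holds, IExpr.eval, h7, e8, e6, ha, setI_ivar, e1, e12,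
      Nat.reduceEqDiff, if_true, if_false]
    generalize digit k e m + (if k ^ m ∣ e + 1 then 1 else 0) = v at hds₁ hds₂ ⊢
    have hne : ∀ q < e * k + k, q ≠ e * k + k + m := fun q hq => by omega
    by_cases hle : k ≤ v
    · obtain ⟨d1, d2⟩ := hds₁ hle
      simp only [if_pos hle]
      refine ⟨by simp [d2], fun q hq => by simp [hne q hq, hb q hq], fun j hj => ?_⟩
      rcases Nat.lt_succ_iff_lt_or_eq.1 hj with h | rfl
      · simp [h.ne, hc j h]
      · simp [d1]
    · obtain ⟨d1, d2⟩ := hds₂ hle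
      simp only [if_neg hle]
      refine ⟨by simp [d2], fun q hq => by simp [hne q hq, hb q hq], fun j hj => ?_⟩
      rcases Nat.lt_succ_iff_lt_or_eq.1 hj with h | rfl
      · simp [h.ne, hc j h]
      · simp [d1]

/-- Append one tuple to the table. -/
def tupleBody : Cmd :=
  (.istore 8 (.var 5) (.var 8) ;; .iset 9 (.const 1) ;; .iset 12 (.add (.var 8) (.var 1))) ;;
  .forLt 7 1 carryBody ;;
  (.iset 8 (.var 12) ;; .iset 5 (.add (.var 5) (.const 1)))

/-- The table of all tuples, as the digits in base `k` of the numbers below `k ^ k`. -/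
def tupleTable : Cmd :=
  (.iset 5 (.const 0) ;; .iset 8 (.const 0) ;; .iset 9 (.const 0)) ;;
  .loop (.ile (.var 9) (.const 0)) tupleBody

/-- The number `k ^ k` is never computed in advance: the loop stops when the carry leaves the top
digit, and the row counter then equals `k ^ k`. -/
theorem run_tupleTable (σ : State) {k : ℕ} (hk : σ.ivar 1 = k) (hk1 : 1 ≤ k)
    (h6 : ∀ m, σ.iarr 6 m = 0) :
    Run tupleTable σ (k ^ k * (k * 34 + 26) + 10) fun σ' =>
      σ'.ivar 5 = k ^ k ∧ (∀ e < k ^ k, σ'.iarr 8 e = e * k) ∧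
      ∀ e < k ^ k, ∀ j < k, σ'.iarr 6 (e * k + j) = digit k e j := by
  have hpos : 0 < k ^ k := by positivity
  refine Run.mono (T := 6 + (k ^ k * (k * 34 + 26) + 4)) (Run.seq (Run.of_loopFree rfl ?_))
    (by omega) (fun σ' h _ => h)
  refine (Run.loop_of_count _ (k ^ k) (k * 34 + 22)
    (fun m σ' => m ≤ k ^ k ∧ σ'.ivar 5 = m ∧ σ'.ivar 8 = m * k ∧
      (σ'.ivar 9 = if m = k ^ k then 1 else 0) ∧
      (∀ e < m, σ'.iarr 8 e = e * k) ∧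
      -- The digits are one row ahead of the counter: row `0` is present in the cleared array, and
      -- each round writes row `m + 1`.
      ∀ e ≤ m, ∀ j < k, σ'.iarr 6 (e * k + j) = digit k e j) ?_ ?_ ?_).mono
      (by simp [Cond.cost, IExpr.cost]) ?_
  · have : 0 ≠ k ^ k := hpos.ne
    simp [Cmd.den, this, h6, digit]
  · rintro m hm σ' hF ⟨-, h5, h8, h9, ht, hd⟩
    rw [if_neg hm.ne] at h9
    have e1 : σ'.ivar 1 = k := (hF.iv 1 rfl).trans hk
    refine ⟨by simp [h9], Run.mono (T := 9 + ((k * 34 + 7) + 6))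
      (Run.seq (Run.of_loopFree rfl (Run.seq ((run_carry _ (k := k) (e := m) ?_ hk1 ?_ ?_ ?_ ?_
        ).mono le_rfl fun σ₁ h₁ f₁ => Run.of_loopFree rfl ?_)))) (by omega)
      (fun σ' h _ => h)⟩
    · simp [Cmd.den, e1]
    · simp [Cmd.den, h8]
    · simp [Cmd.den, h8, e1]
    · simp [Cmd.den]
    · simpa [Cmd.den] using hd m le_rfl
    · obtain ⟨ha, hb, hc⟩ := h₁
      have g5 : σ₁.ivar 5 = m := (f₁.iv 5 rfl).trans (by simp [Cmd.den, h5])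
      have g12 : σ₁.ivar 12 = m * k + k := (f₁.iv 12 rfl).trans (by simp [Cmd.den, h8, e1])
      have g8 : σ₁.iarr 8 = _ := f₁.ia 8 rfl
      simp only [Cmd.den, IExpr.eval, setI_iarr, putI_iarr, Nat.reduceEqDiff, false_and,
        if_false] at hb
      simp only [Cmd.den, IExpr.eval, setI_ivar, setI_iarr, Nat.reduceEqDiff, if_true, if_false,
        g5, g12, ha]
      refine ⟨hm, trivial, by ring, ?_, fun e he => ?_, fun e he j hj => ?_⟩
      · have : k ^ k ∣ m + 1 ↔ m + 1 = k ^ k :=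
          ⟨fun h => le_antisymm hm (Nat.le_of_dvd (by omega) h), fun h => h ▸ dvd_rfl⟩
        simp only [this]
      · rw [g8]
        simp only [Cmd.den, IExpr.eval, setI_iarr, putI_iarr, true_and, h5, h8]
        split_ifs with h
        · rw [h]
        · exact ht e (by omega)
      · rcases he.eq_or_lt with rfl | he
        · rw [Nat.succ_mul]; exact hc j hj
        · rw [hb _ (by nlinarith [Nat.mul_le_mul_right k (Nat.le_of_lt_succ he)]),
            hd e (by omega) j hj]
  · rintro σ' hF ⟨-, -, -, h9, -⟩
    simp [h9]
  · rintro σ' ⟨⟨-, h5, -, -, h8, hd⟩, -⟩ -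
    exact ⟨h5, h8, fun e he => hd e he.le⟩

/-! ### Tables of Hall bounds and the static memory. -/

/-- Compute the bounds in Hall's conditions for one set of clusters. -/
def boundsBody : Cmd :=
  (.iset 8 (.const 0) ;; .iset 9 (.const 0)) ;;
  .forLt 10 1 (.ite (.ile (.arr 6 (.add (.arr 8 (.var 7)) (.var 10))) (.const 0))
    (.iset 9 (.add (.var 9) (.var 3))) (.iset 8 (.add (.var 8) (.var 4)))) ;;
  (.istore 9 (.var 7) (.var 8) ;; .istore 10 (.var 7) (.var 9))

/-- The bounds in Hall's conditions; the `f`-th set consists of the clusters with nonzero digit. -/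
def bounds : Cmd := .forLt 7 5 boundsBody

theorem run_bounds (σ : State) {k E L U : ℕ} (hk : σ.ivar 1 = k) (h5 : σ.ivar 5 = E)
    (h3 : σ.ivar 3 = L) (h4 : σ.ivar 4 = U) (h8 : ∀ e < E, σ.iarr 8 e = e * k)
    (h6 : ∀ e < E, ∀ j < k, σ.iarr 6 (e * k + j) = digit k e j) :
    Run bounds σ (E * (k * 25 + 26) + 7) fun σ' =>
      (∀ e < E, σ'.iarr 9 e = U * #{j ∈ range k | digit k e j ≠ 0}) ∧
      ∀ e < E, σ'.iarr 10 e = L * #{j ∈ range k | digit k e j = 0} := by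
  have := Run.forLt (x := 7) (y := 5) (c := boundsBody) (σ := σ) (T := k * 25 + 17)
    (fun m σ' => (∀ e < m, σ'.iarr 9 e = U * #{j ∈ range k | digit k e j ≠ 0}) ∧
      ∀ e < m, σ'.iarr 10 e = L * #{j ∈ range k | digit k e j = 0}) rfl rfl (by simp)
    (by simp) ?_
  · rw [h5] at this
    exact this.mono (by ring_nf; omega) fun σ' h _ => h.1
  · rintro m hm σ' h7 hF ⟨ha, hb⟩
    rw [h5] at hm
    have e1 : σ'.ivar 1 = k := (hF.iv 1 rfl).trans hk
    have e3 : σ'.ivar 3 = L := (hF.iv 3 rfl).trans h3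
    have e4 : σ'.ivar 4 = U := (hF.iv 4 rfl).trans h4
    have e8 : σ'.iarr 8 m = m * k := by rw [hF.ia 8 rfl, h8 m hm]
    have e6 : σ'.iarr 6 = σ.iarr 6 := hF.ia 6 rfl
    refine Run.mono (T := 4 + ((k * (16 + 9) + 7) + 6)) (Run.seq (Run.of_loopFree rfl
      (Run.seq ?_))) (by omega) (fun σ' h _ => h)
    have := Run.forLt (x := 10) (y := 1)
      (c := .ite (.ile (.arr 6 (.add (.arr 8 (.var 7)) (.var 10))) (.const 0))
        (.iset 9 (.add (.var 9) (.var 3))) (.iset 8 (.add (.var 8) (.var 4))))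
      (σ := (σ'.setI 8 0).setI 9 0) (T := 16)
      (fun q σ' => σ'.ivar 8 = U * #{j ∈ range q | digit k m j ≠ 0} ∧
        σ'.ivar 9 = L * #{j ∈ range q | digit k m j = 0}) rfl rfl (by simp) (by simp) ?_
    · simp only [setI_ivar, Nat.reduceEqDiff, if_false, e1] at this
      refine this.mono le_rfl ?_
      rintro σ₁ ⟨⟨g8, g9⟩, -⟩ f₁
      have g7 : σ₁.ivar 7 = m := (f₁.iv 7 rfl).trans (by simp [h7])
      have i9 : σ₁.iarr 9 = σ'.iarr 9 := f₁.ia 9 rfl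
      have i10 : σ₁.iarr 10 = σ'.iarr 10 := f₁.ia 10 rfl
      refine Run.of_loopFree rfl ?_
      simp only [Cmd.den, IExpr.eval, putI_iarr, putI_ivar, Nat.reduceEqDiff, true_and, false_and,
        if_false, g7, g8, g9, i9, i10]
      refine ⟨fun e he => ?_, fun e he => ?_⟩
      · split_ifs with h
        · rw [h]
        · exact ha e (by omega)
      · split_ifs with h
        · rw [h]
        · exact hb e (by omega)
    · rintro q hq σ₁ h10 f₁ ⟨g8, g9⟩
      simp only [setI_ivar, Nat.reduceEqDiff, if_false, e1] at hq
      have g7 : σ₁.ivar 7 = m := (f₁.iv 7 rfl).trans (by simp [h7])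
      have g3 : σ₁.ivar 3 = L := (f₁.iv 3 rfl).trans (by simp [e3])
      have g4 : σ₁.ivar 4 = U := (f₁.iv 4 rfl).trans (by simp [e4])
      have i8 : σ₁.iarr 8 m = m * k := by rw [f₁.ia 8 rfl]; simpa using e8
      have i6 : σ₁.iarr 6 (m * k + q) = digit k m q := by
        rw [f₁.ia 6 rfl]; simp [e6, h6 m hm q hq]
      refine Run.of_loopFree rfl ?_
      simp only [Cmd.den, Cond.Holds, IExpr.eval, g7, i8, h10, i6, g3, g4, g8, g9,
        nonpos_iff_eq_zero]
      by_cases h : digit k m q = 0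
      · simp [h, g8, range_add_one, filter_insert, Nat.mul_succ]
      · simp [h, g9, range_add_one, filter_insert, Nat.mul_succ]

/-- The static part of the memory: parameters, tables, squared distances `D` and, in increasing
order, `R`. -/
structure Mem (σ : State) (n k L U : ℕ) (D : ℕ → ℕ → ℝ) (R : ℕ → ℝ) : Prop where
  n0 : σ.ivar 0 = n
  k1 : σ.ivar 1 = k
  e5 : σ.ivar 5 = k ^ k
  e6 : σ.ivar 6 = k * n
  t5 : ∀ j < k, σ.iarr 5 j = j * n
  t6 : ∀ e < k ^ k, ∀ j < k, σ.iarr 6 (e * k + j) = digit k e j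
  t8 : ∀ e < k ^ k, σ.iarr 8 e = e * k
  t9 : ∀ e < k ^ k, σ.iarr 9 e = U * #{j ∈ range k | digit k e j ≠ 0}
  t10 : ∀ e < k ^ k, σ.iarr 10 e = L * #{j ∈ range k | digit k e j = 0}
  d1 : ∀ j < k, ∀ i < n, σ.rarr 1 (j * n + i) = D j i
  r2 : ∀ m < k * n, σ.rarr 2 m = R m

/-- The program does not write to the static part of the memory. -/
def keepsMem (c : Cmd) : Bool :=
  !(c.wI 0 || c.wI 1 || c.wI 5 || c.wI 6 || c.wIA 5 || c.wIA 6 || c.wIA 8 || c.wIA 9 || c.wIA 10 ||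
    c.wRA 1 || c.wRA 2)

theorem Mem.frame {σ σ' : State} {n k L U : ℕ} {D : ℕ → ℕ → ℝ} {R : ℕ → ℝ} {c : Cmd}
    (h : Mem σ n k L U D R) (hf : Frame c σ σ') (hc : keepsMem c = true) :
    Mem σ' n k L U D R := by
  simp only [keepsMem, Bool.not_eq_true', Bool.or_eq_false_iff] at hc
  obtain ⟨⟨⟨⟨⟨⟨⟨⟨⟨⟨c0, c1⟩, c5⟩, c6⟩, a5⟩, a6⟩, a8⟩, a9⟩, a10⟩, r1⟩, r2⟩ := hc
  constructor
  · rw [hf.iv 0 c0]; exact h.n0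
  · rw [hf.iv 1 c1]; exact h.k1
  · rw [hf.iv 5 c5]; exact h.e5
  · rw [hf.iv 6 c6]; exact h.e6
  · rw [hf.ia 5 a5]; exact h.t5
  · rw [hf.ia 6 a6]; exact h.t6
  · rw [hf.ia 8 a8]; exact h.t8
  · rw [hf.ia 9 a9]; exact h.t9
  · rw [hf.ia 10 a10]; exact h.t10
  · rw [hf.ra 1 r1]; exact h.d1
  · rw [hf.ra 2 r2]; exact h.r2

end BCenter

/-! ## Hall's conditions, with sets of clusters encoded by numbers -/

namespace BCenter

open RealRAM Finset

/-- All clusters in which the point `i` may be belong to the `f`-th set. -/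
def Inside (k : ℕ) (M : ℕ → ℕ → Prop) (f i : ℕ) : Prop := ∀ j < k, M i j → digit k f j ≠ 0

open Classical in
/-- The number of points that have to be in the clusters of the `f`-th set. -/
noncomputable def insideCount (n k : ℕ) (M : ℕ → ℕ → Prop) (f : ℕ) : ℕ :=
  #{i ∈ range n | Inside k M f i}

/-- Hall's condition for the `f`-th set, in terms of the number of points that have to be in its
clusters. -/
def HallAt (n k L U f c : ℕ) : Prop :=
  c ≤ U * #{j ∈ range k | digit k f j ≠ 0} ∧ c + L * #{j ∈ range k | digit k f j = 0} ≤ n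

/-- Hall's conditions. -/
def HallDigits (n k L U : ℕ) (M : ℕ → ℕ → Prop) : Prop :=
  ∀ f < k ^ k, HallAt n k L U f (insideCount n k M f)

theorem card_filter_range {n : ℕ} (p : ℕ → Prop) [DecidablePred p] :
    #{i ∈ range n | p i} = #{i : Fin n | p i} := by
  rw [card_filter, card_filter, Fin.sum_univ_eq_sum_range (fun i => if p i then 1 else 0)]

theorem digit_eq_finFunctionFinEquiv {k : ℕ} (e : Fin (k ^ k)) (j : Fin k) :
    digit k e j = (finFunctionFinEquiv.symm e j : Fin k) := rfl

open Classical in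
-- For `k ≥ 2` every set of clusters is the set of nonzero digits of some `f < k ^ k`, for instance
-- with digits `0` and `1`; repetitions are harmless. The condition is then `HallCond`.
theorem hallDigits_iff {n k L U : ℕ} (hk : 1 ≤ k) (hLU : L ≤ U) (hU : n ≤ k * U)
    (M : ℕ → ℕ → Prop) : HallDigits n k L U M ↔
      ∃ a : Fin n → Fin k, (∀ i : Fin n, M i (a i)) ∧ IsBalanced L U a := by
  set N : Fin n → Finset (Fin k) := fun i => {j | M i j} with hN
  let A : ℕ → Finset (Fin k) := fun f => {j | digit k f j ≠ 0}
  have hin : ∀ f (i : Fin n), Inside k M f i ↔ N i ⊆ A f := by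
    intro f i
    simp only [Inside, hN, A, subset_iff, mem_filter, mem_univ, true_and]
    exact ⟨fun h j hj => h j j.2 hj, fun h j hj => @h ⟨j, hj⟩⟩
  have hat : ∀ f, HallAt n k L U f (insideCount n k M f) ↔
      #{i | N i ⊆ A f} ≤ U * #(A f) ∧ #{i | N i ⊆ A f} + L * #(A f)ᶜ ≤ n := by
    intro f
    have e : (A f)ᶜ = ({j | digit k f j = 0} : Finset (Fin k)) := by
      ext j; simp [A]
    simp only [HallAt, insideCount, card_filter_range, hin, e, A]
  have hall : HallDigits n k L U M ↔ HallCond L U N := by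
    constructor
    · intro h B
      by_cases hB : ∃ f < k ^ k, A f = B
      · obtain ⟨f, hf, rfl⟩ := hB
        exact (hat f).1 (h f hf)
      -- For `k = 1` only `f = 0` exists, which encodes the empty set. The condition missing for the
      -- full set is the hypothesis `n ≤ k * U`.
      · have hBu : B = univ := by
          rcases hk.eq_or_lt with rfl | hk2
          · have h0 : A 0 ≠ B := fun h0 => hB ⟨0, by simp, h0⟩
            by_contra hne
            refine h0 (?_ : _ = _)
            have hA0 : A 0 = ∅ := by ext j; simp [A, digit]
            rw [hA0, eq_comm, eq_empty_iff_forall_notMem]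
            intro j hj
            refine hne (eq_univ_iff_forall.2 fun j' => ?_)
            rwa [Subsingleton.elim j' j]
          · exfalso
            refine hB ⟨finFunctionFinEquiv fun j => if j ∈ B then ⟨1, hk2⟩ else ⟨0, by omega⟩,
              Fin.is_lt _, ?_⟩
            ext j
            simp only [A, mem_filter, mem_univ, true_and, digit_eq_finFunctionFinEquiv,
              Equiv.symm_apply_apply]
            split_ifs with hj <;> simp [hj]
        subst hBu
        simpa [mul_comm] using hU
    · exact fun h f _ => (hat f).2 (h (A f))
  rw [hall]
  constructor
  · intro h
    obtain ⟨a, ha, hb⟩ := h.exists_assignment hLU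
    exact ⟨a, fun i => by simpa [hN] using ha i, hb⟩
  · rintro ⟨a, ha, hb⟩
    exact HallCond.of_assignment (fun i => by simpa [hN] using ha i) hb

open Classical in
-- Fixing point `m` to `j₀` affects only the status of `m`. It is now inside every set containing
-- `j₀`, and was inside some of these before, since `j₀` was among its options.
theorem insideCount_update {n k : ℕ} {M M' : ℕ → ℕ → Prop} {m j₀ : ℕ} (hm : m < n) (hj₀ : j₀ < k)
    (hM : ∀ i ≠ m, ∀ j, M' i j ↔ M i j) (hMm : ∀ j, M' m j ↔ j = j₀) (h0 : M m j₀) (f : ℕ) :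
    insideCount n k M' f = insideCount n k M f +
      if digit k f j₀ ≠ 0 ∧ ¬ Inside k M f m then 1 else 0 := by
  have h1 : ∀ i ≠ m, (Inside k M' f i ↔ Inside k M f i) := fun i hi => by
    simp only [Inside, hM i hi]
  have h2 : Inside k M' f m ↔ digit k f j₀ ≠ 0 := by
    simp only [Inside, hMm]
    exact ⟨fun h => h j₀ hj₀ rfl, fun h j _ e => e ▸ h⟩
  have h3 : Inside k M f m → digit k f j₀ ≠ 0 := fun h => h j₀ hj₀ h0
  unfold insideCount
  split_ifs with hc
  · rw [← card_insert_of_notMem (s := {i ∈ range n | Inside k M f i}) (a := m) (by simp [hc.2])]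
    congr 1
    ext i
    by_cases hi : i = m
    · subst hi; simp [h2, hc.1, hm]
    · simp [hi, h1 i hi]
  · rw [add_zero]
    congr 1
    ext i
    by_cases hi : i = m
    · subst hi
      have : Inside k M' f i ↔ Inside k M f i := by
        rw [h2]
        exact ⟨fun h => by_contra fun h' => hc ⟨h, h'⟩, h3⟩
      simp [this]
    · simp [h1 i hi]

end BCenter

/-! ## The program: testing feasibility -/

namespace BCenter

open RealRAM Finset

/-- With the `e`-th tuple as centers and the squared radius `r`, the ball of cluster `j` contains
the point `i`. -/
def Adm (k : ℕ) (D : ℕ → ℕ → ℝ) (e : ℕ) (r : ℝ) (i j : ℕ) : Prop := D (digit k e j) i ≤ r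

/-- Test whether the clusters whose balls contain the point `ivar 12` belong to the set number
`ivar 7`. -/
def insideTest : Cmd :=
  .iset 14 (.const 1) ;;
  .forLt 13 1 (.ite
    (.conj (.rle (.arr 1 (.add (.arr 5 (.arr 6 (.add (.var 11) (.var 13)))) (.var 12))) (.var 0))
      (.ile (.arr 6 (.add (.arr 8 (.var 7)) (.var 13))) (.const 0)))
    (.iset 14 (.const 0)) .skip)

section
variable {n k L U : ℕ} {D : ℕ → ℕ → ℝ} {R : ℕ → ℝ}

theorem Mem.read_dist {σ : State} (h : Mem σ n k L U D R) {e i j : ℕ} (he : e < k ^ k)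
    (hi : i < n) (hj : j < k) :
    σ.rarr 1 (σ.iarr 5 (σ.iarr 6 (e * k + j)) + i) = D (digit k e j) i := by
  have hd : digit k e j < k := digit_lt (by omega) _ _
  rw [h.t6 e he j hj, h.t5 _ hd, h.d1 _ hd i hi]

open Classical in
theorem run_insideTest {σ : State} (hM : Mem σ n k L U D R) {e f i : ℕ} {r : ℝ}
    (he : e < k ^ k) (hf : f < k ^ k) (hi : i < n) (h11 : σ.ivar 11 = e * k) (h7 : σ.ivar 7 = f)
    (h12 : σ.ivar 12 = i) (hr : σ.rvar 0 = r) :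
    Run insideTest σ (k * 31 + 9) fun σ' =>
      σ'.ivar 14 = if Inside k (Adm k D e r) f i then 1 else 0 := by
  refine Run.mono (T := 2 + (k * (22 + 9) + 7)) (Run.seq (Run.of_loopFree rfl ?_)) (by omega)
    (fun σ' h _ => h)
  have := Run.forLt (x := 13) (y := 1)
    (c := .ite (.conj
      (.rle (.arr 1 (.add (.arr 5 (.arr 6 (.add (.var 11) (.var 13)))) (.var 12))) (.var 0))
      (.ile (.arr 6 (.add (.arr 8 (.var 7)) (.var 13))) (.const 0)))
      (.iset 14 (.const 0)) .skip) (σ := σ.setI 14 1) (T := 22)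
    (fun m σ' => σ'.ivar 14 = if ∀ j < m, Adm k D e r i j → digit k f j ≠ 0 then 1 else 0)
    rfl rfl (by simp) (by simp) ?_
  · simp only [setI_ivar, Nat.reduceEqDiff, if_false, hM.k1] at this
    exact this.mono le_rfl fun σ' h _ => by convert h.1; exact Iff.rfl
  · rintro m hm σ₁ h13 f₁ hI
    have hm : m < k := by simpa [hM.k1] using hm
    have hF : Frame insideTest σ σ₁ :=
      (Frame.setI rfl σ 1).trans f₁.seqRight
    have hM₁ := hM.frame hF rfl
    have g11 : σ₁.ivar 11 = e * k := (hF.iv 11 rfl).trans h11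
    have g7 : σ₁.ivar 7 = f := (hF.iv 7 rfl).trans h7
    have g12 : σ₁.ivar 12 = i := (hF.iv 12 rfl).trans h12
    have gr : σ₁.rvar 0 = r := (hF.rv 0 rfl).trans hr
    refine Run.of_loopFree rfl ?_
    simp only [Cmd.den, Cond.Holds, RExpr.eval, IExpr.eval, g11, h13, g12, g7, gr,
      hM₁.read_dist he hi hm, hM₁.t8 f hf, hM₁.t6 f hf m hm, nonpos_iff_eq_zero]
    by_cases hc : D (digit k e m) i ≤ r ∧ digit k f m = 0
    · rw [if_pos hc, if_neg fun h => h m (by omega) hc.1 hc.2]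
      simp
    · rw [if_neg hc, hI]
      have : (∀ j < m + 1, Adm k D e r i j → digit k f j ≠ 0) ↔
          ∀ j < m, Adm k D e r i j → digit k f j ≠ 0 := by
        refine ⟨fun h j hj => h j (by omega), fun h j hj hA h0 => ?_⟩
        rcases Nat.lt_succ_iff_lt_or_eq.1 hj with h' | rfl
        · exact h j h' hA h0
        · exact hc ⟨hA, h0⟩
      simp only [this]

/-- The body of the loop over all sets of clusters in the test of Hall's conditions. -/
def checkBody : Cmd :=
  .iset 16 (.const 0) ;;
  .forLt 12 0 (insideTest ;; .iset 16 (.add (.var 16) (.var 14))) ;;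
  (.istore 11 (.var 7) (.var 16) ;;
  .ite (.conj (.ile (.var 16) (.arr 9 (.var 7)))
      (.ile (.add (.var 16) (.arr 10 (.var 7))) (.var 0)))
    .skip (.iset 15 (.const 0)))

/-- Test Hall's conditions for the tuple at `ivar 11` and the squared radius `rvar 0`. -/
def check : Cmd := .iset 15 (.const 1) ;; .forLt 7 5 checkBody

open Classical in
-- Besides the verdict, the counts left in array `11` matter: they initialize the greedy assignment.
theorem run_check {σ : State} (hM : Mem σ n k L U D R) {e : ℕ} {r : ℝ}
    (he : e < k ^ k) (h11 : σ.ivar 11 = e * k) (hr : σ.rvar 0 = r) :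
    Run check σ (k ^ k * (n * (k * 31 + 22) + 40) + 9) fun σ' =>
      (σ'.ivar 15 = if HallDigits n k L U (Adm k D e r) then 1 else 0) ∧
      ∀ f < k ^ k, σ'.iarr 11 f = insideCount n k (Adm k D e r) f := by
  set M := Adm k D e r with hMdef
  refine Run.mono (T := 2 + (k ^ k * (n * (k * 31 + 22) + 40) + 7))
    (Run.seq (Run.of_loopFree rfl ?_)) (by omega) (fun σ' h _ => h)
  have := Run.forLt (x := 7) (y := 5) (c := checkBody) (σ := σ.setI 15 1)
    (T := n * (k * 31 + 22) + 31)
    (fun m σ' => (σ'.ivar 15 = if ∀ f < m, HallAt n k L U f (insideCount n k M f) then 1 else 0) ∧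
      ∀ f < m, σ'.iarr 11 f = insideCount n k M f)
    rfl rfl (by simp) (by simp) ?_
  · simp only [setI_ivar, Nat.reduceEqDiff, if_false, hM.e5] at this
    exact this.mono le_rfl fun σ' h _ => ⟨by convert h.1.1; exact Iff.rfl, h.1.2⟩
  · rintro f hf σ₁ h7 f₁ ⟨h15, hup⟩
    have hf : f < k ^ k := by simpa [hM.e5] using hf
    have hF : Frame check σ σ₁ :=
      (Frame.setI rfl σ 1).trans f₁.seqRight
    have hM₁ := hM.frame hF rfl
    have g11 : σ₁.ivar 11 = e * k := (hF.iv 11 rfl).trans h11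
    have gr : σ₁.rvar 0 = r := (hF.rv 0 rfl).trans hr
    refine Run.mono (T := 2 + ((n * (k * 31 + 22) + 7) + 20)) (Run.seq (Run.of_loopFree rfl
      (Run.seq (T₂ := 20) ?_))) (by omega) (fun σ' h _ => h)
    have inner := Run.forLt (x := 12) (y := 0)
      (c := insideTest ;; .iset 16 (.add (.var 16) (.var 14))) (σ := σ₁.setI 16 0)
      (T := k * 31 + 13)
      (fun m σ' => σ'.ivar 16 = insideCount m k M f)
      rfl rfl (by simp) (by simp [insideCount]) ?_
    · simp only [setI_ivar, Nat.reduceEqDiff, if_false, hM₁.n0] at inner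
      refine inner.mono (by ring_nf; omega) ?_
      rintro σ₂ ⟨g16, -⟩ f₂
      have i9 : σ₂.iarr 9 f = _ := (congrFun (f₂.ia 9 rfl) f).trans (hM₁.t9 f hf)
      have i10 : σ₂.iarr 10 f = _ := (congrFun (f₂.ia 10 rfl) f).trans (hM₁.t10 f hf)
      have i11 : σ₂.iarr 11 = σ₁.iarr 11 := f₂.ia 11 rfl
      have k7 : σ₂.ivar 7 = f := (f₂.iv 7 rfl).trans (by simpa using h7)
      have k0 : σ₂.ivar 0 = n := (f₂.iv 0 rfl).trans (by simpa using hM₁.n0)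
      have k15 : σ₂.ivar 15 = _ := (f₂.iv 15 rfl).trans (by simpa using h15)
      refine (Run.of_loopFree rfl ?_).mono (by decide) fun σ' h _ => h
      simp only [Cmd.den, Cond.Holds, IExpr.eval, putI_ivar, putI_iarr, k7, g16, i9, i10, k0,
        Nat.reduceEqDiff, false_and, if_false]
      have hcell : ∀ f' < f + 1, (if f' = f then insideCount n k M f else σ₂.iarr 11 f') =
          insideCount n k M f' := by
        intro f' hf'
        split_ifs with h
        · rw [h]
        · rw [i11]; exact hup f' (by omega)
      by_cases hc : HallAt n k L U f (insideCount n k M f)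
      · rw [if_pos (show _ ∧ _ from hc)]
        refine ⟨?_, by simpa using hcell⟩
        rw [putI_ivar, k15]
        have : (∀ f' < f + 1, HallAt n k L U f' (insideCount n k M f')) ↔
            ∀ f' < f, HallAt n k L U f' (insideCount n k M f') := by
          refine ⟨fun h j hj => h j (by omega), fun h j hj => ?_⟩
          rcases Nat.lt_succ_iff_lt_or_eq.1 hj with h' | rfl
          · exact h j h'
          · exact hc
        simp only [this]
      · rw [if_neg (show ¬ (_ ∧ _) from hc), if_neg fun h => hc (h f (by omega))]
        exact ⟨by simp, by simpa using hcell⟩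
    · rintro m hm σ₂ h12 f₂ hI
      have hm : m < n := by simpa [hM₁.n0] using hm
      have hF₂ : Frame checkBody σ₁ σ₂ :=
        (Frame.setI rfl σ₁ 0).trans f₂.seqLeft.seqRight
      have hM₂ := hM₁.frame hF₂ rfl
      refine Run.mono (T := (k * 31 + 9) + 4) (Run.seq ((run_insideTest hM₂ he hf hm
        ((hF₂.iv 11 rfl).trans g11) ((hF₂.iv 7 rfl).trans h7) h12
        ((hF₂.rv 0 rfl).trans gr)).mono le_rfl fun σ₃ h₃ f₃ => Run.of_loopFree rfl ?_))
        (by omega) (fun σ' h _ => h)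
      have k16 : σ₃.ivar 16 = insideCount m k M f := (f₃.iv 16 rfl).trans hI
      simp only [Cmd.den, IExpr.eval, setI_ivar, if_true, k16, h₃]
      unfold insideCount
      rw [range_add_one, filter_insert]
      by_cases hin : Inside k M f m
      · simp [hin, hMdef ▸ hin]
      · simp [hin, hMdef ▸ hin]

end

end BCenter

/-! ## The program: binary search for all tuples -/

namespace BCenter

open RealRAM Finset

/-- The array holds the list. -/
def Recorded (A : ℕ → ℕ) (l : List ℕ) : Prop := ∀ m (h : m < l.length), A m = l[m]

theorem Recorded.append_singleton {A A' : ℕ → ℕ} {l : List ℕ} {v : ℕ} (h : Recorded A l)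
    (hA : ∀ m < l.length, A' m = A m) (hv : A' l.length = v) : Recorded A' (l ++ [v]) := by
  intro m hm
  rcases Nat.lt_succ_iff_lt_or_eq.1 (by simpa using hm) with h' | rfl
  · rw [hA m h', h m h', List.getElem_append_left h']
  · simp [hv]

/-- The record of a list of probes. -/
def probeRecord (l : List (ℕ × ℕ)) : List ℕ := l.flatMap fun q => [q.1, q.2]

theorem probeRecord_append_singleton (l : List (ℕ × ℕ)) (q : ℕ × ℕ) :
    probeRecord (l ++ [q]) = probeRecord l ++ [q.1] ++ [q.2] := by
  simp [probeRecord]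

/-- One step of the binary search. -/
def probeStep : Cmd :=
  (.iset 23 (.half (.add (.var 21) (.var 22))) ;; .rset 0 (.arr 2 (.var 23))) ;;
  check ;;
  (.istore 3 (.var 17) (.var 23) ;; .istore 3 (.add (.var 17) (.const 1)) (.var 15) ;;
  .iset 17 (.add (.var 17) (.const 2)) ;;
  .ite (.ile (.const 1) (.var 15))
    (.iset 22 (.var 23) ;; .ite (.rle (.var 4) (.var 0)) .skip (.rset 4 (.var 0)))
    (.iset 21 (.add (.var 23) (.const 1))))

/-- The binary search for one tuple. -/
def binarySearch : Cmd :=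
  (.iset 21 (.const 0) ;; .iset 22 (.var 6) ;; .rset 4 (.arr 2 (.sub (.var 6) (.const 1)))) ;;
  .loop (.neg (.ile (.var 22) (.var 21))) probeStep

/-- Time for testing Hall's conditions. -/
def checkTime (n k : ℕ) : ℕ := k ^ k * (n * (k * 31 + 22) + 40) + 9

/-- The radius that results from a list of probes. -/
noncomputable def radiusOf (S : List ℝ) (l : List (ℕ × ℕ)) : ℝ := l.foldl (improve S) (S.getLastD 0)

/-- `S` is a list of radii and `p` a feasibility predicate, corresponding to the squared radii `R`
and Hall's conditions. -/
structure Radii (n k L U : ℕ) (D : ℕ → ℕ → ℝ) (R : ℕ → ℝ) (p : ℕ → ℝ → Prop) (S : List ℝ) :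
    Prop where
  pos : 0 < k * n
  length_eq : S.length = k * n
  nonneg : ∀ m < k * n, 0 ≤ R m
  getD_eq : ∀ m < k * n, S.getD m 0 = Real.sqrt (R m)
  feasible_iff : ∀ e < k ^ k, ∀ m < k * n,
    p e (S.getD m 0) ↔ HallDigits n k L U (Adm k D e (R m))

section
variable {n k L U : ℕ} {D : ℕ → ℕ → ℝ} {R : ℕ → ℝ} {p : ℕ → ℝ → Prop} {S : List ℝ}

theorem Radii.getLastD_eq (h : Radii n k L U D R p S) :
    S.getLastD 0 = Real.sqrt (R (k * n - 1)) := by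
  have := h.pos
  rw [← h.getD_eq _ (by omega), ← h.length_eq, List.getLastD_eq_getLast?,
    List.getLast?_eq_getElem?, List.getD_eq_getElem?_getD]

/-- The square root is monotone, and strictly so on nonnegative numbers, hence comparing squared
radii leads to the same update as comparing radii. -/
theorem Radii.improve_one (h : Radii n k L U D R p S) {b m : ℕ} (hm : m < k * n) :
    improve S (Real.sqrt (R b)) (m, 1) =
      if R b ≤ R m then Real.sqrt (R b) else Real.sqrt (R m) := by
  unfold improve
  rw [h.getD_eq m hm]
  by_cases hle : R b ≤ R m
  · rw [if_pos hle, if_neg]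
    rintro ⟨-, hlt⟩
    exact absurd (Real.sqrt_le_sqrt hle) (not_le.2 hlt)
  · rw [if_neg hle, if_pos]
    exact ⟨rfl, Real.sqrt_lt_sqrt (h.nonneg m hm) (not_le.1 hle)⟩

theorem improve_zero (S : List ℝ) (b : ℝ) (m : ℕ) : improve S b (m, 0) = b := by
  simp [improve]

/-- Halving removes a binary digit. The bit length of the search interval is thus a potential that
drops with every probe. -/
theorem size_half_lt {x y : ℕ} (h : y ≤ x / 2) (hx : 0 < x) : Nat.size y + 1 ≤ Nat.size x := by
  have h1 : 0 < Nat.size x := Nat.size_pos.2 hx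
  have h2 : x < 2 ^ Nat.size x := Nat.lt_size_self x
  obtain ⟨s, hs⟩ : ∃ s, Nat.size x = s + 1 := ⟨Nat.size x - 1, by omega⟩
  rw [hs] at h2 ⊢
  have : Nat.size y ≤ s := Nat.size_le.2 (by rw [pow_succ] at h2; omega)
  omega

theorem run_binarySearch {σ : State} (hM : Mem σ n k L U D R) (hS : Radii n k L U D R p S) {e : ℕ}
    (he : e < k ^ k) (h11 : σ.ivar 11 = e * k) {pre : List ℕ} (hrec : Recorded (σ.iarr 3) pre)
    (h17 : σ.ivar 17 = pre.length) :
    Run binarySearch σ (Nat.size (k * n) * (checkTime n k + 45) + 20) fun σ' =>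
      Recorded (σ'.iarr 3) (pre ++ probeRecord (probes (p e) S 0 (k * n))) ∧
      σ'.ivar 17 = (pre ++ probeRecord (probes (p e) S 0 (k * n))).length ∧
      ∃ b < k * n, σ'.rvar 4 = R b ∧
        Real.sqrt (R b) = radiusOf S (probes (p e) S 0 (k * n)) := by
  have hpos := hS.pos
  refine Run.mono (T := 11 + (Nat.size (k * n) * (checkTime n k + 45) + 5))
    (Run.seq ((Run.of_loopFree rfl ?_).mono (by decide) fun _ h _ => h)) (by omega)
    (fun σ' h _ => h)
  set σ₀ := Cmd.den (.iset 21 (.const 0) ;; .iset 22 (.var 6) ;;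
    .rset 4 (.arr 2 (.sub (.var 6) (.const 1)))) σ with hσ₀
  have hF₀ : Frame binarySearch σ σ₀ :=
    ((Frame.setI rfl _ _).trans (Frame.setI rfl _ _)).trans (Frame.setR rfl _ _)
  have := Run.loop_of_potential (b := .neg (.ile (.var 22) (.var 21))) (c := probeStep) σ₀
    (fun σ' => ∃ lo hi l, σ'.ivar 21 = lo ∧ σ'.ivar 22 = hi ∧ hi ≤ k * n ∧
      Recorded (σ'.iarr 3) (pre ++ probeRecord l) ∧
      σ'.ivar 17 = (pre ++ probeRecord l).length ∧
      -- The probes made so far followed by those of the remaining interval are the probes of the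
      -- whole search; no other description of the history is needed.
      l ++ probes (p e) S lo hi = probes (p e) S 0 (k * n) ∧
      ∃ b < k * n, σ'.rvar 4 = R b ∧ Real.sqrt (R b) = radiusOf S l)
    -- One probe costs `checkTime`, at most `8 + 32` further steps in the body, and 5 for the loop
    -- test.
    (fun σ' => Nat.size (σ'.ivar 22 - σ'.ivar 21) * (checkTime n k + 45)) ?_ ?_
  · refine this.mono ?_ ?_
    · simp [hσ₀, Cmd.den, Cond.cost, IExpr.cost, hM.e6]
    · rintro σ' ⟨⟨lo, hi, l, e21, e22, -, ha, hb, hc, hd⟩, hnot, -⟩ -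
      rw [probes, if_neg (by simpa [e21, e22] using hnot), List.append_nil] at hc
      subst hc
      exact ⟨ha, hb, hd⟩
  · refine ⟨0, k * n, [], by simp [hσ₀, Cmd.den], by simp [hσ₀, Cmd.den, hM.e6], le_rfl,
      by simpa [hσ₀, Cmd.den, probeRecord] using hrec, by simp [hσ₀, Cmd.den, probeRecord, h17],
      rfl, k * n - 1, by omega, ?_, ?_⟩
    · simp [hσ₀, Cmd.den, hM.e6, hM.r2 _ (show k * n - 1 < k * n by omega)]
    · rw [radiusOf, hS.getLastD_eq]; rfl
  · rintro σ₁ hF₁ ⟨lo, hi, l, e21, e22, hhi, ha, hb, hc, b, hbn, hrb, hbr⟩ hcond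
    have hlt : lo < hi := by simpa [e21, e22] using hcond
    have hF : Frame binarySearch σ σ₁ := hF₀.trans hF₁.seqRight
    have hM₁ := hM.frame hF rfl
    have g11 : σ₁.ivar 11 = e * k := (hF.iv 11 rfl).trans h11
    obtain ⟨mid, hmid⟩ : ∃ mid, mid = (lo + hi) / 2 := ⟨_, rfl⟩
    have hmidn : mid < k * n := by omega
    set σ₂ := Cmd.den (.iset 23 (.half (.add (.var 21) (.var 22))) ;; .rset 0 (.arr 2 (.var 23))) σ₁
      with hσ₂
    have hF₂ : Frame probeStep σ₁ σ₂ := (Frame.setI rfl _ _).trans (Frame.setR rfl _ _)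
    have hM₂ := hM₁.frame hF₂ rfl
    refine ⟨8 + (checkTime n k + 32), Run.seq ((Run.of_loopFree rfl ?_).mono (by decide)
      fun _ h _ => h)⟩
    change Run _ σ₂ _ _
    have k0 : σ₂.rvar 0 = R mid := by
      simp [hσ₂, Cmd.den, e21, e22, ← hmid, hM₁.r2 mid hmidn]
    refine Run.seq ((run_check hM₂ (r := R mid) he ((hF₂.iv 11 rfl).trans g11) k0).mono le_rfl ?_)
    rintro σ₃ ⟨c15, -⟩ f₃
    rw [← hS.feasible_iff e he mid hmidn] at c15
    have c0 : σ₃.rvar 0 = R mid := (f₃.rv 0 rfl).trans k0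
    have c4 : σ₃.rvar 4 = R b := by rw [f₃.rv 4 rfl, ← hrb]; simp [hσ₂, Cmd.den]
    have c23 : σ₃.ivar 23 = mid := by
      rw [f₃.iv 23 rfl]; simp [hσ₂, Cmd.den, e21, e22, ← hmid]
    have c22 : σ₃.ivar 22 = hi := by rw [f₃.iv 22 rfl, ← e22]; simp [hσ₂, Cmd.den]
    have c21 : σ₃.ivar 21 = lo := by rw [f₃.iv 21 rfl, ← e21]; simp [hσ₂, Cmd.den]
    have c17 : σ₃.ivar 17 = (pre ++ probeRecord l).length := by
      rw [f₃.iv 17 rfl, ← hb]; simp [hσ₂, Cmd.den]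
    have c3 : σ₃.iarr 3 = σ₁.iarr 3 := f₃.ia 3 rfl
    refine (Run.of_loopFree rfl ?_).mono (by decide) fun σ' h _ => h
    have hR : ∀ (v : ℕ) (A : ℕ → ℕ),
        (∀ m, A m = if m = (pre ++ probeRecord l).length + 1 then v
          else if m = (pre ++ probeRecord l).length then mid else σ₃.iarr 3 m) →
        Recorded A (pre ++ probeRecord (l ++ [(mid, v)])) := by
      intro v A hA
      rw [probeRecord_append_singleton, ← List.append_assoc, ← List.append_assoc]
      refine Recorded.append_singleton (A := fun m =>
        if m = (pre ++ probeRecord l).length then mid else σ₃.iarr 3 m)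
        (Recorded.append_singleton ha ?_ ?_) ?_ ?_
      · intro m hm
        rw [if_neg hm.ne, c3]
      · rw [if_pos rfl]
      · intro m hm
        rw [List.length_append, List.length_singleton] at hm
        rw [hA, if_neg hm.ne]
      · rw [hA, List.length_append, List.length_singleton, if_pos rfl]
    have hL : ∀ v, (pre ++ probeRecord (l ++ [(mid, v)])).length =
        (pre ++ probeRecord l).length + 2 := by
      intro v; rw [probeRecord_append_singleton]; simp; omega
    have hprobes := hc
    rw [probes, if_pos hlt, ← hmid] at hprobes
    have hcost : ∀ x : ℕ, x ≤ (hi - lo) / 2 → Nat.size x * (checkTime n k + 45) +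
        (8 + (checkTime n k + 32)) + 4 + 1 ≤ Nat.size (hi - lo) * (checkTime n k + 45) := by
      intro x hx
      have h1 := size_half_lt hx (by omega)
      have h2 := Nat.mul_le_mul_right (checkTime n k + 45) h1
      rw [Nat.succ_mul] at h2
      omega
    by_cases hp : p e (S.getD mid 0)
    · rw [if_pos hp] at c15
      rw [if_pos hp] at hprobes
      have himp := hS.improve_one (b := b) hmidn
      by_cases hle : R b ≤ R mid
      · rw [if_pos hle] at himp
        simp only [Cmd.den, Cond.Holds, RExpr.eval, IExpr.eval, putI_ivar, setI_ivar,
          Nat.reduceEqDiff, if_true, if_false, c15, c17, c23, putI_rvar, setI_rvar, c4, c0, hle,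
          le_refl]
        refine ⟨⟨lo, mid, l ++ [(mid, 1)], by simp [c21], by simp, by omega, hR 1 _ ?_,
          by simp [hL], ?_, b, hbn, by simp, ?_⟩, ?_⟩
        · intro m; simp
        · rw [← hprobes]; simp
        · rw [radiusOf, List.foldl_append, List.foldl_cons, List.foldl_nil, ← radiusOf, ← hbr,
            himp]
        · simpa [c21, e21, e22, Cond.cost, IExpr.cost] using hcost (mid - lo) (by omega)
      · rw [if_neg hle] at himp
        simp only [Cmd.den, Cond.Holds, RExpr.eval, IExpr.eval, putI_ivar, setI_ivar,
          Nat.reduceEqDiff, if_true, if_false, c15, c17, c23, putI_rvar, setI_rvar, c4, c0, hle,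
          le_refl]
        refine ⟨⟨lo, mid, l ++ [(mid, 1)], by simp [c21], by simp, by omega, hR 1 _ ?_,
          by simp [hL], ?_, mid, hmidn, by simp, ?_⟩, ?_⟩
        · intro m; simp
        · rw [← hprobes]; simp
        · rw [radiusOf, List.foldl_append, List.foldl_cons, List.foldl_nil, ← radiusOf, ← hbr,
            himp]
        · simpa [c21, e21, e22, Cond.cost, IExpr.cost] using hcost (mid - lo) (by omega)
    · rw [if_neg hp] at c15
      rw [if_neg hp] at hprobes
      simp only [Cmd.den, Cond.Holds, RExpr.eval, IExpr.eval, putI_ivar, setI_ivar,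
        Nat.reduceEqDiff, if_true, if_false, c15, c17, c23, nonpos_iff_eq_zero, one_ne_zero]
      refine ⟨⟨mid + 1, hi, l ++ [(mid, 0)], by simp, by simp [c22], by omega, hR 0 _ ?_,
        by simp [hL], ?_, b, hbn, by simp [c4], ?_⟩, ?_⟩
      · intro m; simp
      · rw [← hprobes]; simp
      · rw [radiusOf, List.foldl_append, List.foldl_cons, List.foldl_nil, ← radiusOf, ← hbr,
          improve_zero]
      · simpa [c22, e21, e22, Cond.cost, IExpr.cost] using hcost (hi - (mid + 1)) (by omega)

/-- Record the tuple. -/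
def recordTuple : Cmd :=
  .forLt 13 1 (.istore 3 (.var 17) (.arr 6 (.add (.var 11) (.var 13))) ;;
    .iset 17 (.add (.var 17) (.const 1)))

theorem run_recordTuple {σ : State} (hM : Mem σ n k L U D R) {e : ℕ} (he : e < k ^ k)
    (h11 : σ.ivar 11 = e * k) {pre : List ℕ} (hrec : Recorded (σ.iarr 3) pre)
    (h17 : σ.ivar 17 = pre.length) :
    Run recordTuple σ (k * 19 + 7) fun σ' =>
      Recorded (σ'.iarr 3) (pre ++ (List.range k).map (digit k e)) ∧
      σ'.ivar 17 = (pre ++ (List.range k).map (digit k e)).length := by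
  have := Run.forLt (x := 13) (y := 1)
    (c := .istore 3 (.var 17) (.arr 6 (.add (.var 11) (.var 13))) ;;
      .iset 17 (.add (.var 17) (.const 1))) (σ := σ) (T := 10)
    (fun m σ' => Recorded (σ'.iarr 3) (pre ++ (List.range m).map (digit k e)) ∧
      σ'.ivar 17 = (pre ++ (List.range m).map (digit k e)).length) rfl rfl (by simp)
    (by simpa [h17] using hrec) ?_
  · rw [hM.k1] at this
    exact this.mono le_rfl fun σ' h _ => h.1
  · rintro m hm σ₁ h13 f₁ ⟨ha, hb⟩
    have hm : m < k := by simpa [hM.k1] using hm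
    have hM₁ := hM.frame f₁ rfl
    have g11 : σ₁.ivar 11 = e * k := (f₁.iv 11 rfl).trans h11
    refine Run.of_loopFree rfl ?_
    simp only [Cmd.den, IExpr.eval, g11, h13, hM₁.t6 e he m hm, hb, putI_ivar]
    rw [List.range_succ, List.map_append, ← List.append_assoc]
    refine ⟨ha.append_singleton (fun q hq => ?_) (by simp), by simp; omega⟩
    simp [by simpa using hq.ne]

/-- The search for one tuple. -/
def tupleSearch : Cmd :=
  .iset 11 (.arr 8 (.var 20)) ;;
  recordTuple ;; binarySearch ;;
  .ite (.conj (.ile (.const 1) (.var 18)) (.rle (.var 3) (.var 4))) .skip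
    (.rset 3 (.var 4) ;; .iset 19 (.var 11) ;; .iset 18 (.const 1))

/-- The search for all tuples. -/
def searchAll : Cmd := (.iset 17 (.const 0) ;; .iset 18 (.const 0)) ;; .forLt 20 5 tupleSearch

/-- The record of the search for the first `m` tuples. -/
noncomputable def recordUpTo (n k : ℕ) (p : ℕ → ℝ → Prop) (S : List ℝ) (m : ℕ) : List ℕ :=
  (List.range m).flatMap fun e =>
    (List.range k).map (digit k e) ++ probeRecord (probes (p e) S 0 (k * n))

/-- Time for the search for one tuple. -/
def tupleSearchTime (n k : ℕ) : ℕ := k * 19 + Nat.size (k * n) * (checkTime n k + 45) + 60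

theorem run_searchAll {σ : State} (hM : Mem σ n k L U D R) (hS : Radii n k L U D R p S)
    (hk : 1 ≤ k) :
    Run searchAll σ (k ^ k * tupleSearchTime n k + 11) fun σ' =>
      Recorded (σ'.iarr 3) (recordUpTo n k p S (k ^ k)) ∧
      ∃ e < k ^ k, σ'.ivar 19 = e * k ∧ ∃ b < k * n, σ'.rvar 3 = R b ∧
        Real.sqrt (R b) = radiusOf S (probes (p e) S 0 (k * n)) ∧
        ∀ e' < k ^ k, radiusOf S (probes (p e) S 0 (k * n)) ≤
          radiusOf S (probes (p e') S 0 (k * n)) := by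
  set rad : ℕ → ℝ := fun e => radiusOf S (probes (p e) S 0 (k * n)) with hrad
  refine Run.mono (T := 4 + (k ^ k * tupleSearchTime n k + 7))
    (Run.seq (Run.of_loopFree rfl ?_)) (by omega) (fun σ' h _ => h)
  set σ₀ := Cmd.den (.iset 17 (.const 0) ;; .iset 18 (.const 0)) σ with hσ₀
  have hF₀ : Frame searchAll σ σ₀ := (Frame.setI rfl _ _).trans (Frame.setI rfl _ _)
  have hM₀ := hM.frame hF₀ rfl
  have := Run.forLt (x := 20) (y := 5) (c := tupleSearch) (σ := σ₀)
    (T := 3 + ((k * 19 + 7) + ((Nat.size (k * n) * (checkTime n k + 45) + 20) + 17)))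
    (fun m σ' => Recorded (σ'.iarr 3) (recordUpTo n k p S m) ∧
      σ'.ivar 17 = (recordUpTo n k p S m).length ∧ (σ'.ivar 18 = if m = 0 then 0 else 1) ∧
      -- Integer variable `18` tells whether a best tuple exists yet; before the first search, real
      -- variable `3` is not a radius. Naming the best squared radius as an entry of `R` allows
      -- translation back to radii.
      (0 < m → ∃ e < m, σ'.ivar 19 = e * k ∧ ∃ b < k * n, σ'.rvar 3 = R b ∧
        Real.sqrt (R b) = rad e ∧ ∀ e' < m, rad e ≤ rad e')) rfl rfl (by simp) ?_ ?_
  · rw [hM₀.e5] at this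
    refine this.mono ?_ ?_
    · refine Nat.add_le_add_right (Nat.mul_le_mul_left _ ?_) _
      unfold tupleSearchTime; omega
    · rintro σ' ⟨⟨ha, -, -, hb⟩, -⟩ -
      exact ⟨ha, hb (by positivity)⟩
  · simp [hσ₀, Cmd.den, recordUpTo, Recorded]
  · rintro e he σ₁ h20 f₁ ⟨ha, hb, h18, hbest⟩
    have he : e < k ^ k := by rwa [hM₀.e5] at he
    have hM₁ := hM₀.frame f₁ rfl
    refine Run.seq (Run.of_loopFree rfl ?_)
    simp only [Cmd.den, IExpr.eval, h20, hM₁.t8 e he]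
    have hF₂ : Frame tupleSearch σ₁ (σ₁.setI 11 (e * k)) := Frame.setI rfl _ _
    have hM₂ := hM₁.frame hF₂ rfl
    refine Run.seq ((run_recordTuple hM₂ he (by simp) (by simpa using ha)
      (by simpa using hb)).mono le_rfl ?_)
    rintro σ₃ ⟨ha₃, hb₃⟩ f₃
    have hM₃ := hM₂.frame f₃ rfl
    refine Run.seq ((run_binarySearch hM₃ hS he ((f₃.iv 11 rfl).trans (by simp)) ha₃
      hb₃).mono le_rfl ?_)
    rintro σ₄ ⟨ha₄, hb₄, b₄, hb₄n, hr₄, hs₄⟩ f₄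
    have hrec : recordUpTo n k p S (e + 1) = recordUpTo n k p S e ++
        (List.range k).map (digit k e) ++ probeRecord (probes (p e) S 0 (k * n)) := by
      simp [recordUpTo, List.range_succ]
    have c11 : σ₄.ivar 11 = e * k := (f₄.iv 11 rfl).trans ((f₃.iv 11 rfl).trans (by simp))
    have c18 : σ₄.ivar 18 = if e = 0 then 0 else 1 :=
      (f₄.iv 18 rfl).trans ((f₃.iv 18 rfl).trans (by simp [h18]))
    have c19 : σ₄.ivar 19 = σ₁.ivar 19 :=
      (f₄.iv 19 rfl).trans ((f₃.iv 19 rfl).trans (by simp))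
    have c3 : σ₄.rvar 3 = σ₁.rvar 3 := (f₄.rv 3 rfl).trans (f₃.rv 3 rfl)
    refine (Run.of_loopFree rfl ?_).mono (by decide) fun σ' h _ => h
    rw [hrec]
    by_cases hc : e ≠ 0 ∧ σ₁.rvar 3 ≤ R b₄
    · have : Cond.Holds σ₄ (.conj (.ile (.const 1) (.var 18)) (.rle (.var 3) (.var 4))) := by
        simp [c18, hc.1, c3, hr₄, hc.2]
      simp only [Cmd.den, if_pos this]
      obtain ⟨e₀, he₀, h19, b, hbn, hrb, hsb, hmin⟩ := hbest (Nat.pos_of_ne_zero hc.1)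
      refine ⟨ha₄, hb₄, by simp [c18, hc.1], fun _ => ⟨e₀, by omega, c19.trans h19, b, hbn,
        c3.trans hrb, hsb, fun e' he' => ?_⟩⟩
      rcases Nat.lt_succ_iff_lt_or_eq.1 he' with h | rfl
      · exact hmin e' h
      · rw [← hsb, ← hrb]
        change _ ≤ radiusOf S _
        rw [← hs₄]
        exact Real.sqrt_le_sqrt hc.2
    · have : ¬ Cond.Holds σ₄ (.conj (.ile (.const 1) (.var 18)) (.rle (.var 3) (.var 4))) := by
        by_cases h0 : e = 0
        · simp [c18, h0]
        · simpa [c18, h0, c3, hr₄] using hc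
      simp only [Cmd.den, if_neg this]
      refine ⟨by simpa using ha₄, by simpa using hb₄, by simp, fun _ => ⟨e, by omega,
        by simp [c11], b₄, hb₄n, by simp [hr₄], hs₄, fun e' he' => ?_⟩⟩
      rcases Nat.lt_succ_iff_lt_or_eq.1 he' with h | rfl
      · have h0 : e ≠ 0 := by omega
        obtain ⟨e₀, he₀, h19, b, hbn, hrb, hsb, hmin⟩ := hbest (Nat.pos_of_ne_zero h0)
        refine le_trans ?_ (hmin e' h)
        rw [← hsb, ← hrb]
        change radiusOf S _ ≤ _
        rw [← hs₄]
        exact Real.sqrt_le_sqrt (not_le.1 fun h' => hc ⟨h0, h'⟩).le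
      · exact le_rfl

end

end BCenter

/-! ## The program: the clustering -/

namespace BCenter

open RealRAM Finset

/-- Record for all sets whether all clusters for the point `ivar 12` belong to it. -/
def insideRow : Cmd := .forLt 7 5 (insideTest ;; .istore 12 (.var 7) (.var 14))

/-- Test whether Hall's condition survives if the point `ivar 12` is put into cluster `ivar 10`. -/
def fitTest : Cmd :=
  .ite (.conj (.conj (.ile (.const 1) (.arr 6 (.add (.arr 8 (.var 7)) (.var 10))))
      (.ile (.arr 12 (.var 7)) (.const 0)))
      (.neg (.conj (.ile (.add (.arr 11 (.var 7)) (.const 1)) (.arr 9 (.var 7)))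
        (.ile (.add (.add (.arr 11 (.var 7)) (.const 1)) (.arr 10 (.var 7))) (.var 0)))))
    (.iset 15 (.const 0)) .skip

/-- Put the point `ivar 12` into cluster `ivar 10` if Hall's conditions survive. -/
def chooseBody : Cmd :=
  (.iset 15 (.const 1) ;;
  .ite (.rle (.arr 1 (.add (.arr 5 (.arr 6 (.add (.var 11) (.var 10)))) (.var 12))) (.var 0))
    .skip (.iset 15 (.const 0))) ;;
  .forLt 7 5 fitTest ;;
  .ite (.ile (.const 1) (.var 15)) (.istore 2 (.var 12) (.var 10)) .skip

/-- Choose the cluster of the point `ivar 12`. -/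
def choose : Cmd := .forLt 10 1 chooseBody

/-- Update the number of points inside one set of clusters. -/
def updateBody : Cmd :=
  .ite (.conj (.ile (.const 1) (.arr 6 (.add (.arr 8 (.var 7)) (.arr 2 (.var 12)))))
      (.ile (.arr 12 (.var 7)) (.const 0)))
    (.istore 11 (.var 7) (.add (.arr 11 (.var 7)) (.const 1))) .skip

/-- Update the number of points inside all sets of clusters. -/
def updateRow : Cmd := .forLt 7 5 updateBody

/-- Put one point into a cluster. -/
def greedyBody : Cmd := insideRow ;; choose ;; updateRow

/-- Put all points into clusters. -/
def greedy : Cmd := .forLt 12 0 greedyBody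

/-- Hall's conditions survive if the point `i` is put into the cluster `j`. -/
def Fits (n k L U : ℕ) (M : ℕ → ℕ → Prop) (u : ℕ → ℕ) (i j : ℕ) : Prop :=
  M i j ∧ ∀ f < k ^ k, digit k f j ≠ 0 → ¬ Inside k M f i → HallAt n k L U f (u f + 1)

section
variable {n k L U : ℕ} {D : ℕ → ℕ → ℝ} {R : ℕ → ℝ}

open Classical in
theorem run_insideRow {σ : State} (hM : Mem σ n k L U D R) {e i : ℕ} {r : ℝ} (he : e < k ^ k)
    (hi : i < n) (h11 : σ.ivar 11 = e * k) (h12 : σ.ivar 12 = i) (hr : σ.rvar 0 = r) :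
    Run insideRow σ (k ^ k * (k * 31 + 21) + 7) fun σ' =>
      ∀ f < k ^ k, σ'.iarr 12 f = if Inside k (Adm k D e r) f i then 1 else 0 := by
  have := Run.forLt (x := 7) (y := 5) (c := insideTest ;; .istore 12 (.var 7) (.var 14)) (σ := σ)
    (T := k * 31 + 12)
    (fun m σ' => ∀ f < m, σ'.iarr 12 f = if Inside k (Adm k D e r) f i then 1 else 0)
    rfl rfl (by simp) (by simp) ?_
  · rw [hM.e5] at this
    exact this.mono le_rfl fun σ' h _ => h.1
  · rintro f hf σ₁ h7 f₁ hI
    have hf : f < k ^ k := by rwa [hM.e5] at hf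
    have hM₁ := hM.frame f₁ rfl
    refine Run.seq (T₁ := k * 31 + 9) (T₂ := 3) ((run_insideTest hM₁ he hf hi
      ((f₁.iv 11 rfl).trans h11) h7 ((f₁.iv 12 rfl).trans h12)
      ((f₁.rv 0 rfl).trans hr)).mono le_rfl fun σ₂ h₂ f₂ => Run.of_loopFree rfl ?_)
    have k7 : σ₂.ivar 7 = f := (f₂.iv 7 rfl).trans h7
    have k12 : σ₂.iarr 12 = σ₁.iarr 12 := f₂.ia 12 rfl
    intro f' hf'
    simp only [Cmd.den, IExpr.eval, putI_iarr, k7, h₂, true_and, k12]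
    by_cases h : f' = f
    · rw [if_pos h, h]
    · rw [if_neg h]; exact hI f' (by omega)

open Classical in
-- The proposition `q` is the verdict already stored, namely whether the ball contains the point;
-- the loop conjoins the tests of the sets to it.
theorem run_fitTest {σ : State} (hM : Mem σ n k L U D R) {M : ℕ → ℕ → Prop} {u : ℕ → ℕ}
    {i j : ℕ} {q : Prop} (hj : j < k) (h10 : σ.ivar 10 = j)
    (hu : ∀ f < k ^ k, σ.iarr 11 f = u f)
    (hin : ∀ f < k ^ k, σ.iarr 12 f = if Inside k M f i then 1 else 0)
    (h15 : σ.ivar 15 = if q then 1 else 0) :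
    Run (.forLt 7 5 fitTest) σ (k ^ k * 60 + 7) fun σ' =>
      σ'.ivar 15 = if q ∧ ∀ f < k ^ k, digit k f j ≠ 0 → ¬ Inside k M f i →
        HallAt n k L U f (u f + 1) then 1 else 0 := by
  have := Run.forLt (x := 7) (y := 5) (c := fitTest) (σ := σ) (T := 51)
    (fun m σ' => σ'.ivar 15 = if q ∧ ∀ f < m, digit k f j ≠ 0 → ¬ Inside k M f i →
        HallAt n k L U f (u f + 1) then 1 else 0)
    rfl rfl (by simp) (by simp [h15]) ?_
  · rw [hM.e5] at this
    exact this.mono le_rfl fun σ' h _ => h.1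
  · rintro f hf σ₁ h7 f₁ hI
    have hf : f < k ^ k := by rwa [hM.e5] at hf
    have hM₁ := hM.frame f₁ rfl
    have g10 : σ₁.ivar 10 = j := (f₁.iv 10 rfl).trans h10
    have g11 : σ₁.iarr 11 f = u f := by rw [f₁.ia 11 rfl, hu f hf]
    have g12 : σ₁.iarr 12 f = _ := (congrFun (f₁.ia 12 rfl) f).trans (hin f hf)
    refine (Run.of_loopFree rfl ?_).mono (by decide) fun σ' h _ => h
    have hcond : Cond.Holds σ₁ (.conj (.conj
        (.ile (.const 1) (.arr 6 (.add (.arr 8 (.var 7)) (.var 10))))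
        (.ile (.arr 12 (.var 7)) (.const 0)))
        (.neg (.conj (.ile (.add (.arr 11 (.var 7)) (.const 1)) (.arr 9 (.var 7)))
          (.ile (.add (.add (.arr 11 (.var 7)) (.const 1)) (.arr 10 (.var 7))) (.var 0))))) ↔
        (digit k f j ≠ 0 ∧ ¬ Inside k M f i) ∧ ¬ HallAt n k L U f (u f + 1) := by
      simp only [Cond.Holds, IExpr.eval, h7, g10, hM₁.t8 f hf, hM₁.t6 f hf j hj, g12, g11,
        hM₁.t9 f hf, hM₁.t10 f hf, hM₁.n0, HallAt]
      have e1 : 1 ≤ digit k f j ↔ digit k f j ≠ 0 := Nat.one_le_iff_ne_zero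
      have e2 : (if Inside k M f i then 1 else 0) ≤ 0 ↔ ¬ Inside k M f i := by
        split_ifs with h <;> simp [h]
      rw [e1, e2]
    by_cases hc : (digit k f j ≠ 0 ∧ ¬ Inside k M f i) ∧ ¬ HallAt n k L U f (u f + 1)
    · simp only [fitTest, Cmd.den, if_pos (hcond.2 hc)]
      rw [if_neg]
      · simp
      · rintro ⟨-, h⟩
        exact hc.2 (h f (by omega) hc.1.1 hc.1.2)
    · simp only [fitTest, Cmd.den, if_neg fun h => hc (hcond.1 h)]
      rw [hI]
      have : (∀ f' < f + 1, digit k f' j ≠ 0 → ¬ Inside k M f' i → HallAt n k L U f' (u f' + 1)) ↔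
          ∀ f' < f, digit k f' j ≠ 0 → ¬ Inside k M f' i → HallAt n k L U f' (u f' + 1) := by
        refine ⟨fun h f' hf' => h f' (by omega), fun h f' hf' h1 h2 => ?_⟩
        rcases Nat.lt_succ_iff_lt_or_eq.1 hf' with h' | rfl
        · exact h f' h' h1 h2
        · exact by_contra fun h3 => hc ⟨⟨h1, h2⟩, h3⟩
      simp only [this]

open Classical in
theorem run_choose {σ : State} (hM : Mem σ n k L U D R) {e i : ℕ} {r : ℝ} {u : ℕ → ℕ}
    (he : e < k ^ k) (hi : i < n) (h11 : σ.ivar 11 = e * k) (h12 : σ.ivar 12 = i)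
    (hr : σ.rvar 0 = r) (hu : ∀ f < k ^ k, σ.iarr 11 f = u f)
    (hin : ∀ f < k ^ k, σ.iarr 12 f = if Inside k (Adm k D e r) f i then 1 else 0)
    (hex : ∃ j < k, Fits n k L U (Adm k D e r) u i j) :
    Run choose σ (k * (k ^ k * 60 + 46) + 7) fun σ' =>
      (∀ i' ≠ i, σ'.iarr 2 i' = σ.iarr 2 i') ∧ σ'.iarr 2 i < k ∧
      Fits n k L U (Adm k D e r) u i (σ'.iarr 2 i) := by
  have := Run.forLt (x := 10) (y := 1) (c := chooseBody) (σ := σ)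
    (T := 17 + ((k ^ k * 60 + 7) + 13))
    (fun m σ' => (∀ i' ≠ i, σ'.iarr 2 i' = σ.iarr 2 i') ∧
      -- Later fitting clusters overwrite earlier ones, so the invariant claims only that the stored
      -- cluster fits once some fitting one has been met.
      ((∃ j < m, Fits n k L U (Adm k D e r) u i j) → σ'.iarr 2 i < k ∧
      Fits n k L U (Adm k D e r) u i (σ'.iarr 2 i))) rfl rfl (by simp) (by simp) ?_
  · rw [hM.k1] at this
    exact this.mono (by ring_nf; omega) fun σ' h _ => ⟨h.1.1, h.1.2 hex⟩
  · rintro j hj σ₁ h10 f₁ ⟨ha, hb⟩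
    have hj : j < k := by rwa [hM.k1] at hj
    have hM₁ := hM.frame f₁ rfl
    have g11 : σ₁.ivar 11 = e * k := (f₁.iv 11 rfl).trans h11
    have g12 : σ₁.ivar 12 = i := (f₁.iv 12 rfl).trans h12
    have gr : σ₁.rvar 0 = r := (f₁.rv 0 rfl).trans hr
    refine Run.seq ((Run.of_loopFree (Q := fun σ₂ => σ₂.ivar 15 =
      if Adm k D e r i j then 1 else 0) rfl ?_).mono (by decide) fun σ₂ h₂ f₂ => ?_)
    · by_cases hA : D (digit k e j) i ≤ r
      · simp [Cmd.den, g11, g12, h10, gr, hM₁.read_dist he hi hj, hA, Adm]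
      · simp [Cmd.den, g11, g12, h10, gr, hM₁.read_dist he hi hj, hA, Adm]
    · have hM₂ := hM₁.frame f₂ rfl
      have k10 : σ₂.ivar 10 = j := (f₂.iv 10 rfl).trans h10
      have k11 : σ₂.iarr 11 = σ.iarr 11 := (f₂.ia 11 rfl).trans (f₁.ia 11 rfl)
      have k12 : σ₂.iarr 12 = σ.iarr 12 := (f₂.ia 12 rfl).trans (f₁.ia 12 rfl)
      refine Run.seq ((run_fitTest hM₂ (u := u) (M := Adm k D e r) (i := i) hj k10
        (by rwa [k11]) (by rwa [k12]) h₂).mono le_rfl fun σ₃ h₃ f₃ =>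
          (Run.of_loopFree rfl ?_).mono (by decide) fun σ' h _ => h)
      replace h₃ : σ₃.ivar 15 = if Fits n k L U (Adm k D e r) u i j then 1 else 0 := by
        convert h₃; exact Iff.rfl
      have c2 : σ₃.iarr 2 = σ₁.iarr 2 := (f₃.ia 2 rfl).trans (f₂.ia 2 rfl)
      have c12 : σ₃.ivar 12 = i := (f₃.iv 12 rfl).trans ((f₂.iv 12 rfl).trans g12)
      have c10 : σ₃.ivar 10 = j := (f₃.iv 10 rfl).trans k10
      by_cases hfit : Fits n k L U (Adm k D e r) u i j
      · rw [if_pos hfit] at h₃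
        simp only [Cmd.den, Cond.Holds, IExpr.eval, h₃, le_refl, if_true, putI_iarr, c12, c10,
          true_and, c2]
        exact ⟨fun i' hi' => by rw [if_neg hi', ha i' hi'], fun _ => ⟨hj, hfit⟩⟩
      · rw [if_neg hfit] at h₃
        simp only [Cmd.den, Cond.Holds, IExpr.eval, h₃, nonpos_iff_eq_zero, one_ne_zero, if_false,
          c2]
        refine ⟨ha, ?_⟩
        rintro ⟨j', hj', hf'⟩
        rcases Nat.lt_succ_iff_lt_or_eq.1 hj' with h | rfl
        · exact hb ⟨j', h, hf'⟩
        · exact absurd hf' hfit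

open Classical in
theorem run_updateRow {σ : State} (hM : Mem σ n k L U D R) {M : ℕ → ℕ → Prop} {i a : ℕ}
    {u : ℕ → ℕ} (h12 : σ.ivar 12 = i) (ha : σ.iarr 2 i = a) (hak : a < k)
    (hu : ∀ f < k ^ k, σ.iarr 11 f = u f)
    (hin : ∀ f < k ^ k, σ.iarr 12 f = if Inside k M f i then 1 else 0) :
    Run updateRow σ (k ^ k * 37 + 7) fun σ' =>
      ∀ f < k ^ k, σ'.iarr 11 f =
        u f + if digit k f a ≠ 0 ∧ ¬ Inside k M f i then 1 else 0 := by
  have := Run.forLt (x := 7) (y := 5) (c := updateBody) (σ := σ) (T := 28)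
    (fun m σ' => ∀ f < k ^ k, σ'.iarr 11 f =
      u f + if f < m ∧ digit k f a ≠ 0 ∧ ¬ Inside k M f i then 1 else 0)
    rfl rfl (by simp) (by simpa using hu) ?_
  · rw [hM.e5] at this
    refine this.mono le_rfl fun σ' h _ f hf => ?_
    rw [h.1 f hf]; simp only [hf, true_and]
  · rintro f hf σ₁ h7 f₁ hI
    have hf : f < k ^ k := by rwa [hM.e5] at hf
    have hM₁ := hM.frame f₁ rfl
    have g2 : σ₁.iarr 2 i = a := by rw [f₁.ia 2 rfl, ha]
    have gi : σ₁.ivar 12 = i := (f₁.iv 12 rfl).trans h12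
    have g12 : σ₁.iarr 12 f = _ := (congrFun (f₁.ia 12 rfl) f).trans (hin f hf)
    have g11 := hI f hf
    simp only [lt_irrefl, false_and, if_false, add_zero] at g11
    refine (Run.of_loopFree rfl ?_).mono (by decide) fun σ' h _ => h
    have hcond : Cond.Holds σ₁ (.conj
        (.ile (.const 1) (.arr 6 (.add (.arr 8 (.var 7)) (.arr 2 (.var 12)))))
        (.ile (.arr 12 (.var 7)) (.const 0))) ↔ digit k f a ≠ 0 ∧ ¬ Inside k M f i := by
      simp only [Cond.Holds, IExpr.eval, h7, gi, g2, hM₁.t8 f hf, hM₁.t6 f hf a hak, g12]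
      have e1 : 1 ≤ digit k f a ↔ digit k f a ≠ 0 := Nat.one_le_iff_ne_zero
      have e2 : (if Inside k M f i then 1 else 0) ≤ 0 ↔ ¬ Inside k M f i := by
        split_ifs with h <;> simp [h]
      rw [e1, e2]
    have hlt : ∀ f' ≠ f, (f' < f + 1 ↔ f' < f) := fun f' h => by omega
    by_cases hc : digit k f a ≠ 0 ∧ ¬ Inside k M f i
    · simp only [updateBody, Cmd.den, if_pos (hcond.2 hc)]
      intro f' hf'
      by_cases h : f' = f
      · subst h; simp [h7, g11, hc.1, hc.2]
      · simp [h, h7, hI f' hf', hlt f' h]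
    · simp only [updateBody, Cmd.den, if_neg fun h => hc (hcond.1 h)]
      intro f' hf'
      rw [hI f' hf']
      by_cases h : f' = f
      · subst h; simp only [hc, and_false]
      · simp only [hlt f' h]

/-- The remaining freedom after the first `m` points have been put into clusters. -/
def Fixed (M : ℕ → ℕ → Prop) (a : ℕ → ℕ) (m i j : ℕ) : Prop := if i < m then j = a i else M i j

/-- Hall's conditions give a complete balanced assignment extending the choices made. Its cluster
for point `m` fits: the same assignment survives the fixing of `m`, so Hall's conditions hold with
the new counts. -/
theorem exists_fits (hk : 1 ≤ k) (hLU : L ≤ U) (hU : n ≤ k * U) {M : ℕ → ℕ → Prop} {a : ℕ → ℕ}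
    {m : ℕ} (hm : m < n) (h : HallDigits n k L U (Fixed M a m)) :
    ∃ j < k, Fits n k L U M (insideCount n k (Fixed M a m)) m j := by
  obtain ⟨b, hb, hbal⟩ := (hallDigits_iff hk hLU hU _).1 h
  set j := b ⟨m, hm⟩ with hj
  have hmj : Fixed M a m m j := hb ⟨m, hm⟩
  have hMj : M m j := by simpa [Fixed] using hmj
  refine ⟨j, j.2, hMj, fun f hf hd hin => ?_⟩
  set M' : ℕ → ℕ → Prop := fun i j' => if i = m then j' = j else Fixed M a m i j' with hM'
  have hH : HallDigits n k L U M' := (hallDigits_iff hk hLU hU _).2 ⟨b, fun i => by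
    by_cases hi : (i : ℕ) = m
    · have : i = ⟨m, hm⟩ := Fin.ext hi
      simp [hM', this, hj]
    · simp only [hM', hi, if_false]; exact hb i, hbal⟩
  have hcount := insideCount_update (M := Fixed M a m) (M' := M') hm j.2
    (fun i hi j' => by simp [hM', hi]) (fun j' => by simp [hM']) hmj f
  have hin' : ¬ Inside k (Fixed M a m) f m := by simpa [Inside, Fixed] using hin
  rw [if_pos ⟨hd, hin'⟩] at hcount
  rw [← hcount]
  exact hH f hf

/-- The only counts that change are those tested by `Fits`, and they increase by one. The greedy
step is therefore sound and its incremental update exact. -/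
theorem hallDigits_fixed_succ {M : ℕ → ℕ → Prop} {a a' : ℕ → ℕ} {m : ℕ} (hm : m < n)
    (h : HallDigits n k L U (Fixed M a m)) (haa : ∀ i ≠ m, a' i = a i) (hak : a' m < k)
    (hfit : Fits n k L U M (insideCount n k (Fixed M a m)) m (a' m)) :
    HallDigits n k L U (Fixed M a' (m + 1)) ∧ ∀ f, insideCount n k (Fixed M a' (m + 1)) f =
      insideCount n k (Fixed M a m) f +
        open Classical in if digit k f (a' m) ≠ 0 ∧ ¬ Inside k M f m then 1 else 0 := by
  classical
  have hin : ∀ f, Inside k (Fixed M a m) f m ↔ Inside k M f m := fun f => by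
    simp [Inside, Fixed]
  have hcount : ∀ f, _ := fun f => insideCount_update (M := Fixed M a m)
    (M' := Fixed M a' (m + 1)) hm hak (fun i hi j => by
      have h1 : i < m + 1 ↔ i < m := by omega
      simp [Fixed, h1, haa i hi]) (fun j => by simp [Fixed])
    (by simpa [Fixed] using hfit.1) f
  simp only [hin] at hcount
  refine ⟨fun f hf => ?_, hcount⟩
  rw [hcount f]
  split_ifs with hc
  · exact hfit.2 f hf hc.1 hc.2
  · exact h f hf

/-- Time for putting one point into a cluster. -/
def greedyTime (k : ℕ) : ℕ :=
  (k ^ k * (k * 31 + 21) + 7) + ((k * (k ^ k * 60 + 46) + 7) + (k ^ k * 37 + 7))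

theorem run_greedy {σ : State} (hM : Mem σ n k L U D R) (hk : 1 ≤ k) (hLU : L ≤ U)
    (hU : n ≤ k * U) {e : ℕ} {r : ℝ} (he : e < k ^ k) (h11 : σ.ivar 11 = e * k)
    (hr : σ.rvar 0 = r) (hu : ∀ f < k ^ k, σ.iarr 11 f = insideCount n k (Adm k D e r) f)
    (hH : HallDigits n k L U (Adm k D e r)) :
    Run greedy σ (n * (greedyTime k + 9) + 7) fun σ' =>
      (∀ i < n, σ'.iarr 2 i < k ∧ Adm k D e r i (σ'.iarr 2 i)) ∧
      HallDigits n k L U (Fixed (Adm k D e r) (σ'.iarr 2) n) := by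
  classical
  set M := Adm k D e r with hMdef
  have h0 : ∀ a, Fixed M a 0 = M := fun a => by ext i j; simp [Fixed]
  have := Run.forLt (x := 12) (y := 0) (c := greedyBody) (σ := σ) (T := greedyTime k)
    (fun m σ' => (∀ i < m, σ'.iarr 2 i < k ∧ M i (σ'.iarr 2 i)) ∧
      HallDigits n k L U (Fixed M (σ'.iarr 2) m) ∧
      ∀ f < k ^ k, σ'.iarr 11 f = insideCount n k (Fixed M (σ'.iarr 2) m) f)
    rfl rfl (by simp) (by simp only [h0]; exact ⟨by simp, hH, hu⟩) ?_
  · rw [hM.n0] at this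
    exact this.mono le_rfl fun σ' h _ => ⟨h.1.1, h.1.2.1⟩
  · rintro m hm σ₁ h12 f₁ ⟨ha, hH₁, hu₁⟩
    have hm : m < n := by rwa [hM.n0] at hm
    have hM₁ := hM.frame f₁ rfl
    have g11 : σ₁.ivar 11 = e * k := (f₁.iv 11 rfl).trans h11
    have gr : σ₁.rvar 0 = r := (f₁.rv 0 rfl).trans hr
    refine Run.seq ((run_insideRow hM₁ he hm g11 h12 gr).mono le_rfl fun σ₂ h₂ f₂ => ?_)
    have hM₂ := hM₁.frame f₂ rfl
    have k11 : σ₂.iarr 11 = σ₁.iarr 11 := f₂.ia 11 rfl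
    have k12 : σ₂.ivar 12 = m := (f₂.iv 12 rfl).trans h12
    refine Run.seq ((run_choose hM₂ he hm ((f₂.iv 11 rfl).trans g11) k12
      ((f₂.rv 0 rfl).trans gr) (by rwa [k11]) h₂
      (exists_fits hk hLU hU hm hH₁)).mono le_rfl ?_)
    rintro σ₃ ⟨haa, hak, hfit⟩ f₃
    have hM₃ := hM₂.frame f₃ rfl
    have k2 : σ₂.iarr 2 = σ₁.iarr 2 := f₂.ia 2 rfl
    rw [k2] at haa
    have c11 : σ₃.iarr 11 = σ₁.iarr 11 := (f₃.ia 11 rfl).trans k11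
    have c12 : σ₃.iarr 12 = σ₂.iarr 12 := f₃.ia 12 rfl
    refine (run_updateRow hM₃ (M := M) ((f₃.iv 12 rfl).trans k12) rfl hak
      (by rwa [c11]) (by rwa [c12])).mono le_rfl fun σ₄ h₄ f₄ => ?_
    have d2 : σ₄.iarr 2 = σ₃.iarr 2 := f₄.ia 2 rfl
    obtain ⟨hs₁, hs₂⟩ := hallDigits_fixed_succ hm hH₁ haa hak hfit
    rw [d2]
    refine ⟨fun i hi => ?_, hs₁, fun f hf => by rw [h₄ f hf, hs₂ f]⟩
    rcases Nat.lt_succ_iff_lt_or_eq.1 hi with h | rfl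
    · rw [haa i h.ne]; exact ha i h
    · exact ⟨hak, hfit.1⟩

/-- Restore the best tuple and its radius. -/
def restore : Cmd := .iset 11 (.var 19) ;; .rset 0 (.var 3)

/-- Write the tuple to the integer array `1`. -/
def writeTuple : Cmd := .forLt 13 1 (.istore 1 (.var 13) (.arr 6 (.add (.var 11) (.var 13))))

theorem run_writeTuple {σ : State} (hM : Mem σ n k L U D R) {e : ℕ} (he : e < k ^ k)
    (h11 : σ.ivar 11 = e * k) :
    Run writeTuple σ (k * 15 + 7) fun σ' => ∀ j < k, σ'.iarr 1 j = digit k e j := by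
  have := Run.forLt (x := 13) (y := 1)
    (c := .istore 1 (.var 13) (.arr 6 (.add (.var 11) (.var 13)))) (σ := σ) (T := 6)
    (fun m σ' => ∀ j < m, σ'.iarr 1 j = digit k e j) rfl rfl (by simp) (by simp) ?_
  · rw [hM.k1] at this
    exact this.mono le_rfl fun σ' h _ => h.1
  · rintro m hm σ₁ h13 f₁ hI
    have hm : m < k := by rwa [hM.k1] at hm
    have hM₁ := hM.frame f₁ rfl
    have g11 : σ₁.ivar 11 = e * k := (f₁.iv 11 rfl).trans h11
    refine Run.of_loopFree rfl ?_
    intro j hj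
    simp only [Cmd.den, IExpr.eval, putI_iarr, h13, g11, hM₁.t6 e he m hm, true_and]
    split_ifs with h
    · rw [h]
    · exact hI j (by omega)

/-- Compute the clustering for the best tuple. -/
def finish : Cmd := restore ;; check ;; writeTuple ;; greedy

/-- The test is repeated for the best tuple, not for its verdict but to restore the counts, which
later probes may have overwritten. -/
theorem run_finish {σ : State} (hM : Mem σ n k L U D R) (hk : 1 ≤ k) (hLU : L ≤ U)
    (hU : n ≤ k * U) {e : ℕ} {r : ℝ} (he : e < k ^ k) (h19 : σ.ivar 19 = e * k)
    (hr : σ.rvar 3 = r) (hH : HallDigits n k L U (Adm k D e r)) :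
    Run finish σ (checkTime n k + n * (greedyTime k + 9) + k * 15 + 18) fun σ' =>
      (∀ j < k, σ'.iarr 1 j = digit k e j) ∧
      (∀ i < n, σ'.iarr 2 i < k ∧ Adm k D e r i (σ'.iarr 2 i)) ∧
      HallDigits n k L U (Fixed (Adm k D e r) (σ'.iarr 2) n) := by
  refine Run.mono (T := 4 + (checkTime n k + ((k * 15 + 7) + (n * (greedyTime k + 9) + 7))))
    (Run.seq ((Run.of_loopFree (c := restore) (Q := fun σ₁ => σ₁.ivar 11 = e * k ∧ σ₁.rvar 0 = r)
      rfl (by simp [restore, Cmd.den, h19, hr])).mono (by decide) ?_)) (by omega)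
    (fun σ' h _ => h)
  rintro σ₁ ⟨g11, gr⟩ f₁
  have hM₁ := hM.frame f₁ rfl
  refine Run.seq ((run_check hM₁ he g11 gr).mono le_rfl ?_)
  rintro σ₂ ⟨-, h₂⟩ f₂
  have hM₂ := hM₁.frame f₂ rfl
  have k11 : σ₂.ivar 11 = e * k := (f₂.iv 11 rfl).trans g11
  refine Run.seq ((run_writeTuple hM₂ he k11).mono le_rfl fun σ₃ h₃ f₃ => ?_)
  have hM₃ := hM₂.frame f₃ rfl
  have c11 : σ₃.iarr 11 = σ₂.iarr 11 := f₃.ia 11 rfl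
  refine (run_greedy hM₃ hk hLU hU he ((f₃.iv 11 rfl).trans k11)
    ((f₃.rv 0 rfl).trans ((f₂.rv 0 rfl).trans gr)) (by rwa [c11]) hH).mono le_rfl ?_
  rintro σ₄ ⟨ha, hb⟩ f₄
  exact ⟨fun j hj => by rw [f₄.ia 1 rfl, h₃ j hj], ha, hb⟩

end

end BCenter

/-! ## What the tables of the program mean for the input -/

namespace BCenter

open RealRAM Finset

section
variable {n k d L U : ℕ} {P : Fin n → EuclideanSpace ℝ (Fin d)}

theorem input_rarr_zero (i : Fin n) (l : Fin d) :
    (input P k L U).rarr 0 (i * d + l) = P i l := by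
  have h : (⟨(i : ℕ) * d + l, by
      have := i.2; have := l.2
      calc (i : ℕ) * d + l < i * d + d := by omega
        _ = (i + 1) * d := by ring
        _ ≤ n * d := Nat.mul_le_mul_right _ i.2⟩ : Fin (n * d)) = finProdFinEquiv (i, l) := by
    ext; simp [finProdFinEquiv]; ring
  simp only [input, if_true]
  rw [dif_pos (by exact Fin.isLt (finProdFinEquiv (i, l)) |>.trans_eq' (by
    rw [← h]))]
  rw [h]
  simp

theorem sqd_input (i i' : Fin n) :
    sqd ((input P k L U).rarr 0) d i i' = dist (P i) (P i') ^ 2 := by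
  rw [EuclideanSpace.dist_sq_eq, sqd, ← Fin.sum_univ_eq_sum_range (fun l =>
    ((input P k L U).rarr 0 (i * d + l) - (input P k L U).rarr 0 (i' * d + l)) ^ 2)]
  refine sum_congr rfl fun l _ => ?_
  rw [input_rarr_zero, input_rarr_zero, Real.dist_eq, sq_abs]

/-- One selected point whose distance to `i` is at most every distance from `s j` to the earlier
points bounds one infimum by the other; squares of nonnegative numbers compare alike. -/
theorem isGonzalez_of_gonzalezSel {δ : ℕ → ℕ → ℝ} {σs : ℕ → ℕ} {s : Fin k → Fin n}
    (hδ : ∀ i i' : Fin n, δ i i' = dist (P i) (P i') ^ 2) (hs : ∀ j : Fin k, σs j = s j)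
    (h : GonzalezSel δ n k σs) : IsGonzalez P s := by
  intro j hj i
  obtain ⟨l, hl, hle⟩ := h j j.2 hj i i.2
  let l' : Fin k := ⟨l, hl.trans j.2⟩
  have hl' : l' ∈ Set.Iio j := hl
  refine (Metric.infDist_le_dist_of_mem (Set.mem_image_of_mem _ hl')).trans ?_
  refine (Metric.le_infDist ⟨_, Set.mem_image_of_mem _ hl'⟩).2 ?_
  rintro _ ⟨q, hq, rfl⟩
  have := hle q hq
  rw [hs q, hs j, show σs l = s l' from hs l', hδ, hδ, dist_comm, dist_comm (P (s q))] at this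
  exact (sq_le_sq₀ dist_nonneg dist_nonneg).1 this

theorem map_range_mul {α : Type*} (f : ℕ → α) :
    (Multiset.range (k * n)).map f =
      (univ : Finset (Fin n × Fin k)).val.map fun q => f ((q.2 : ℕ) * n + q.1) := by
  have h1 : (Multiset.range (k * n)).map f = (univ : Finset (Fin (k * n))).val.map fun m : Fin (k * n) => f m := by
    simp [Fin.univ_val_map, ← Multiset.coe_range, List.ofFn_eq_map, ← List.map_coe_finRange_eq_range,
      Function.comp_def]
  have h2 : (univ : Finset (Fin (k * n))) = (univ : Finset (Fin n × Fin k)).map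
      ((Equiv.prodComm _ _).trans finProdFinEquiv).toEmbedding :=
    (map_univ_equiv _).symm
  rw [h1, h2, Finset.map_val, Multiset.map_map]
  refine Multiset.map_congr rfl fun q _ => ?_
  simp [finProdFinEquiv, add_comm, mul_comm]

/-- Both lists are sorted and have the same entries with multiplicity, so they agree; taking square
roots preserves the order of the sorted squares. -/
theorem sortedDistances_eq {s : Fin k → Fin n} {A R : ℕ → ℝ}
    (hA : ∀ (j : Fin k) (i : Fin n), A (j * n + i) = dist (P i) (P (s j)) ^ 2)
    (hR : ∀ x y, x ≤ y → y < k * n → R x ≤ R y)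
    (hRA : (Multiset.range (k * n)).map R = (Multiset.range (k * n)).map A) :
    sortedDistances P s = (List.range (k * n)).map fun m => Real.sqrt (R m) := by
  have hp : ((List.range (k * n)).map fun m => Real.sqrt (R m)).Pairwise (· ≤ ·) := by
    rw [List.pairwise_map]
    refine List.pairwise_lt_range.imp_of_mem fun {x y} _ hy hxy => ?_
    exact Real.sqrt_le_sqrt (hR x y hxy.le (List.mem_range.1 hy))
  refine List.Perm.eq_of_pairwise' pairwise_sortedDistances hp (Multiset.coe_eq_coe.1 ?_)
  rw [sortedDistances, Multiset.sort_eq, ← Multiset.map_coe, Multiset.coe_range]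
  have : (Multiset.range (k * n)).map (fun m => Real.sqrt (R m)) =
      (Multiset.range (k * n)).map fun m => Real.sqrt (A m) := by
    have := congrArg (Multiset.map Real.sqrt) hRA
    simpa only [Multiset.map_map, Function.comp_def] using this
  rw [this, map_range_mul]
  refine Multiset.map_congr rfl fun q _ => ?_
  rw [hA, Real.sqrt_sq dist_nonneg]

/-- The tuple with the given number. -/
def tuple (k e : ℕ) (hk : 1 ≤ k) (j : Fin k) : Fin k := ⟨digit k e j, digit_lt hk _ _⟩

/-- Both sides are equivalent to the existence of a balanced assignment of points to balls
containing them. This links the real linear system to the test that the machine performs. -/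
theorem feasible_iff_hallDigits (hk : 1 ≤ k) (hLU : L ≤ U) (hU : n ≤ k * U) {s : Fin k → Fin n}
    {D : ℕ → ℕ → ℝ} (hD : ∀ (j : Fin k) (i : Fin n), D j i = dist (P i) (P (s j)) ^ 2)
    (e : ℕ) {r : ℝ} (hr : 0 ≤ r) :
    Feasible P L U (fun j => P (s (tuple k e hk j))) (Real.sqrt r) ↔
      HallDigits n k L U (Adm k D e r) := by
  have key : ∀ (i : Fin n) (j : Fin k),
      dist (P i) (P (s (tuple k e hk j))) ≤ Real.sqrt r ↔ Adm k D e r i j := by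
    intro i j
    rw [Adm, show digit k e j = (tuple k e hk j : ℕ) from rfl, hD,
      Real.le_sqrt dist_nonneg hr]
  rw [hallDigits_iff hk hLU hU]
  constructor
  · intro h
    obtain ⟨a, ha, hb⟩ := h.exists_assignment hLU
    exact ⟨a, fun i => (key i _).1 (ha i), hb⟩
  · rintro ⟨a, ha, hb⟩
    exact feasible_of_assignment (fun i => (key i _).2 (ha i)) hb

theorem radii_of_tables (hk : 1 ≤ k) (hn : 1 ≤ n) (hLU : L ≤ U) (hU : n ≤ k * U)
    {s : Fin k → Fin n} {D : ℕ → ℕ → ℝ} {R : ℕ → ℝ}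
    (hD : ∀ (j : Fin k) (i : Fin n), D j i = dist (P i) (P (s j)) ^ 2)
    (hR : ∀ m < k * n, 0 ≤ R m)
    (hS : sortedDistances P s = (List.range (k * n)).map fun m => Real.sqrt (R m)) :
    Radii n k L U D R (fun e => Feasible P L U fun j => P (s (tuple k e hk j)))
      (sortedDistances P s) := by
  have hg : ∀ m < k * n, (sortedDistances P s).getD m 0 = Real.sqrt (R m) := fun m hm => by
    rw [hS, List.getD_eq_getElem _ _ (by simpa using hm)]; simp
  refine ⟨by positivity, by rw [length_sortedDistances, mul_comm], hR, hg, fun e _ m hm => ?_⟩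
  rw [hg m hm]
  exact feasible_iff_hallDigits hk hLU hU hD e (hR m hm)

theorem search_eq (s : Fin k → Fin n) (τ : Fin k → Fin k) :
    search P L U s τ =
      probes (Feasible P L U fun j => P (s (τ j))) (sortedDistances P s) 0 (k * n) := by
  rw [search, length_sortedDistances, mul_comm]

theorem radius_eq_radiusOf (s : Fin k → Fin n) (τ : Fin k → Fin k) :
    radius P L U s τ = radiusOf (sortedDistances P s)
      (probes (Feasible P L U fun j => P (s (τ j))) (sortedDistances P s) 0 (k * n)) := by
  rw [radius_eq, search_eq]; rfl

/-- All tuples, in the order of their numbers. -/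
def allTuples (k : ℕ) (hk : 1 ≤ k) : List (Fin k → Fin k) :=
  (List.range (k ^ k)).map fun e => tuple k e hk

theorem exists_tuple_eq (hk : 1 ≤ k) (τ : Fin k → Fin k) : ∃ e < k ^ k, tuple k e hk = τ := by
  refine ⟨finFunctionFinEquiv τ, (finFunctionFinEquiv τ).2, ?_⟩
  conv_rhs => rw [← finFunctionFinEquiv.symm_apply_apply τ]
  rfl

theorem mem_allTuples (hk : 1 ≤ k) (τ : Fin k → Fin k) : τ ∈ allTuples k hk := by
  obtain ⟨e, he, rfl⟩ := exists_tuple_eq hk τ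
  exact List.mem_map.2 ⟨e, List.mem_range.2 he, rfl⟩

theorem nodup_allTuples (hk : 1 ≤ k) : (allTuples k hk).Nodup := by
  refine (List.nodup_map_iff_inj_on List.nodup_range).2 fun e he e' he' h => ?_
  have : finFunctionFinEquiv.symm (⟨e, List.mem_range.1 he⟩ : Fin (k ^ k)) =
      finFunctionFinEquiv.symm ⟨e', List.mem_range.1 he'⟩ := h
  simpa using finFunctionFinEquiv.symm.injective this

theorem searchRecord_allTuples (hk : 1 ≤ k) (s : Fin k → Fin n) :
    searchRecord P L U s (allTuples k hk) =
      recordUpTo n k (fun e => Feasible P L U fun j => P (s (tuple k e hk j)))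
        (sortedDistances P s) (k ^ k) := by
  rw [searchRecord, allTuples, recordUpTo, List.flatMap_map]
  refine List.flatMap_congr fun e _ => ?_
  rw [search_eq, probeRecord]
  congr 1
  rw [List.ofFn_eq_map, ← List.map_coe_finRange_eq_range, List.map_map]
  rfl

end

end BCenter

/-! ## The complete program -/

namespace BCenter

open RealRAM Finset

/-- Steps (1) and (2) of the algorithm, and the tables of the tuples and of Hall's conditions. -/
def prepare : Cmd := tables ;; gonzalez ;; sortArray ;; tupleTable ;; bounds

/-- The whole algorithm. -/
def program : Cmd := prepare ;; searchAll ;; finish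

/-- Time for the preparation. -/
def prepareTime (n k d : ℕ) : ℕ :=
  (16 * n + 16 * k + 20) + ((k * (n * (27 * d + 68) + 28) + 7) +
    ((Nat.clog 2 (k * n) * (k * n * 106 + 30) + 7) +
      ((k ^ k * (k * 34 + 26) + 10) + (k ^ k * (k * 25 + 26) + 7))))

/-- Time for the whole algorithm. -/
def programTime (n k d : ℕ) : ℕ :=
  prepareTime n k d + ((k ^ k * tupleSearchTime n k + 11) +
    (checkTime n k + n * (greedyTime k + 9) + k * 15 + 18))

section
variable {n k d L U : ℕ} {P : Fin n → EuclideanSpace ℝ (Fin d)}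

theorem run_prepare (hk : 1 ≤ k) (hn : 1 ≤ n) :
    Run prepare (input P k L U) (prepareTime n k d) fun σ =>
      ∃ (s : Fin k → Fin n) (D : ℕ → ℕ → ℝ) (R : ℕ → ℝ),
        Mem σ n k L U D R ∧ IsGonzalez P s ∧ (∀ j : Fin k, σ.iarr 0 j = s j) ∧
        (∀ (j : Fin k) (i : Fin n), D j i = dist (P i) (P (s j)) ^ 2) ∧
        (∀ m < k * n, 0 ≤ R m) ∧
        sortedDistances P s = (List.range (k * n)).map fun m => Real.sqrt (R m) := by
  set σ₀ := input P k L U with hσ₀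
  refine Run.seq ((run_tables σ₀ (n := n) (k := k) (d := d) rfl rfl rfl).mono le_rfl ?_)
  rintro σ₁ ⟨h₁4, h₁5, h₁6⟩ f₁
  have p₁ : σ₁.rarr 0 = σ₀.rarr 0 := f₁.ra 0 rfl
  refine Run.seq ((run_gonzalez σ₁ (n := n) (k := k) (d := d) (f₁.iv 0 rfl) (f₁.iv 1 rfl) (f₁.iv 2 rfl) hn h₁4 h₁5
    (fun m => by rw [f₁.ra 2 rfl, f₁.ra 1 rfl]; rfl)).mono le_rfl ?_)
  rintro σ₂ ⟨h₂0, h₂1, h₂2, hsel⟩ f₂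
  rw [p₁] at h₂1 hsel
  let s : Fin k → Fin n := fun j => ⟨σ₂.iarr 0 j, h₂0 j j.2⟩
  have hdist : ∀ (j : Fin k) (i : Fin n),
      σ₂.rarr 1 (j * n + i) = dist (P i) (P (s j)) ^ 2 := fun j i => by
    rw [h₂1 j j.2 i i.2, dist_comm]
    exact sqd_input (s j) i
  refine Run.seq ((run_sortArray σ₂ ((f₂.iv 6 rfl).trans h₁6)).mono le_rfl ?_)
  rintro σ₃ ⟨hmono, hperm⟩ f₃
  rw [funext h₂2] at hperm
  refine Run.seq ((run_tupleTable σ₃ (k := k) ((f₃.iv 1 rfl).trans ((f₂.iv 1 rfl).trans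
    (f₁.iv 1 rfl))) hk (fun m => by rw [f₃.ia 6 rfl, f₂.ia 6 rfl, f₁.ia 6 rfl]; rfl)).mono
    le_rfl ?_)
  rintro σ₄ ⟨h₄5, h₄8, h₄6⟩ f₄
  refine (run_bounds σ₄ (k := k) (L := L) (U := U) ((f₄.iv 1 rfl).trans ((f₃.iv 1 rfl).trans
    ((f₂.iv 1 rfl).trans (f₁.iv 1 rfl)))) h₄5 ((f₄.iv 3 rfl).trans ((f₃.iv 3 rfl).trans
    ((f₂.iv 3 rfl).trans (f₁.iv 3 rfl)))) ((f₄.iv 4 rfl).trans ((f₃.iv 4 rfl).trans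
    ((f₂.iv 4 rfl).trans (f₁.iv 4 rfl)))) h₄8 h₄6).mono le_rfl ?_
  rintro σ₅ ⟨h₅9, h₅10⟩ f₅
  have hsorted := sortedDistances_eq hdist hmono hperm
  refine ⟨s, fun j i => σ₂.rarr 1 (j * n + i), σ₃.rarr 2, ?_, ?_, ?_, hdist, ?_, hsorted⟩
  · constructor
    · rw [f₅.iv 0 rfl, f₄.iv 0 rfl, f₃.iv 0 rfl, f₂.iv 0 rfl, f₁.iv 0 rfl]; rfl
    · rw [f₅.iv 1 rfl, f₄.iv 1 rfl, f₃.iv 1 rfl, f₂.iv 1 rfl, f₁.iv 1 rfl]; rfl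
    · rw [f₅.iv 5 rfl, h₄5]
    · rw [f₅.iv 6 rfl, f₄.iv 6 rfl, f₃.iv 6 rfl, f₂.iv 6 rfl, h₁6]
    · rw [f₅.ia 5 rfl, f₄.ia 5 rfl, f₃.ia 5 rfl, f₂.ia 5 rfl]; exact h₁5
    · rw [f₅.ia 6 rfl]; exact h₄6
    · rw [f₅.ia 8 rfl]; exact h₄8
    · exact h₅9
    · exact h₅10
    · rw [f₅.ra 1 rfl, f₄.ra 1 rfl, f₃.ra 1 rfl]; exact fun _ _ _ _ => rfl
    · rw [f₅.ra 2 rfl, f₄.ra 2 rfl]; exact fun _ _ => rfl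
  · exact isGonzalez_of_gonzalezSel sqd_input (fun _ => rfl) hsel
  · rw [f₅.ia 0 rfl, f₄.ia 0 rfl, f₃.ia 0 rfl]; exact fun _ => rfl
  · intro m hm
    have hmem : σ₃.rarr 2 m ∈ (Multiset.range (k * n)).map (σ₂.rarr 1) := by
      rw [← hperm]
      exact Multiset.mem_map_of_mem _ (Multiset.mem_range.2 hm)
    rw [map_range_mul] at hmem
    obtain ⟨q, -, hq⟩ := Multiset.mem_map.1 hmem
    rw [← hq, hdist]
    positivity

theorem run_program (hk : 1 ≤ k) (hn : 1 ≤ n) (hL : k * L ≤ n) (hU : n ≤ k * U) :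
    Run program (input P k L U) (programTime n k d) fun σ =>
      ∃ (s : Fin k → Fin n) (τ : Fin k → Fin k) (a : Fin n → Fin k), ShowsRun σ P L U s τ a := by
  classical
  have hLU : L ≤ U := Nat.le_of_mul_le_mul_left (hL.trans hU) hk
  refine Run.seq ((run_prepare hk hn).mono le_rfl ?_)
  rintro σ₁ ⟨s, D, R, hM₁, hG, h₁0, hD, hR, hS⟩ -
  set p : ℕ → ℝ → Prop := fun e => Feasible P L U fun j => P (s (tuple k e hk j)) with hp
  have hrad : ∀ e, radius P L U s (tuple k e hk) =
      radiusOf (sortedDistances P s) (probes (p e) (sortedDistances P s) 0 (k * n)) :=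
    fun e => radius_eq_radiusOf s _
  refine Run.seq ((run_searchAll hM₁ (radii_of_tables hk hn hLU hU hD hR hS) hk).mono le_rfl ?_)
  rintro σ₂ ⟨hrec, e, he, h19, b, hb, h3, hbe, hmin⟩ f₂
  rw [← hrad] at hbe
  have hf := feasible_radius (P := P) (s := s) hLU hL hU hk hn (tuple k e hk)
  rw [← hbe, feasible_iff_hallDigits hk hLU hU hD e (hR b hb)] at hf
  refine (run_finish (hM₁.frame f₂ rfl) hk hLU hU he h19 h3 hf).mono le_rfl ?_
  rintro σ₃ ⟨htup, hclu, hfix⟩ f₃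
  let a : Fin n → Fin k := fun i => ⟨σ₃.iarr 2 i, (hclu i i.2).1⟩
  obtain ⟨a', ha', hbal⟩ := (hallDigits_iff hk hLU hU _).1 hfix
  -- With all `n` points fixed, each has one option left, so the assignment provided by Hall's
  -- conditions is the computed one, which is thereby balanced.
  have haa : a' = a := by
    funext i
    have := ha' i
    simp only [Fixed, i.2, if_true] at this
    exact Fin.ext this
  rw [haa] at hbal
  have hle : ∀ i, dist (P i) (P (s (tuple k e hk (a i)))) ≤ radius P L U s (tuple k e hk) := by
    intro i
    have := (hclu i i.2).2
    rw [Adm, show digit k e (σ₃.iarr 2 i) = (tuple k e hk (a i) : ℕ) from rfl, hD] at this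
    rw [← hbe]
    exact Real.le_sqrt_of_sq_le this
  refine ⟨s, tuple k e hk, a, ⟨hG, fun τ' => ?_, _, isSolution_of_assignment hle hbal,
    fun T j _ => rfl⟩, ?_, fun j => htup j j.2, fun i => rfl, allTuples k hk, nodup_allTuples hk,
    mem_allTuples hk, ?_⟩
  · obtain ⟨e', he', rfl⟩ := exists_tuple_eq hk τ'
    rw [hrad, hrad]
    exact hmin e' he'
  · rw [f₃.ia 0 rfl, f₂.ia 0 rfl]; exact h₁0
  · rw [searchRecord_allTuples, f₃.ia 3 rfl]; exact hrec

end

/-! ## The running time -/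

/-- The constant is the time formula with `n`, `d` and the logarithmic factors set to `1`: each
monomial that occurs in them is at most `n * (q + d)`. -/
theorem programTime_le (k : ℕ) : ∃ C : ℕ, ∀ n d q : ℕ, 1 ≤ n → 1 ≤ d → Nat.clog 2 (k * n) ≤ q →
    Nat.size (k * n) ≤ q → programTime n k d ≤ C * (n * (q + d)) := by
  refine ⟨(16 + 16 * k + 20) + ((k * (27 + 68 + 28) + 7) + ((k * 106 + 30 + 7) +
      ((k ^ k * (k * 34 + 26) + 10) + (k ^ k * (k * 25 + 26) + 7)))) +
      ((k ^ k * (k * 19 + (k ^ k * (k * 31 + 22 + 40) + 9 + 45) + 60) + 11) +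
        ((k ^ k * (k * 31 + 22 + 40) + 9) + (greedyTime k + 9) + k * 15 + 18)),
    fun n d q hn hd hc hs => ?_⟩
  set E := k ^ k
  set X := n * (q + d) with hX
  have hnd : n * d ≤ X := Nat.mul_le_mul_left _ (by omega)
  have hnq : n * q ≤ X := Nat.mul_le_mul_left _ (by omega)
  have hnX : n ≤ X := (Nat.le_mul_of_pos_right n hd).trans hnd
  have hqX : q ≤ X := (Nat.le_mul_of_pos_left q hn).trans hnq
  have h1X : 1 ≤ X := hn.trans hnX
  have t1 : 16 * n + 16 * k + 20 ≤ (16 + 16 * k + 20) * X := by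
    linarith [Nat.mul_le_mul_left (16 * k) h1X]
  have t2 : k * (n * (27 * d + 68) + 28) + 7 ≤ (k * (27 + 68 + 28) + 7) * X := by
    linarith [Nat.mul_le_mul_left (27 * k) hnd, Nat.mul_le_mul_left (68 * k) hnX,
      Nat.mul_le_mul_left (28 * k) h1X]
  have t3 : Nat.clog 2 (k * n) * (k * n * 106 + 30) + 7 ≤ (k * 106 + 30 + 7) * X := by
    linarith [Nat.mul_le_mul_right (k * n * 106 + 30) hc, Nat.mul_le_mul_left (106 * k) hnq]
  have t4 : E * (k * 34 + 26) + 10 ≤ (E * (k * 34 + 26) + 10) * X := Nat.le_mul_of_pos_right _ h1X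
  have t5 : E * (k * 25 + 26) + 7 ≤ (E * (k * 25 + 26) + 7) * X := Nat.le_mul_of_pos_right _ h1X
  have t6 : q * (checkTime n k + 45) ≤ (E * (k * 31 + 22 + 40) + 9 + 45) * X := by
    change q * (E * (n * (k * 31 + 22) + 40) + 9 + 45) ≤ _
    linarith [Nat.mul_le_mul_left (E * (k * 31 + 22)) hnq, Nat.mul_le_mul_left (E * 40) hqX]
  have t7 : tupleSearchTime n k ≤ (k * 19 + (E * (k * 31 + 22 + 40) + 9 + 45) + 60) * X := by
    unfold tupleSearchTime
    linarith [Nat.mul_le_mul_right (checkTime n k + 45) hs, Nat.mul_le_mul_left (k * 19) h1X]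
  have t8 : checkTime n k ≤ (E * (k * 31 + 22 + 40) + 9) * X := by
    change E * (n * (k * 31 + 22) + 40) + 9 ≤ _
    linarith [Nat.mul_le_mul_left (E * (k * 31 + 22)) hnX, Nat.mul_le_mul_left (E * 40) h1X]
  have t9 : n * (greedyTime k + 9) ≤ (greedyTime k + 9) * X := by
    linarith [Nat.mul_le_mul_left (greedyTime k + 9) hnX]
  unfold programTime prepareTime
  simp only [show k ^ k = E from rfl]
  linarith [Nat.mul_le_mul_left E t7, Nat.mul_le_mul_left (k * 15) h1X]

theorem exists_programTime_le (k : ℕ) : ∃ C : ℝ, ∀ n d : ℕ, 1 ≤ n → 1 ≤ d →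
    (programTime n k d : ℝ) ≤ C * (n * (Real.log n + d)) := by
  obtain ⟨C, hC⟩ := programTime_le k
  refine ⟨C * (k + 3), fun n d hn hd => ?_⟩
  -- From `k < 2 ^ k` and `n < 2 ^ (Nat.log 2 n + 1)`; the exponent serves as `q`, bounding both
  -- logarithmic quantities.
  have hlt : k * n < 2 ^ (k + Nat.log 2 n + 1) := by
    rw [add_assoc, pow_add]
    exact Nat.mul_lt_mul'' Nat.lt_two_pow_self (Nat.lt_pow_succ_log_self (by norm_num) n)
  have h := hC n d (k + Nat.log 2 n + 1) hn hd (Nat.clog_le_of_le_pow hlt.le) (Nat.size_le.2 hlt)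
  have hn' : (1 : ℝ) ≤ n := by exact_mod_cast hn
  have hd' : (1 : ℝ) ≤ d := by exact_mod_cast hd
  -- The factor `2` suffices because `Real.log 2 > 1 / 2`. For `n = 1` the logarithm vanishes, and
  -- `d ≥ 1` absorbs the additive constants.
  have hlog : (Nat.log 2 n : ℝ) ≤ 2 * Real.log n := by
    have h1 : (Nat.log 2 n : ℝ) * Real.log 2 ≤ Real.log n := by
      rw [← Real.log_pow]
      refine Real.log_le_log (by positivity) ?_
      exact_mod_cast Nat.pow_log_le_self 2 (by omega)
    have h2 := Real.log_two_gt_d9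
    nlinarith [(Nat.cast_nonneg (Nat.log 2 n) : (0 : ℝ) ≤ _)]
  have hlog0 := Real.log_nonneg hn'
  calc (programTime n k d : ℝ) ≤ C * (n * ((k + Nat.log 2 n + 1) + d)) := by exact_mod_cast h
    _ ≤ C * (n * ((k + 3) * (Real.log n + d))) := by
        gcongr
        nlinarith [mul_nonneg (Nat.cast_nonneg k : (0 : ℝ) ≤ k) hlog0,
          mul_nonneg (Nat.cast_nonneg k : (0 : ℝ) ≤ k) (sub_nonneg.2 hd')]
    _ = C * (k + 3) * (n * (Real.log n + d)) := by ring

end BCenter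

theorem theorem3 :
    -- Everything the algorithm may return is a 4-approximation.
    (∀ (k n d L U : ℕ) (P : Fin n → EuclideanSpace ℝ (Fin d)),
      1 ≤ k → 1 ≤ L → k * L ≤ n → n ≤ k * U → U ≤ n →
      ∀ (s : Fin k → Fin n) (τ : Fin k → Fin k) (a : Fin n → Fin k),
        BCenter.Returns P L U s τ a →
        BCenter.IsApprox 4 P L U (fun j => P (s (τ j))) a) ∧
    -- The algorithm runs in time O(n (log n + d)) for constant k.
    ∃ prog : RealRAM.Cmd, ∀ k : ℕ, 1 ≤ k → ∃ C : ℝ,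
      ∀ (n d L U : ℕ) (P : Fin n → EuclideanSpace ℝ (Fin d)),
        1 ≤ d → 1 ≤ L → k * L ≤ n → n ≤ k * U → U ≤ n →
        ∃ (t : ℕ) (σ : RealRAM.State) (s : Fin k → Fin n) (τ : Fin k → Fin k) (a : Fin n → Fin k),
          RealRAM.Exec prog (BCenter.input P k L U) t σ ∧
          (t : ℝ) ≤ C * (n * (Real.log n + d)) ∧
          BCenter.ShowsRun σ P L U s τ a := by
  refine ⟨fun k n d L U P hk hL hkL hkU _ s τ a h => h.isApprox hk hL hkL hkU,
    BCenter.program, fun k hk => ?_⟩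
  obtain ⟨C, hC⟩ := BCenter.exists_programTime_le k
  refine ⟨C, fun n d L U P hd hL hkL hkU _ => ?_⟩
  have hn : 1 ≤ n := (Nat.mul_pos hk hL).trans_le hkL
  obtain ⟨t, σ, hrun, ht, s, τ, a, hshow⟩ := BCenter.run_program (P := P) hk hn hkL hkU
  exact ⟨t, σ, s, τ, a, hrun, (Nat.cast_le.2 ht).trans (hC n d hn hd), hshow⟩
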